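/- Let $p\in\mathbb{C}^*$ with $|p|<1$, $(u;p)_\infty=\prod_{i\ge0}(1-p^iu)$ and $\theta(u)=(u;p)_\infty(p/u;p)_\infty$. Let $n\ge1$, $s\ge2$, $m=2s+2$, and let $t,a_1,\dots,a_m\in\mathbb{C}^*$ satisfy $t^{2n-2}a_1\cdots a_m=1$. Assume that $t,a_1,\dots,a_s$ are generic in the following sense: $t^k\notin p^{\mathbb{Z}}$ for $1\le k\le n$; $t^ka_i/a_j\notin p^{\mathbb{Z}}$ for $i\ne j$ in $\{1,\dots,s\}$ and $k\in\mathbb{Z}$ with $|k|\le n$; and $t^ka_ia_j\notin p^{\mathbb{Z}}$ for $i,j\in\{1,\dots,s\}$ and $0\le k\le 2n-2$. For $N\ge0$ let $\mathcal{H}_{s-1,N}$ be the space of holomorphic functions $f$ on $(\mathbb{C}^*)^N$ that are invariant under permutations and inversions of the coordinates and satisfy $f(z_1,\dots,pz_i,\dots,z_N)=f(z)(pz_i^2)^{-s+1}$ for all $i$. Let $Z_{s,N}=\{\mu\in\mathbb{N}^s:\mu_1+\cdots+\mu_s=N\}$, and for $\mu\in Z_{s,n}$ put $$(a)_{t,\mu}=(a_1,ta_1,\dots,t^{\mu_1-1}a_1,\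 \dots,\ a_s,ta_s,\dots,t^{\mu_s-1}a_s)\in(\mathbb{C}^*)^n.$$ Write $z_{\hat i}$ for $z$ with its $i$-th coordinate removed, and set $$f_i^+(z)=\frac{\prod_{k=1}^m\theta(a_kz_i)}{z_i^s\,\theta(z_i^2)}\prod_{j\ne i}\frac{\theta(tz_iz_j)\,\theta(tz_i/z_j)}{\theta(z_iz_j)\,\theta(z_i/z_j)},\qquad f_i^-(z)=f_i^+(z^{-1}).$$ For $\varphi\in\mathcal{H}_{s-1,n-1}$ let $\nabla^\Psi_{\mathrm{sym}}\varphi\in\mathcal{H}_{s-1,n}$ be the holomorphic function represented by the meromorphic function $\sum_{i=1}^n(f_i^+(z)+f_i^-(z))\,\varphi(z_{\hat i})$, and write $\psi_1\equiv_\Psi\psi_2$ if $\psi_1-\psi_2\in\nabla^\Psi_{\mathrm{sym}}\mathcal{H}_{s-1,n-1}$. Fix any square roots of $t,a_1,\dots,a_m$; they determine multiplicatively the square root $u^{1/2}$ of every monomial $u$ in $t,a_1,\dots,a_m$ below. Put $[u]=u^{-1/2}\theta(u)$ and $[u]_k=[u][tu]\cdots[t^{k-1}u]$. Then there is a unique basis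 $(E_\mu)_{\mu\in Z_{s,n}}$ of $\mathcal{H}_{s-1,n}$ with $E_\mu((a)_{t,\nu})=\delta_{\mu,\nu}$ for all $\mu,\nu\in Z_{s,n}$, and, with the renormalization $\widetilde E_\mu=K_\mu E_\mu$, where $$K_\mu=\prod_{i,j=1}^s[ta_i/a_j]_{\mu_i}\prod_{i=1}^s\prod_{j=s+1}^m[a_ia_j]_{\mu_i}\prod_{1\le i<j\le s}[a_ia_j]_{\mu_i+\mu_j},$$ one has, for every $\mu\in Z_{s,n}$ and every integer $l$ with $0\le l\le\mu_s$, $$\widetilde E_\mu\equiv_\Psi\sum_{\nu}R_{\mu,\nu}\,\widetilde E_\nu .$$ The sum is over the $\nu\in Z_{s,n}$ with $\nu_s=\mu_s-l$ and $\mu_i\le\nu_i$ for $1\le i\le s-1$, and $$R_{\mu,\nu}=\prod_{j=1}^{s-1}\frac{[t^{\mu_s-\mu_j}a_s/a_j]}{[t^{\nu_s-\nu_j}a_s/a_j]}\ \prod_{j=1}^{s}\frac{[t^{\nu_s-\mu_j}a_s/a_j]_{\mu_s-\nu_s}}{\prod_{i=1}^{s-1}[t^{\mu_i-\mu_j+1}a_i/a_j]_{\nu_i-\mu_i}}.$$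 -/

import Mathlib

open Finset

namespace EllipticBC

/-! The algebraic torus `(ℂˣ)ⁿ` is the type `Fin n → ℂˣ`; all parameters are elements of `ℂˣ`.
Throughout, `s = r + 1` and `m = 2 s + 2 = (r + 1) + (r + 3)`, the `m` parameters being
`a (Fin.castAdd _ i)` for `i < s` (the first `s` ones) and `a (Fin.natAdd _ j)` for `j < s + 2`
(the remaining ones). The last of the first `s` indices is `Fin.last r`, the others are
`Fin.castSucc j` for `j : Fin r`. -/

/-- The infinite product `(u; p)_∞ = ∏_{i ≥ 0} (1 - pⁱ u)`, for `|p| < 1`. -/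
noncomputable def qPoch (u p : ℂ) : ℂ := ∏' i : ℕ, (1 - p ^ i * u)

/-- The multiplicative theta function `θ(u; p) = (u; p)_∞ (p/u; p)_∞`. -/
noncomputable def theta (p u : ℂˣ) : ℂ := qPoch u p * qPoch ((p / u : ℂˣ) : ℂ) p

/-- The odd theta function `[u] = u^{-1/2} θ(u; p)`, as a function of a square root `x` of `u`:
`oddTheta p x = [x²] = x⁻¹ θ(x²; p)`. -/
noncomputable def oddTheta (p x : ℂˣ) : ℂ := ((x⁻¹ : ℂˣ) : ℂ) * theta p (x ^ 2)

/-- The shifted factorial `[u]_k = [u][tu]⋯[t^{k-1}u]`, where `u = x²` and `t = τ²`. -/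
noncomputable def oddThetaFact (p τ x : ℂˣ) (k : ℕ) : ℂ :=
  ∏ i ∈ range k, oddTheta p (τ ^ i * x)

/-- Holomorphic functions on the torus `(ℂˣ)ⁿ`. -/
def IsHolomorphic {n : ℕ} (f : (Fin n → ℂˣ) → ℂ) : Prop :=
  ∃ F : (Fin n → ℂ) → ℂ, DifferentiableOn ℂ F {w | ∀ i, w i ≠ 0} ∧
    ∀ z : Fin n → ℂˣ, F (fun i => (z i : ℂ)) = f z

/-- The space `ℋ_{d,n}^{(p)}` of holomorphic functions on `(ℂˣ)ⁿ` that are invariant under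
permutations and inversions of the coordinates and satisfy
`f(z₁, …, p zᵢ, …, zₙ) = f(z) (p zᵢ²)^{-d}` for all `i`. -/
def H (p : ℂˣ) (d n : ℕ) : Submodule ℂ ((Fin n → ℂˣ) → ℂ) where
  carrier := {f | IsHolomorphic f ∧
    (∀ (σ : Equiv.Perm (Fin n)) (z : Fin n → ℂˣ), f (fun i => z (σ i)) = f z) ∧
    (∀ (i : Fin n) (z : Fin n → ℂˣ), f (Function.update z i (z i)⁻¹) = f z) ∧
    (∀ (i : Fin n) (z : Fin n → ℂˣ), f (Function.update z i (p * z i)) =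
      f z * (((p * z i ^ 2) ^ (-(d : ℤ)) : ℂˣ) : ℂ))}
  add_mem' := by
    rintro f g ⟨⟨F, hF, hFf⟩, h1, h2, h3⟩ ⟨⟨G, hG, hGg⟩, k1, k2, k3⟩
    refine ⟨⟨F + G, hF.add hG, fun z => ?_⟩, fun σ z => ?_, fun i z => ?_, fun i z => ?_⟩
    · simp [hFf, hGg]
    · simp [h1 σ z, k1 σ z]
    · simp [h2 i z, k2 i z]
    · simp only [Pi.add_apply, h3 i z, k3 i z]; ring
  zero_mem' := ⟨⟨0, differentiableOn_const 0, fun _ => rfl⟩, by simp, by simp, by simp⟩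
  smul_mem' := by
    rintro c f ⟨⟨F, hF, hFf⟩, h1, h2, h3⟩
    refine ⟨⟨c • F, hF.const_smul c, fun z => ?_⟩, fun σ z => ?_, fun i z => ?_, fun i z => ?_⟩
    · simp [hFf]
    · simp [h1 σ z]
    · simp [h2 i z]
    · simp only [Pi.smul_apply, smul_eq_mul, h3 i z]; ring

/-- The index set `Z_{s,n} = {μ ∈ ℕˢ : μ₁ + ⋯ + μ_s = n}`. -/
abbrev Z (s n : ℕ) : Type := {μ : Fin s → ℕ // ∑ i, μ i = n}

instance (s n : ℕ) : Fintype (Z s n) :=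
  Fintype.subtype (Finset.piAntidiag Finset.univ n) (by simp)

/-- The reference point
`(c)_{t,μ} = (c₁, t c₁, …, t^{μ₁-1} c₁, …, c_s, t c_s, …, t^{μ_s-1} c_s)` of `(ℂˣ)ⁿ`. -/
def refPoint {s n : ℕ} (t : ℂˣ) (c : Fin s → ℂˣ) (μ : Z s n) : Fin n → ℂˣ := fun i =>
  let b : (k : Fin s) × Fin (μ.1 k) := finSigmaFinEquiv.symm (Fin.cast μ.2.symm i)
  t ^ (b.2 : ℕ) * c b.1

/-- `E` is a basis of `ℋ_{s-1,n}^{(p)}` (with `s = r + 1`) such that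
`E_μ((c)_{t,ν}) = δ_{μ,ν}`. -/
structure IsInterpolationBasis {r n : ℕ} (p t : ℂˣ) (c : Fin (r + 1) → ℂˣ)
    (E : Z (r + 1) n → (Fin n → ℂˣ) → ℂ) : Prop where
  linearIndependent : LinearIndependent ℂ E
  span_eq : Submodule.span ℂ (Set.range E) = H p r n
  interpolation : ∀ μ ν, E μ (refPoint t c ν) = if μ = ν then 1 else 0

/-- An interpolation basis is unique as soon as it exists. -/
theorem IsInterpolationBasis.unique {r n : ℕ} {p t : ℂˣ} {c : Fin (r + 1) → ℂˣ}
    {E E' : Z (r + 1) n → (Fin n → ℂˣ) → ℂ} (hE : IsInterpolationBasis p t c E)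
    (hE' : IsInterpolationBasis p t c E') : E = E' := by
  funext μ
  have hmem : E' μ ∈ Submodule.span ℂ (Set.range E) := by
    rw [hE.span_eq, ← hE'.span_eq]; exact Submodule.subset_span ⟨μ, rfl⟩
  obtain ⟨w, hw⟩ := (Submodule.mem_span_range_iff_exists_fun ℂ).1 hmem
  have hcoef : ∀ ν, w ν = if μ = ν then 1 else 0 := by
    intro ν
    have h := congrFun hw (refPoint t c ν)
    rw [hE'.interpolation] at h
    simpa [Finset.sum_apply, hE.interpolation] using h
  rw [← hw]
  simp [hcoef]

open Classical in
/-- The interpolation functions `E_μ(c; z; p)`, `μ ∈ Z_{s,n}`: the unique interpolation basis of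
`ℋ_{s-1,n}^{(p)}` with respect to `c` (and `0` if there is none). -/
noncomputable def interpE {r n : ℕ} (p t : ℂˣ) (c : Fin (r + 1) → ℂˣ) :
    Z (r + 1) n → (Fin n → ℂˣ) → ℂ :=
  if h : ∃ E : Z (r + 1) n → (Fin n → ℂˣ) → ℂ, IsInterpolationBasis p t c E then h.choose else 0

/-- `f_i^+(z) = ∏_k θ(a_k z_i) / (z_i^s θ(z_i²)) ·
∏_{j ≠ i} θ(t z_i z_j) θ(t z_i / z_j) / (θ(z_i z_j) θ(z_i / z_j))`. -/
noncomputable def fPlus {r n : ℕ} (p t : ℂˣ) (a : Fin ((r + 1) + (r + 3)) → ℂˣ)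
    (i : Fin n) (z : Fin n → ℂˣ) : ℂ :=
  (∏ k, theta p (a k * z i)) / ((z i : ℂ) ^ (r + 1) * theta p (z i ^ 2)) *
    ∏ j ∈ univ.erase i, (theta p (t * z i * z j) * theta p (t * z i / z j)) /
      (theta p (z i * z j) * theta p (z i / z j))

/-- `f_i^-(z) = f_i^+(z⁻¹)`. -/
noncomputable def fMinus {r n : ℕ} (p t : ℂˣ) (a : Fin ((r + 1) + (r + 3)) → ℂˣ)
    (i : Fin n) (z : Fin n → ℂˣ) : ℂ := fPlus p t a i z⁻¹

/-- The points of the torus at which no denominator of the `f_i^±` vanishes. -/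
def IsRegularPoint {n : ℕ} (p : ℂˣ) (z : Fin n → ℂˣ) : Prop :=
  ∀ i, theta p (z i ^ 2) ≠ 0 ∧
    ∀ j, j ≠ i → theta p (z i * z j) ≠ 0 ∧ theta p (z i / z j) ≠ 0

/-- The formula `∑_i (f_i^+(z) + f_i^-(z)) φ(z_î)`, where `z_î` is `z` without its `i`-th
coordinate; it is meaningful at regular points. -/
noncomputable def nablaFormula {r n : ℕ} (p t : ℂˣ) (a : Fin ((r + 1) + (r + 3)) → ℂˣ)
    (φ : (Fin n → ℂˣ) → ℂ) (z : Fin (n + 1) → ℂˣ) : ℂ :=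
  ∑ i, (fPlus p t a i z + fMinus p t a i z) * φ (i.removeNth z)

/-- The image of `∇_sym^Ψ : ℋ_{s-1,n}^{(p)} → ℋ_{s-1,n+1}^{(p)}`. As `∇_sym^Ψ φ` is the
holomorphic function represented by the meromorphic expression `nablaFormula p t a φ`,
`∇_sym^Ψ φ = ψ` means that `ψ` agrees with this expression wherever no denominator vanishes. -/
noncomputable def nablaImage {r : ℕ} (n : ℕ) (p t : ℂˣ) (a : Fin ((r + 1) + (r + 3)) → ℂˣ) :
    Submodule ℂ ((Fin (n + 1) → ℂˣ) → ℂ) where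
  carrier := {ψ | ψ ∈ H p r (n + 1) ∧ ∃ φ ∈ H p r n,
    ∀ z, IsRegularPoint p z → ψ z = nablaFormula p t a φ z}
  add_mem' := by
    rintro ψ χ ⟨hψ, φ, hφ, h⟩ ⟨hχ, η, hη, k⟩
    refine ⟨add_mem hψ hχ, φ + η, add_mem hφ hη, fun z hz => ?_⟩
    simp [nablaFormula, h z hz, k z hz, mul_add, sum_add_distrib]
  zero_mem' := ⟨zero_mem _, 0, zero_mem _, fun z _ => by simp [nablaFormula]⟩
  smul_mem' := by
    rintro b ψ ⟨hψ, φ, hφ, h⟩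
    refine ⟨Submodule.smul_mem _ b hψ, b • φ, Submodule.smul_mem _ b hφ, fun z hz => ?_⟩
    simp only [nablaFormula, Pi.smul_apply, smul_eq_mul, h z hz, mul_sum]
    exact sum_congr rfl fun i _ => by ring

/-- The congruence `ψ₁ ≡_Ψ ψ₂` modulo the image of `∇_sym^Ψ`. -/
def PsiCongr {r n : ℕ} (p t : ℂˣ) (a : Fin ((r + 1) + (r + 3)) → ℂˣ)
    (ψ₁ ψ₂ : (Fin (n + 1) → ℂˣ) → ℂ) : Prop := ψ₁ - ψ₂ ∈ nablaImage n p t a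

/-- The first `s = r + 1` of the parameters. -/
def firstParams {r : ℕ} (a : Fin ((r + 1) + (r + 3)) → ℂˣ) : Fin (r + 1) → ℂˣ :=
  fun i => a (Fin.castAdd (r + 3) i)

/-- The remaining `m - s = r + 3` parameters. -/
def restParams {r : ℕ} (a : Fin ((r + 1) + (r + 3)) → ℂˣ) : Fin (r + 3) → ℂˣ :=
  fun j => a (Fin.natAdd (r + 1) j)

/-- `K_μ = ∏_{i,j ≤ s} [t a_i/a_j]_{μ_i} ∏_{i ≤ s < j} [a_i a_j]_{μ_i}
∏_{i < j ≤ s} [a_i a_j]_{μ_i + μ_j}`, in terms of square roots `τ`, `α_k` of `t`, `a_k`. -/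
noncomputable def normK {r : ℕ} (p τ : ℂˣ) (α : Fin ((r + 1) + (r + 3)) → ℂˣ)
    (μ : Fin (r + 1) → ℕ) : ℂ :=
  (∏ i, ∏ j, oddThetaFact p τ (τ * firstParams α i / firstParams α j) (μ i)) *
  (∏ i, ∏ j, oddThetaFact p τ (firstParams α i * restParams α j) (μ i)) *
  ∏ i, ∏ j ∈ Ioi i, oddThetaFact p τ (firstParams α i * firstParams α j) (μ i + μ j)

/-- The renormalized interpolation functions `Ẽ_μ = K_μ E_μ(a₁, …, a_s; z; p)`, for chosen square
roots `τ` of `t` and `α_k` of `a_k` (which enter `K_μ` only). -/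
noncomputable def interpETilde {r n : ℕ} (p t τ : ℂˣ) (a α : Fin ((r + 1) + (r + 3)) → ℂˣ)
    (μ : Z (r + 1) n) : (Fin n → ℂˣ) → ℂ :=
  normK p τ α μ.1 • interpE p t (firstParams a) μ

/-- The coefficient
`R_{μ,ν} = ∏_{j<s} [t^{μ_s-μ_j} a_s/a_j] / [t^{ν_s-ν_j} a_s/a_j] ·
∏_{j≤s} ([t^{ν_s-μ_j} a_s/a_j]_{μ_s-ν_s} / ∏_{i<s} [t^{μ_i-μ_j+1} a_i/a_j]_{ν_i-μ_i})`
for `ν_s ≤ μ_s` and `μ_i ≤ ν_i` (`i < s`), in terms of square roots `τ`, `α_i` of `t`, `a_i`. -/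
noncomputable def coeffR {r : ℕ} (p τ : ℂˣ) (α : Fin (r + 1) → ℂˣ)
    (μ ν : Fin (r + 1) → ℕ) : ℂ :=
  (∏ j : Fin r,
    oddTheta p (τ ^ ((μ (Fin.last r) : ℤ) - μ j.castSucc) * (α (Fin.last r) / α j.castSucc)) /
    oddTheta p (τ ^ ((ν (Fin.last r) : ℤ) - ν j.castSucc) * (α (Fin.last r) / α j.castSucc))) *
  ∏ j : Fin (r + 1),
    oddThetaFact p τ (τ ^ ((ν (Fin.last r) : ℤ) - μ j) * (α (Fin.last r) / α j))
      (μ (Fin.last r) - ν (Fin.last r)) /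
    ∏ i : Fin r,
      oddThetaFact p τ (τ ^ ((μ i.castSucc : ℤ) - μ j + 1) * (α i.castSucc / α j))
        (ν i.castSucc - μ i.castSucc)

/-- Genericity of `t` and `c = (c₁, …, c_s)` in the case of `n` variables, for which the
interpolation basis exists, the reference points are regular, and the denominators of the
coefficients `R_{μ,ν}` do not vanish: none of the finitely many numbers below is in `p^ℤ`. -/
structure IsGeneric {s : ℕ} (n : ℕ) (p t : ℂˣ) (c : Fin s → ℂˣ) : Prop where
  pow_ne : ∀ k : ℕ, 1 ≤ k → k ≤ n → ∀ N : ℤ, t ^ k ≠ p ^ N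
  div_ne : ∀ i j, i ≠ j → ∀ k : ℤ, |k| ≤ n → ∀ N : ℤ, t ^ k * (c i / c j) ≠ p ^ N
  mul_ne : ∀ i j, ∀ k : ℕ, k ≤ 2 * n - 2 → ∀ N : ℤ, t ^ k * (c i * c j) ≠ p ^ N

end EllipticBC

open EllipticBC

/-! Existence of the basis is a triangularity argument. For `o < s` and `μ`, the symmetric product
over the coordinates of `∏_{j ≠ o} e(z_i, t^{μ_j} a_j)` vanishes at the reference point of `ν`
unless `ν_j ≤ μ_j` for all `j ≠ o`, so evaluation of `ℋ` at the reference points is onto. It is also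
injective (`eq_zero_of_ref`): an even theta function of degree `s - 1` in one variable is determined
by its values at `s` inequivalent points, and the reference points allow this to be used variable by
variable.

For the congruence, apply `∇` to the interpolation function `E_λ` in one variable fewer and evaluate
at a reference point. The zeros of `f_i^±` kill every term except those where `z_i` is the last
element of its string, whence `∇E_λ = ∑_b C_{λ,b} E_{λ+ε_b}` (`nabla_interp_eval`,
`sum_topCoeff_mem_nablaImage`). To pass from reference points to all regular points, clear
denominators in one variable: the numerator is an odd theta function that also vanishes at the
apparent poles `z_i = z_k`, since the residues cancel, and so `s` further zeros force it to vanish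
(`slicewiseDetermined_nabla_sub`). Only the balancing condition makes this numerator quasi-periodic.

The products in `C_{λ,b}` telescope, and `K_{λ+ε_b}` is built to absorb them. Up to a factor
independent of `b`, the relation becomes `∑_b Ẽ_{λ+ε_b} / ∏_{j≠b} [t^{λ_b+1} a_b / (t^{λ_j} a_j)] ≡
0` (`normK_add_single_eq`, `sum_interpETilde_mem_nablaImage`).

Solving for `Ẽ_{λ+ε_s}` lowers the last part of the index by one, so induction on `l` reduces the
theorem to a recursion for `R_{μ,ν}` (`coeffRSum_sub_mem`). That recursion is the elliptic partial
fraction identity of type `A` with nodes `t^{ν_i} a_i` and `t^{μ_i} a_i`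
(`sum_prod_oddTheta_eq_zero`, `sum_recTerm`). -/

namespace EllipticBC

/-! ### The theta function and the even kernel `e(u, v)` -/

theorem summable_norm_pow_mul {p : ℂ} (hp : ‖p‖ < 1) (u : ℂ) :
    Summable fun i : ℕ => ‖-(p ^ i * u)‖ := by
  simpa [norm_mul, norm_pow] using
    (summable_geometric_of_lt_one (norm_nonneg p) hp).mul_right ‖u‖

theorem multipliable_qPoch {p : ℂ} (hp : ‖p‖ < 1) (u : ℂ) :
    Multipliable fun i : ℕ => 1 - p ^ i * u := by
  simpa [sub_eq_add_neg] using multipliable_one_add_of_summable (summable_norm_pow_mul hp u)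

theorem qPoch_eq {p : ℂ} (hp : ‖p‖ < 1) (u : ℂ) :
    qPoch u p = (1 - u) * qPoch (p * u) p := by
  have h := tprod_eq_zero_mul' (f := fun i : ℕ => 1 - p ^ i * u)
    (by simpa [pow_succ, mul_assoc] using multipliable_qPoch hp (p * u))
  simpa [qPoch, pow_succ, mul_assoc] using h

theorem qPoch_ne_zero {p u : ℂ} (hp : ‖p‖ < 1) (h : ∀ i : ℕ, p ^ i * u ≠ 1) :
    qPoch u p ≠ 0 := by
  have := tprod_one_add_ne_zero_of_summable (f := fun i : ℕ => -(p ^ i * u))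
    (fun i hi => h i (by linear_combination -hi)) (summable_norm_pow_mul hp u)
  simpa [qPoch, sub_eq_add_neg] using this

theorem differentiable_qPoch {p : ℂ} (hp : ‖p‖ < 1) : Differentiable ℂ fun u => qPoch u p := by
  have key : HasProdLocallyUniformlyOn (fun (i : ℕ) (u : ℂ) => 1 + -(p ^ i * u))
      (fun u => ∏' i : ℕ, (1 + -(p ^ i * u))) Set.univ := by
    apply hasProdLocallyUniformlyOn_of_forall_compact isOpen_univ
    intro K _ hcK
    obtain ⟨R, hR⟩ := hcK.isBounded.exists_norm_le
    refine ((summable_geometric_of_lt_one (norm_nonneg p) hp).mul_right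
      R).hasProdUniformlyOn_nat_one_add hcK (.of_forall fun n x hx => ?_) (fun _ => by fun_prop)
    rw [norm_neg, norm_mul, norm_pow]
    exact mul_le_mul_of_nonneg_left (hR x hx) (by positivity)
  have := TendstoLocallyUniformlyOn.differentiableOn key (.of_forall fun s => by fun_prop)
    isOpen_univ
  simpa [qPoch, sub_eq_add_neg, differentiableOn_univ] using this

section Theta

variable {p : ℂˣ} (hp : ‖(p : ℂ)‖ < 1)
include hp

theorem theta_inv (u : ℂˣ) : theta p u⁻¹ = -((u⁻¹ : ℂˣ) : ℂ) * theta p u := by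
  have hu : (u : ℂ) ≠ 0 := u.ne_zero
  rw [theta, theta, qPoch_eq hp (u⁻¹ : ℂˣ), qPoch_eq hp (u : ℂ)]
  simp only [Units.val_mul, Units.val_inv_eq_inv_val, div_eq_mul_inv]
  field_simp
  ring

theorem theta_mul_left (u : ℂˣ) : theta p (p * u) = -((u⁻¹ : ℂˣ) : ℂ) * theta p u := by
  rw [← theta_inv hp, theta, theta, mul_comm]
  congr 2; simp [div_eq_mul_inv]

theorem theta_one : theta p 1 = 0 := by
  rw [theta, Units.val_one, qPoch_eq hp]; simp

/-- The two infinite products vanish only at `u = p^{-i}` and at `u = p^{i+1}` respectively, with `i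
≥ 0`. -/
theorem theta_ne_zero {u : ℂˣ} (h : ∀ N : ℤ, u ≠ p ^ N) : theta p u ≠ 0 := by
  refine mul_ne_zero (qPoch_ne_zero hp fun i hi => h (-i) ?_)
    (qPoch_ne_zero hp fun i hi => h (i + 1) ?_)
  · have : p ^ i * u = 1 := Units.ext (by simpa using hi)
    rw [zpow_neg, zpow_natCast]; exact eq_inv_of_mul_eq_one_right this
  · have h1 : p ^ i * (p / u) = 1 := Units.ext (by simpa using hi)
    have : p ^ (i + 1) = u := by rw [pow_succ, ← div_eq_one, mul_div_assoc, h1]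
    rw [← this]; exact_mod_cast rfl

theorem theta_div_comm (u v : ℂˣ) : theta p (v / u) = -((v / u : ℂˣ) : ℂ) * theta p (u / v) := by
  rw [← inv_div u v, theta_inv hp]

end Theta

/-- `e(u, v) = u⁻¹ θ(uv) θ(u/v)`. -/
noncomputable def ethe (p u v : ℂˣ) : ℂ := ((u⁻¹ : ℂˣ) : ℂ) * theta p (u * v) * theta p (u / v)

section Ethe

variable {p : ℂˣ} (hp : ‖(p : ℂ)‖ < 1)
include hp

theorem ethe_swap (u v : ℂˣ) : ethe p u v = -ethe p v u := by
  have hu : (u : ℂ) ≠ 0 := u.ne_zero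
  have hv : (v : ℂ) ≠ 0 := v.ne_zero
  rw [ethe, ethe, theta_div_comm hp u v, mul_comm v u]
  simp only [div_eq_mul_inv, Units.val_mul, Units.val_inv_eq_inv_val]
  field_simp

theorem ethe_self (u : ℂˣ) : ethe p u u = 0 := by simp [ethe, theta_one hp]

theorem ethe_inv_left (u v : ℂˣ) : ethe p u⁻¹ v = ethe p u v := by
  have hu : (u : ℂ) ≠ 0 := u.ne_zero
  have hv : (v : ℂ) ≠ 0 := v.ne_zero
  have h1 : u⁻¹ * v = (u / v)⁻¹ := by simp [div_eq_mul_inv, mul_comm]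
  have h2 : u⁻¹ / v = (u * v)⁻¹ := by simp [div_eq_mul_inv, mul_comm]
  rw [ethe, ethe, h1, h2, theta_inv hp, theta_inv hp]
  simp only [div_eq_mul_inv, Units.val_mul, Units.val_inv_eq_inv_val, mul_inv_rev, inv_inv]
  field_simp

/-- The powers of `v` produced by the two theta factors cancel. The multiplier is thus independent
of `v`, which makes `u ↦ e(u, v)` the building block of degree one. -/
theorem ethe_p_mul_left (u v : ℂˣ) :
    ethe p (p * u) v = ethe p u v * (((p * u ^ 2) ^ (-(1 : ℤ)) : ℂˣ) : ℂ) := by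
  have hu : (u : ℂ) ≠ 0 := u.ne_zero
  have hv : (v : ℂ) ≠ 0 := v.ne_zero
  have hp0 : (p : ℂ) ≠ 0 := p.ne_zero
  rw [ethe, ethe, mul_assoc p u v, mul_div_assoc, theta_mul_left hp, theta_mul_left hp]
  simp only [div_eq_mul_inv, Units.val_mul, Units.val_inv_eq_inv_val, mul_inv_rev, inv_inv,
    zpow_neg, zpow_one, Units.val_pow_eq_pow_val]
  field_simp

omit hp in
theorem ethe_ne_zero_iff {u v : ℂˣ} :
    ethe p u v ≠ 0 ↔ theta p (u * v) ≠ 0 ∧ theta p (u / v) ≠ 0 := by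
  simp [ethe]

theorem ethe_ne_zero_symm {u v : ℂˣ} (h : ethe p u v ≠ 0) : ethe p v u ≠ 0 := by
  rw [ethe_swap hp]; exact neg_ne_zero.2 h

end Ethe

/-! ### Holomorphic functions on `ℂˣ` and their Laurent coefficients -/

/-- Holomorphic functions of one variable on `ℂˣ`. -/
def HolUnits (g : ℂˣ → ℂ) : Prop :=
  ∃ G : ℂ → ℂ, DifferentiableOn ℂ G {0}ᶜ ∧ ∀ x : ℂˣ, G x = g x

namespace HolUnits

theorem const (c : ℂ) : HolUnits fun _ => c := ⟨fun _ => c, differentiableOn_const c, fun _ => rfl⟩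

theorem val : HolUnits fun x => (x : ℂ) := ⟨id, differentiableOn_id, fun _ => rfl⟩

theorem val_inv : HolUnits fun x => ((x⁻¹ : ℂˣ) : ℂ) :=
  ⟨fun x => x⁻¹, fun x hx => (differentiableAt_inv hx).differentiableWithinAt, fun x => by simp⟩

variable {f g : ℂˣ → ℂ}

theorem add (hf : HolUnits f) (hg : HolUnits g) : HolUnits (f + g) := by
  obtain ⟨F, hF, h⟩ := hf
  obtain ⟨G, hG, k⟩ := hg
  exact ⟨F + G, hF.add hG, fun x => by simp [h, k]⟩

theorem mul (hf : HolUnits f) (hg : HolUnits g) : HolUnits (f * g) := by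
  obtain ⟨F, hF, h⟩ := hf
  obtain ⟨G, hG, k⟩ := hg
  exact ⟨F * G, hF.mul hG, fun x => by simp [h, k]⟩

theorem smul (c : ℂ) (hf : HolUnits f) : HolUnits (c • f) := (const c).mul hf

theorem prod {ι : Type*} (s : Finset ι) {f : ι → ℂˣ → ℂ} (h : ∀ i ∈ s, HolUnits (f i)) :
    HolUnits (∏ i ∈ s, f i) := by
  classical
  induction s using Finset.induction_on with
  | empty => exact const 1
  | insert a s ha ih =>
    rw [Finset.prod_insert ha]
    exact (h a (by simp)).mul (ih fun i hi => h i (by simp [hi]))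

/-- Composition with a holomorphic map of `ℂˣ`. -/
theorem comp (hf : HolUnits f) {m : ℂˣ → ℂˣ} (hm : HolUnits fun x => (m x : ℂ)) :
    HolUnits (f ∘ m) := by
  obtain ⟨F, hF, h⟩ := hf
  obtain ⟨M, hM, k⟩ := hm
  refine ⟨F ∘ M, hF.comp hM fun x hx => ?_, fun x => by simp [k, h]⟩
  have : M x = m (Units.mk0 x hx) := k (Units.mk0 x hx)
  simp [this]

end HolUnits

theorem holUnits_theta {p : ℂˣ} (hp : ‖(p : ℂ)‖ < 1) : HolUnits (theta p) := by
  have h : HolUnits fun x => qPoch x p :=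
    ⟨fun x => qPoch x p, (differentiable_qPoch hp).differentiableOn, fun _ => rfl⟩
  refine h.mul (h.comp (m := fun x => p / x) ?_)
  simpa [div_eq_mul_inv, Pi.mul_def] using (HolUnits.const (p : ℂ)).mul HolUnits.val_inv

/-- The `k`-th Laurent coefficient of `G`, up to normalization, on the circle through `u`. -/
noncomputable def laurentCoeff (G : ℂ → ℂ) (u : ℂ) (k : ℤ) : ℂ :=
  ∫ θ in (0 : ℝ)..2 * Real.pi, G (u * Complex.exp (θ * Complex.I)) * Complex.exp (-(k * θ * Complex.I))

section Laurent

variable {G : ℂ → ℂ}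

theorem circleIntegral_eq_laurentCoeff {R : ℝ} (hR : 0 < R) (k : ℤ) :
    (∮ z in C(0, R), G z * z ^ (-k - 1)) = Complex.I * (R : ℂ) ^ (-k) * laurentCoeff G R k := by
  have hR' : (R : ℂ) ≠ 0 := by exact_mod_cast hR.ne'
  rw [circleIntegral, laurentCoeff, ← intervalIntegral.integral_const_mul]
  refine intervalIntegral.integral_congr fun θ _ => ?_
  simp only [deriv_circleMap, circleMap, zero_add, smul_eq_mul]
  have h1 : Complex.exp (-(k * θ * Complex.I)) = Complex.exp (θ * Complex.I) ^ (-k) := by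
    rw [← Complex.exp_int_mul]; congr 1; push_cast; ring
  rw [h1, mul_zpow, zpow_sub_one₀ hR', zpow_sub_one₀ (Complex.exp_ne_zero _)]
  have := Complex.exp_ne_zero (θ * Complex.I)
  field_simp

/-- Cauchy's theorem on the annulus between the two circles, for `G(z) z^{-k-1}`. -/
theorem laurentCoeff_of_le (hG : DifferentiableOn ℂ G {0}ᶜ) {r R : ℝ} (hr : 0 < r) (h : r ≤ R)
    (k : ℤ) : (R : ℂ) ^ (-k) * laurentCoeff G R k = (r : ℂ) ^ (-k) * laurentCoeff G r k := by
  have hd : DifferentiableOn ℂ (fun z => G z * z ^ (-k - 1)) {0}ᶜ :=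
    hG.mul fun z hz => (differentiableAt_zpow.2 (Or.inl hz)).differentiableWithinAt
  have key := Complex.circleIntegral_eq_of_differentiable_on_annulus_off_countable (c := 0)
    (f := fun z => G z * z ^ (-k - 1)) hr h Set.countable_empty ?_ ?_
  · rw [circleIntegral_eq_laurentCoeff (hr.trans_le h), circleIntegral_eq_laurentCoeff hr,
      mul_assoc, mul_assoc] at key
    exact mul_left_cancel₀ Complex.I_ne_zero key
  · refine hd.continuousOn.mono fun z hz h0 => hz.2 ?_
    rw [Set.mem_singleton_iff] at h0
    simpa [h0] using hr
  · intro z hz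
    refine hd.differentiableAt (isOpen_compl_singleton.mem_nhds fun h0 => hz.1.2 ?_)
    rw [Set.mem_singleton_iff] at h0
    simpa [h0] using hr.le

theorem laurentCoeff_ofReal (hG : DifferentiableOn ℂ G {0}ᶜ) {R : ℝ} (hR : 0 < R) (k : ℤ) :
    laurentCoeff G R k = (R : ℂ) ^ k * laurentCoeff G 1 k := by
  have hR' : (R : ℂ) ≠ 0 := by exact_mod_cast hR.ne'
  have : (R : ℂ) ^ (-k) * laurentCoeff G R k = laurentCoeff G 1 k := by
    rcases le_total 1 R with h | h
    · simpa using laurentCoeff_of_le hG one_pos h k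
    · simpa using (laurentCoeff_of_le hG hR h k).symm
  rw [← this, ← mul_assoc, ← zpow_add₀ hR']; simp

theorem exp_two_pi_add (c : ℂ) (θ : ℝ) (k : ℤ) :
    Complex.exp (k * ((θ + 2 * Real.pi : ℝ) : ℂ) * Complex.I + c) =
      Complex.exp (k * θ * Complex.I + c) := by
  have : (k : ℂ) * ((θ + 2 * Real.pi : ℝ) : ℂ) * Complex.I + c =
    k * θ * Complex.I + c + k * (2 * Real.pi * Complex.I) := by push_cast; ring
  rw [this, Complex.exp_add _ ((k : ℂ) * _), Complex.exp_int_mul_two_pi_mul_I, mul_one]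

theorem periodic_laurent_integrand (u : ℂ) (k : ℤ) :
    Function.Periodic (fun θ : ℝ => G (u * Complex.exp (θ * Complex.I)) *
      Complex.exp (-(k * θ * Complex.I))) (2 * Real.pi) := by
  intro θ
  have h1 := exp_two_pi_add 0 θ 1
  have h2 := exp_two_pi_add 0 θ (-k)
  simp only [Int.cast_one, one_mul, add_zero, Int.cast_neg, neg_mul] at h1 h2
  simp only [h1, h2]

theorem laurentCoeff_rotate (u : ℂ) (α : ℝ) (k : ℤ) :
    laurentCoeff G (u * Complex.exp (α * Complex.I)) k =
      Complex.exp (α * Complex.I) ^ k * laurentCoeff G u k := by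
  have h := (periodic_laurent_integrand (G := G) u k).intervalIntegral_add_eq α 0
  rw [zero_add] at h
  rw [laurentCoeff, laurentCoeff, ← h, ← intervalIntegral.integral_const_mul,
    add_comm α (2 * Real.pi)]
  have h2 := intervalIntegral.integral_comp_add_right (a := 0) (b := 2 * Real.pi)
    (fun θ : ℝ => Complex.exp (α * Complex.I) ^ k * (G (u * Complex.exp (θ * Complex.I)) *
      Complex.exp (-(k * θ * Complex.I)))) α
  rw [zero_add] at h2
  rw [← h2]
  refine intervalIntegral.integral_congr fun θ _ => ?_
  rw [← Complex.exp_int_mul, mul_left_comm, ← Complex.exp_add, mul_assoc, ← Complex.exp_add]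
  congr 2
  · congr 2; push_cast; ring
  · push_cast; ring

/-- Polar decomposition reduces to a change of radius and a rotation. Arbitrary complex `u` is
needed because the functional equation compares the circles through `1` and through `p`. -/
theorem laurentCoeff_eq (hG : DifferentiableOn ℂ G {0}ᶜ) {u : ℂ} (hu : u ≠ 0) (k : ℤ) :
    laurentCoeff G u k = u ^ k * laurentCoeff G 1 k := by
  have h : u = (‖u‖ : ℂ) * Complex.exp (u.arg * Complex.I) :=
    (Complex.norm_mul_exp_arg_mul_I u).symm
  rw [h, laurentCoeff_rotate, laurentCoeff_ofReal hG (norm_pos_iff.2 hu), mul_zpow]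
  ring

theorem continuous_circle_comp (hG : DifferentiableOn ℂ G {0}ᶜ) {u : ℂ} (hu : u ≠ 0) :
    Continuous fun z : Circle => G (u * z) :=
  hG.continuousOn.comp_continuous (by fun_prop) fun z => mul_ne_zero hu z.coe_ne_zero

/-- On the circle through `u` the function is continuous with all Fourier coefficients zero, so its
Fourier series is summable and converges pointwise to it. -/
theorem eq_zero_of_laurentCoeff (hG : DifferentiableOn ℂ G {0}ᶜ)
    (h : ∀ k, laurentCoeff G 1 k = 0) {u : ℂ} (hu : u ≠ 0) : G u = 0 := by
  have : Fact (0 < 2 * Real.pi) := ⟨Real.two_pi_pos⟩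
  let f : C(AddCircle (2 * Real.pi), ℂ) :=
    ⟨fun x => G (u * AddCircle.toCircle x),
      (continuous_circle_comp hG hu).comp AddCircle.continuous_toCircle⟩
  have hf : fourierCoeff f = 0 := by
    funext n
    rw [fourierCoeff_eq_intervalIntegral f n 0, zero_add]
    have h0 : laurentCoeff G u n = 0 := by rw [laurentCoeff_eq hG hu, h, mul_zero]
    have : (∫ x in (0 : ℝ)..2 * Real.pi, @fourier (2 * Real.pi) (-n) x • f x) =
        laurentCoeff G u n := by
      refine intervalIntegral.integral_congr fun θ _ => ?_
      have hpi : (Real.pi : ℂ) ≠ 0 := by exact_mod_cast Real.pi_ne_zero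
      simp only [fourier_coe_apply, f, ContinuousMap.coe_mk, AddCircle.toCircle_apply_mk,
        Circle.coe_exp, smul_eq_mul]
      rw [mul_comm]
      congr 2
      · congr 3; rw [div_self Real.two_pi_pos.ne', one_mul]
      · push_cast; field_simp
    rw [this, h0, smul_zero]; rfl
  have hs := has_pointwise_sum_fourier_series_of_summable (f := f)
    (by rw [hf]; exact summable_zero) ((0 : ℝ) : AddCircle (2 * Real.pi))
  have h0 : f ((0 : ℝ) : AddCircle (2 * Real.pi)) = 0 := by
    refine hs.unique ?_
    simp only [hf, Pi.zero_apply, zero_smul]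
    exact hasSum_zero
  simpa [f] using h0

end Laurent

/-! ### Theta functions of one variable and the points that determine them -/

/-- Holomorphic functions `g` on `ℂˣ` with `g(x⁻¹) = ε g(x)` and `g(px) = g(x) (p x²)^{-d}`. -/
def Th (p : ℂˣ) (ε : ℂ) (d : ℕ) : Submodule ℂ (ℂˣ → ℂ) where
  carrier := {g | HolUnits g ∧ (∀ x, g x⁻¹ = ε * g x) ∧
    ∀ x, g (p * x) = g x * (((p * x ^ 2) ^ (-(d : ℤ)) : ℂˣ) : ℂ)}
  add_mem' := by
    rintro f g ⟨h1, h2, h3⟩ ⟨k1, k2, k3⟩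
    exact ⟨h1.add k1, fun x => by simp only [Pi.add_apply, h2, k2]; ring,
      fun x => by simp only [Pi.add_apply, h3, k3]; ring⟩
  zero_mem' := ⟨HolUnits.const 0, by simp, by simp⟩
  smul_mem' := by
    rintro c f ⟨h1, h2, h3⟩
    exact ⟨h1.smul c, fun x => by simp only [Pi.smul_apply, smul_eq_mul, h2]; ring,
      fun x => by simp only [Pi.smul_apply, smul_eq_mul, h3]; ring⟩

section Th

variable {p : ℂˣ} {ε ε' : ℂ} {d d' : ℕ} {f g : ℂˣ → ℂ}

theorem Th.mul (hf : f ∈ Th p ε d) (hg : g ∈ Th p ε' d') : f * g ∈ Th p (ε * ε') (d + d') := by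
  obtain ⟨h1, h2, h3⟩ := hf
  obtain ⟨k1, k2, k3⟩ := hg
  refine ⟨h1.mul k1, fun x => by simp only [Pi.mul_apply, h2, k2]; ring, fun x => ?_⟩
  simp only [Pi.mul_apply, h3, k3]
  have : (-((d + d' : ℕ) : ℤ)) = -(d : ℤ) + -(d' : ℤ) := by push_cast; ring
  rw [this, zpow_add, Units.val_mul]
  ring

theorem Th.const (c : ℂ) : (fun _ => c) ∈ Th p 1 0 := ⟨HolUnits.const c, by simp, by simp⟩

theorem Th.prod {ι : Type*} (s : Finset ι) {F : ι → ℂˣ → ℂ} (h : ∀ i ∈ s, F i ∈ Th p 1 d) :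
    ∏ i ∈ s, F i ∈ Th p 1 (#s * d) := by
  classical
  induction s using Finset.induction_on with
  | empty => simpa [Pi.one_def] using Th.const (1 : ℂ)
  | insert a s ha ih =>
    rw [Finset.prod_insert ha, card_insert_of_notMem ha, add_mul, one_mul, add_comm]
    simpa using Th.mul (h a (by simp)) (ih fun i hi => h i (by simp [hi]))

variable (hp : ‖(p : ℂ)‖ < 1)
include hp

theorem ethe_mem_Th (v : ℂˣ) : (fun u => ethe p u v) ∈ Th p 1 1 := by
  refine ⟨?_, fun u => by simpa using ethe_inv_left hp u v, fun u => by
    simpa using ethe_p_mul_left hp u v⟩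
  have hθ := holUnits_theta hp
  have h1 := hθ.comp (m := fun u => u * v) (by
    simpa [Pi.mul_def] using HolUnits.val.mul (HolUnits.const (v : ℂ)))
  have h2 := hθ.comp (m := fun u => u / v) (by
    simpa [Pi.mul_def, div_eq_mul_inv] using HolUnits.val.mul (HolUnits.const (v⁻¹ : ℂ)))
  exact (HolUnits.val_inv.mul h1).mul h2

theorem ethe_mem_Th_right (v : ℂˣ) : (fun u => ethe p v u) ∈ Th p 1 1 := by
  have : (fun u => ethe p v u) = -fun u => ethe p u v := by
    funext u; rw [Pi.neg_apply, ← ethe_swap hp]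
  rw [this]
  exact neg_mem (ethe_mem_Th hp v)

/-- The basic odd function `θ(x²)/x`. -/
theorem oddTheta_mem_Th : oddTheta p ∈ Th p (-1) 2 := by
  have hsq : HolUnits fun x : ℂˣ => ((x ^ 2 : ℂˣ) : ℂ) := by
    simpa [Pi.mul_def, pow_two] using HolUnits.val.mul HolUnits.val
  refine ⟨HolUnits.val_inv.mul ((holUnits_theta hp).comp hsq), fun x => ?_, fun x => ?_⟩
  · have hx : (x : ℂ) ≠ 0 := x.ne_zero
    rw [oddTheta, oddTheta, inv_pow, theta_inv hp]
    simp only [Units.val_inv_eq_inv_val, Units.val_pow_eq_pow_val, inv_inv]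
    field_simp
  · have hx : (x : ℂ) ≠ 0 := x.ne_zero
    have hp0 : (p : ℂ) ≠ 0 := p.ne_zero
    have h : (p * x) ^ 2 = p * (p * x ^ 2) := by rw [mul_pow, pow_two p, mul_assoc]
    rw [oddTheta, oddTheta, h, theta_mul_left hp, theta_mul_left hp]
    simp only [Units.val_inv_eq_inv_val, Units.val_pow_eq_pow_val, Units.val_mul, mul_inv,
      zpow_neg, zpow_natCast]
    field_simp

end Th

/-- Extension of a function on `ℂˣ` to `ℂ` by zero. -/
noncomputable def extendUnits (g : ℂˣ → ℂ) (w : ℂ) : ℂ :=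
  if h : w ≠ 0 then g (Units.mk0 w h) else 0

theorem extendUnits_coe (g : ℂˣ → ℂ) (x : ℂˣ) : extendUnits g x = g x := by
  simp [extendUnits]

theorem HolUnits.differentiableOn {g : ℂˣ → ℂ} (hg : HolUnits g) :
    DifferentiableOn ℂ (extendUnits g) {0}ᶜ := by
  obtain ⟨G, hG, h⟩ := hg
  refine hG.congr fun w hw => ?_
  have := h (Units.mk0 w hw)
  rw [← extendUnits_coe g] at this
  exact this.symm

/-- The Laurent coefficients of a function on `ℂˣ`. -/
noncomputable def lCoeff (g : ℂˣ → ℂ) (k : ℤ) : ℂ := laurentCoeff (extendUnits g) 1 k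

theorem HolUnits.intervalIntegrable {g : ℂˣ → ℂ} (hg : HolUnits g) (k : ℤ) :
    IntervalIntegrable (fun θ : ℝ => extendUnits g (1 * Complex.exp (θ * Complex.I)) *
      Complex.exp (-(k * θ * Complex.I))) MeasureTheory.volume 0 (2 * Real.pi) := by
  refine Continuous.intervalIntegrable ?_ _ _
  exact (hg.differentiableOn.continuousOn.comp_continuous (by fun_prop)
    fun θ => by simp [Complex.exp_ne_zero]).mul (by fun_prop)

theorem lCoeff_add {f g : ℂˣ → ℂ} (hf : HolUnits f) (hg : HolUnits g) (k : ℤ) :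
    lCoeff (f + g) k = lCoeff f k + lCoeff g k := by
  rw [lCoeff, lCoeff, lCoeff, laurentCoeff, laurentCoeff, laurentCoeff,
    ← intervalIntegral.integral_add (hf.intervalIntegrable k) (hg.intervalIntegrable k)]
  congr 1
  funext θ
  rw [← add_mul]
  congr 1
  simp [extendUnits]

theorem lCoeff_smul (c : ℂ) (g : ℂˣ → ℂ) (k : ℤ) : lCoeff (c • g) k = c * lCoeff g k := by
  rw [lCoeff, lCoeff, laurentCoeff, laurentCoeff, ← intervalIntegral.integral_const_mul]
  congr 1
  funext θ
  rw [← mul_assoc]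
  congr 1
  simp [extendUnits]

section Coefficients

variable {p : ℂˣ} {ε : ℂ} {d : ℕ} {g : ℂˣ → ℂ}

theorem lCoeff_neg (hg : g ∈ Th p ε d) (k : ℤ) : lCoeff g (-k) = ε * lCoeff g k := by
  rw [lCoeff, lCoeff, laurentCoeff, laurentCoeff, ← intervalIntegral.integral_const_mul]
  have h := (periodic_laurent_integrand (G := extendUnits g) 1 (-k)).intervalIntegral_add_eq
    0 (-(2 * Real.pi))
  rw [zero_add, neg_add_cancel] at h
  rw [h]
  have h2 := intervalIntegral.integral_comp_neg (a := 0) (b := 2 * Real.pi)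
    (fun θ : ℝ => extendUnits g (1 * Complex.exp (θ * Complex.I)) *
      Complex.exp (-(((-k : ℤ) : ℂ) * θ * Complex.I)))
  rw [neg_zero] at h2
  rw [← h2]
  refine intervalIntegral.integral_congr fun θ _ => ?_
  have h3 := hg.2.1 (Units.mk0 _ (Complex.exp_ne_zero (θ * Complex.I)))
  rw [← extendUnits_coe g, ← extendUnits_coe g] at h3
  simp only [Units.val_inv_eq_inv_val, Units.val_mk0, ← Complex.exp_neg] at h3
  simp only [one_mul, Complex.ofReal_neg, neg_mul, h3, Int.cast_neg, mul_neg, neg_neg]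
  ring

/-- Comparison of the coefficients of `x^k` in `g(px) = p^{-d} x^{-2d} g(x)`. -/
theorem lCoeff_add_two_mul (hg : g ∈ Th p ε d) (k : ℤ) :
    lCoeff g (k + 2 * d) = (p : ℂ) ^ (k + d) * lCoeff g k := by
  have hp0 : (p : ℂ) ≠ 0 := p.ne_zero
  have h1 := laurentCoeff_eq hg.1.differentiableOn hp0 k
  have h2 : laurentCoeff (extendUnits g) p k = (p : ℂ) ^ (-(d : ℤ)) * lCoeff g (k + 2 * d) := by
    rw [lCoeff, laurentCoeff, laurentCoeff, ← intervalIntegral.integral_const_mul]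
    refine intervalIntegral.integral_congr fun θ _ => ?_
    have h3 := hg.2.2 (Units.mk0 _ (Complex.exp_ne_zero (θ * Complex.I)))
    rw [← extendUnits_coe g, ← extendUnits_coe g] at h3
    simp only [Units.val_mul, Units.val_mk0, Units.val_zpow_eq_zpow_val,
      Units.val_pow_eq_pow_val] at h3
    have h4 : Complex.exp (-(((k + 2 * d : ℤ) : ℂ) * θ * Complex.I)) =
        (Complex.exp (θ * Complex.I) ^ 2) ^ (-(d : ℤ)) * Complex.exp (-(k * θ * Complex.I)) := by
      rw [← Complex.exp_nat_mul, ← Complex.exp_int_mul, ← Complex.exp_add]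
      congr 1; push_cast; ring
    simp only [h3, h4, one_mul, mul_zpow]
    ring
  rw [h2] at h1
  rw [← lCoeff.eq_1] at h1
  rw [zpow_add₀ hp0, mul_comm ((p : ℂ) ^ k), mul_assoc, ← h1, ← mul_assoc, ← zpow_add₀ hp0]
  simp

/-- Coefficients whose indices agree modulo `2d` vanish together, and index `-k` reduces to index
`k`; the indices `0, …, d` represent all classes. -/
theorem eq_zero_of_lCoeff (hd : 1 ≤ d) (hg : g ∈ Th p ε d)
    (h : ∀ k : ℕ, k ≤ d → lCoeff g k = 0) : g = 0 := by
  have hp0 : (p : ℂ) ≠ 0 := p.ne_zero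
  have hstep : ∀ k : ℤ, lCoeff g (k + 2 * d) = 0 ↔ lCoeff g k = 0 := fun k => by
    rw [lCoeff_add_two_mul hg, mul_eq_zero, or_iff_right (zpow_ne_zero _ hp0)]
  have hq : ∀ k q : ℤ, lCoeff g k = 0 → lCoeff g (k + 2 * d * q) = 0 := by
    intro k q hk
    induction q using Int.induction_on with
    | zero => simpa using hk
    | succ i ih => rw [mul_add, ← add_assoc, mul_one]; exact (hstep _).2 ih
    | pred i ih =>
      refine (hstep _).1 ?_
      rwa [mul_sub, mul_one, ← add_sub_assoc, sub_add_cancel]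
  have hsmall : ∀ k : ℤ, |k| ≤ d → lCoeff g k = 0 := by
    intro k hk
    rcases le_total 0 k with h0 | h0
    · have := h k.toNat (by rw [abs_of_nonneg h0] at hk; omega)
      rwa [Int.toNat_of_nonneg h0] at this
    · have := h (-k).toNat (by rw [abs_of_nonpos h0] at hk; omega)
      rw [Int.toNat_of_nonneg (by omega)] at this
      rw [← neg_neg k, lCoeff_neg hg, this, mul_zero]
  have hall : ∀ k : ℤ, lCoeff g k = 0 := by
    intro k
    -- The shift by `d` selects the representative of `k` modulo `2d` in `[-d, d)`.
    have h1 := Int.emod_nonneg (k + d) (b := 2 * d) (by omega)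
    have h2 := Int.emod_lt_of_pos (k + d) (b := 2 * d) (by omega)
    have h3 := Int.emod_add_mul_ediv (k + d) (2 * d)
    have := hq ((k + d) % (2 * d) - d) ((k + d) / (2 * d))
      (hsmall _ (by rw [abs_le]; constructor <;> omega))
    rwa [show (k + d) % (2 * d) - d + 2 * d * ((k + d) / (2 * d)) = k by linarith] at this
  funext x
  rw [← extendUnits_coe g]
  exact eq_zero_of_laurentCoeff hg.1.differentiableOn hall x.ne_zero

end Coefficients

/-- The Laurent coefficients with index in `s` as a linear map. -/
noncomputable def lCoeffMap (p : ℂˣ) (ε : ℂ) (d : ℕ) (s : Finset ℕ) : Th p ε d →ₗ[ℂ] (s → ℂ) where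
  toFun g k := lCoeff g.1 (k : ℕ)
  map_add' f g := by funext k; exact lCoeff_add f.2.1 g.2.1 _
  map_smul' c g := by funext k; exact lCoeff_smul c g.1 _

/-- If the coefficients in `s` determine the elements of `Th p ε d`, an element vanishing at `#s`
points that admit Lagrange functions is zero. -/
theorem Th.eq_zero_of_lagrange {p : ℂˣ} {ε : ℂ} {d : ℕ} {s : Finset ℕ}
    (hs : ∀ g ∈ Th p ε d, (∀ k ∈ s, lCoeff g (k : ℕ) = 0) → g = 0)
    {ι : Type*} [Fintype ι] (hι : Fintype.card ι = #s) (x : ι → ℂˣ)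
    (L : ι → ℂˣ → ℂ) (hL : ∀ i, L i ∈ Th p ε d) (hne : ∀ i, L i (x i) ≠ 0)
    (h0 : ∀ i j, i ≠ j → L i (x j) = 0) {g : ℂˣ → ℂ} (hg : g ∈ Th p ε d)
    (hgx : ∀ i, g (x i) = 0) : g = 0 := by
  classical
  -- The coefficients bound the dimension by `#s`. The Lagrange functions make evaluation at `#s`
  -- points surjective, so the dimensions agree and evaluation is injective.
  have hinj : Function.Injective (lCoeffMap p ε d s) := by
    rw [injective_iff_map_eq_zero]
    intro f hf
    exact Subtype.ext (hs f.1 f.2 fun k hk => congrFun hf ⟨k, hk⟩)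
  have : FiniteDimensional ℂ (Th p ε d) := Module.Finite.of_injective _ hinj
  have hle := LinearMap.finrank_le_finrank_of_injective hinj
  rw [Module.finrank_fintype_fun_eq_card, Fintype.card_coe, ← hι] at hle
  let ev : Th p ε d →ₗ[ℂ] (ι → ℂ) :=
    { toFun := fun f i => f.1 (x i), map_add' := fun _ _ => rfl, map_smul' := fun _ _ => rfl }
  have hsurj : Function.Surjective ev := by
    intro w
    refine ⟨∑ i, (w i / L i (x i)) • ⟨L i, hL i⟩, ?_⟩
    rw [map_sum]
    funext j
    rw [Finset.sum_apply, Finset.sum_eq_single j]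
    · simp [ev, div_mul_cancel₀ _ (hne j)]
    · intro i _ hij
      simp [ev, h0 i j hij]
    · simp
  have heq : Module.finrank ℂ (Th p ε d) = Module.finrank ℂ (ι → ℂ) :=
    le_antisymm (by simpa using hle) (LinearMap.finrank_le_finrank_of_surjective hsurj)
  have hinj' := (LinearMap.injective_iff_surjective_of_finrank_eq_finrank heq).2 hsurj
  have : (⟨g, hg⟩ : Th p ε d) = 0 := hinj' (by
    rw [map_zero]; funext i; exact hgx i)
  exact congrArg Subtype.val this

section Uniqueness

variable {p : ℂˣ} (hp : ‖(p : ℂ)‖ < 1) {d : ℕ} {g : ℂˣ → ℂ} {ι : Type*} [Fintype ι]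
include hp

/-- An even function of degree `d ≥ 1` vanishing at `d + 1` inequivalent points is zero. -/
theorem Th.eq_zero_even (hd : 1 ≤ d) (hι : Fintype.card ι = d + 1) {x : ι → ℂˣ}
    (hx : ∀ i j, i ≠ j → ethe p (x i) (x j) ≠ 0) (hg : g ∈ Th p 1 d)
    (hgx : ∀ i, g (x i) = 0) : g = 0 := by
  classical
  -- The coefficients `0, …, d` match the `d + 1` points, and a product of `e(u, x_j)` over the
  -- other `d` points has degree exactly `d`.
  refine Th.eq_zero_of_lagrange (s := range (d + 1))
    (fun f hf h => eq_zero_of_lCoeff hd hf fun k hk => h k (by simpa using Nat.lt_succ_of_le hk))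
    (by simpa using hι) x (fun i => ∏ j ∈ univ.erase i, fun u => ethe p u (x j)) (fun i => ?_)
    (fun i => ?_) (fun i j hij => ?_) hg hgx
  · have := Th.prod (univ.erase i) fun j _ => ethe_mem_Th hp (x j)
    rwa [card_erase_of_mem (mem_univ i), card_univ, hι, add_tsub_cancel_right, mul_one] at this
  · rw [Finset.prod_apply, prod_ne_zero_iff]
    exact fun j hj => hx i j (ne_of_mem_erase hj).symm
  · rw [Finset.prod_apply, prod_eq_zero_iff]
    exact ⟨j, by simp [hij.symm], ethe_self hp _⟩

/-- An odd function of degree `d` vanishing at `d - 1` inequivalent points, none of them a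
half-period, is zero. -/
theorem Th.eq_zero_odd (hι : Fintype.card ι + 1 = d) (hd : 2 ≤ d) {x : ι → ℂˣ}
    (hx : ∀ i j, i ≠ j → ethe p (x i) (x j) ≠ 0) (hx2 : ∀ i, theta p (x i ^ 2) ≠ 0)
    (hg : g ∈ Th p (-1) d) (hgx : ∀ i, g (x i) = 0) : g = 0 := by
  classical
  refine Th.eq_zero_of_lagrange (s := Ico 1 d) (fun f hf h => ?_)
    (by simp; omega) x (fun i => oddTheta p * ∏ j ∈ univ.erase i, fun u => ethe p u (x j))
    (fun i => ?_) (fun i => ?_) (fun i j hij => ?_) hg hgx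
  -- Oddness kills the coefficient of index `0`. It also kills that of index `d`, which equals the
  -- one of index `-d` by quasi-periodicity. The `d - 1` indices strictly between remain.
  · have h0 : lCoeff f 0 = 0 := by
      have := lCoeff_neg hf 0
      rw [neg_zero] at this
      linear_combination this / 2
    have hdd : lCoeff f d = 0 := by
      have h1 := lCoeff_neg hf d
      have h2 := lCoeff_add_two_mul hf (-d)
      rw [neg_add_cancel, zpow_zero, one_mul, h1,
        show (-(d : ℤ) + 2 * d) = d by ring] at h2
      linear_combination h2 / 2
    refine eq_zero_of_lCoeff (by omega) hf fun k hk => ?_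
    rcases Nat.eq_zero_or_pos k with rfl | hk0
    · exact h0
    · rcases hk.eq_or_lt with rfl | hk1
      · exact hdd
      · exact h k (by simp; omega)
  -- The index `i` shows that the index type is nonempty, so the subtraction in `card ι - 1` is not
  -- truncated; the degree is `2 + (d - 2)`.
  · have h1 : 0 < Fintype.card ι := Fintype.card_pos_iff.2 ⟨i⟩
    have := Th.mul (oddTheta_mem_Th hp) (Th.prod (univ.erase i) fun j _ => ethe_mem_Th hp (x j))
    rw [card_erase_of_mem (mem_univ i), card_univ, mul_one, mul_one] at this
    rwa [show 2 + (Fintype.card ι - 1) = d by omega] at this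
  · rw [Pi.mul_apply, Finset.prod_apply, oddTheta]
    refine mul_ne_zero (mul_ne_zero (x i)⁻¹.ne_zero (hx2 i)) (prod_ne_zero_iff.2 fun j hj => ?_)
    exact hx i j (ne_of_mem_erase hj).symm
  · rw [Pi.mul_apply, Finset.prod_apply, prod_eq_zero (i := j) (by simp [hij.symm])
      (ethe_self hp _), mul_zero]

end Uniqueness

/-! ### Coordinates as multisets, reference points, genericity -/

/-- The multiset of coordinates of a tuple. -/
def coords {n : ℕ} {α : Type*} (z : Fin n → α) : Multiset α := univ.val.map z

section Coords

variable {α : Type*} {n : ℕ}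

theorem coords_zero (z : Fin 0 → α) : coords z = 0 := by simp [coords]

theorem coords_cons_removeNth (z : Fin (n + 1) → α) (i : Fin (n + 1)) :
    z i ::ₘ coords (i.removeNth z) = coords z := by
  rw [coords, coords, Fin.univ_succAbove n i, cons_val, map_val, Multiset.map_cons,
    Multiset.map_map]
  rfl

theorem coords_snoc (z : Fin n → α) (x : α) :
    coords (Fin.snoc z x : Fin (n + 1) → α) = x ::ₘ coords z := by
  rw [← coords_cons_removeNth _ (Fin.last n)]
  simp

theorem prod_map_coords {M : Type*} [CommMonoid M] (z : Fin n → α) (g : α → M) :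
    ((coords z).map g).prod = ∏ i, g (z i) := by
  rw [coords, Multiset.map_map]; rfl

theorem map_val_eq_sum {ι : Type*} (s : Finset ι) (z : ι → α) :
    s.val.map z = ∑ i ∈ s, ({z i} : Multiset α) := by
  rw [sum_eq_multiset_sum, ← Multiset.sum_map_singleton (s.val.map z), Multiset.map_map]
  rfl

theorem mem_coords {z : Fin n → α} {x : α} : x ∈ coords z ↔ ∃ i, z i = x := by simp [coords]

/-- The fibres of `z` and `z'` over each value have the same cardinality; bijections between them
assemble to a permutation. -/
theorem exists_perm_of_coords_eq {z z' : Fin n → α} (h : coords z = coords z') :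
    ∃ σ : Equiv.Perm (Fin n), (fun i => z' (σ i)) = z := by
  classical
  have hcard : ∀ y, Fintype.card {i // z i = y} = Fintype.card {i // z' i = y} := by
    intro y
    have h1 := congrArg (Multiset.count y) h
    rw [coords, coords, Multiset.count_map, Multiset.count_map] at h1
    simp only [Fintype.card_subtype, eq_comm (b := y)]
    exact h1
  let e : ∀ y, {i // z i = y} ≃ {i // z' i = y} := fun y => Fintype.equivOfCardEq (hcard y)
  refine ⟨(Equiv.sigmaFiberEquiv z).symm.trans
    ((Equiv.sigmaCongrRight e).trans (Equiv.sigmaFiberEquiv z')), ?_⟩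
  funext i
  exact (e (z i) ⟨i, rfl⟩).2

/-- A symmetric function depends only on the multiset of coordinates. -/
theorem eq_of_coords_eq {β : Type*} {f : (Fin n → α) → β}
    (hf : ∀ (σ : Equiv.Perm (Fin n)) (z : Fin n → α), f (fun i => z (σ i)) = f z)
    {z z' : Fin n → α} (h : coords z = coords z') : f z = f z' := by
  obtain ⟨σ, rfl⟩ := exists_perm_of_coords_eq h
  exact hf σ z'

end Coords

section RefPoints

variable {s : ℕ} (t : ℂˣ) (c : Fin s → ℂˣ)

/-- The multiset of coordinates of the reference point `(c)_{t,μ}`. -/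
def refMs (μ : Fin s → ℕ) : Multiset ℂˣ :=
  ∑ b, (Multiset.range (μ b)).map fun k => t ^ k * c b

theorem refMs_zero : refMs t c 0 = 0 := by simp [refMs]

/-- Raising `μ_b` appends one element at the top of the `b`-th string. All inductions on the number
of variables use this. -/
theorem refMs_add_single (μ : Fin s → ℕ) (b : Fin s) :
    refMs t c (μ + Pi.single b 1) = (t ^ μ b * c b) ::ₘ refMs t c μ := by
  have : ∀ b', (Multiset.range ((μ + Pi.single b 1 : Fin s → ℕ) b')).map (fun k => t ^ k * c b') =
      (Multiset.range (μ b')).map (fun k => t ^ k * c b') +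
        if b' = b then {t ^ μ b * c b} else 0 := by
    intro b'
    by_cases h : b' = b
    · subst h
      simp [Multiset.range_succ, ← Multiset.singleton_add, add_comm]
    · simp [h]
  rw [refMs, sum_congr rfl fun b' _ => this b', sum_add_distrib, sum_ite_eq' univ b,
    if_pos (mem_univ b), add_comm, Multiset.singleton_add, refMs]

theorem mem_refMs {μ : Fin s → ℕ} {x : ℂˣ} :
    x ∈ refMs t c μ ↔ ∃ b, ∃ k < μ b, t ^ k * c b = x := by
  simp [refMs, Multiset.mem_sum]

theorem refPoint_spec {n : ℕ} (ν : Z s n) : ∃ e : Fin n ≃ (b : Fin s) × Fin (ν.1 b),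
    ∀ i, refPoint t c ν i = t ^ ((e i).2 : ℕ) * c (e i).1 :=
  ⟨(finCongr ν.2.symm).trans finSigmaFinEquiv.symm, fun _ => rfl⟩

theorem coords_refPoint {n : ℕ} (ν : Z s n) : coords (refPoint t c ν) = refMs t c ν.1 := by
  obtain ⟨e, he⟩ := refPoint_spec t c ν
  have h : coords (refPoint t c ν) =
      ∑ q : (b : Fin s) × Fin (ν.1 b), {t ^ (q.2 : ℕ) * c q.1} := by
    rw [coords, map_val_eq_sum, ← e.sum_comp]
    exact sum_congr rfl fun i _ => by rw [he]
  rw [h, ← Finset.univ_sigma_univ, sum_sigma, refMs]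
  refine sum_congr rfl fun b _ => ?_
  rw [Fin.sum_univ_eq_sum_range (fun k => ({t ^ k * c b} : Multiset ℂˣ)), ← map_val_eq_sum]
  rfl

/-- Distinct coordinates of a point with reference coordinates have distinct labels. -/
theorem exists_labels {n : ℕ} {ν : Fin s → ℕ} (hν : ∑ i, ν i = n) {z : Fin n → ℂˣ}
    (hz : coords z = refMs t c ν) : ∃ e : Fin n ≃ (b : Fin s) × Fin (ν b),
      ∀ i, z i = t ^ ((e i).2 : ℕ) * c (e i).1 := by
  obtain ⟨e, he⟩ := refPoint_spec t c ⟨ν, hν⟩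
  rw [← coords_refPoint t c ⟨ν, hν⟩] at hz
  obtain ⟨σ, rfl⟩ := exists_perm_of_coords_eq hz
  exact ⟨σ.trans e, fun i => he (σ i)⟩

end RefPoints

section Generic

variable {s N : ℕ} {p t : ℂˣ} {c : Fin s → ℂˣ}

theorem IsGeneric.theta_pow_ne (hp : ‖(p : ℂ)‖ < 1) (hg : IsGeneric N p t c) {k : ℤ} (hk : k ≠ 0)
    (hkN : |k| ≤ N) : theta p (t ^ k) ≠ 0 := by
  refine theta_ne_zero hp fun M hM => ?_
  rcases lt_or_gt_of_ne hk with h | h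
  · rw [abs_of_neg h] at hkN
    refine hg.pow_ne (-k).toNat (by omega) (by omega) (-M) ?_
    rw [← zpow_natCast, Int.toNat_of_nonneg (by omega), zpow_neg, zpow_neg, hM]
  · rw [abs_of_pos h] at hkN
    refine hg.pow_ne k.toNat (by omega) (by omega) M ?_
    rw [← zpow_natCast, Int.toNat_of_nonneg (by omega), hM]

theorem IsGeneric.theta_div_ne (hp : ‖(p : ℂ)‖ < 1) (hg : IsGeneric N p t c) {b b' : Fin s} {k : ℤ}
    (hne : b ≠ b' ∨ k ≠ 0) (hkN : |k| ≤ N) : theta p (t ^ k * (c b / c b')) ≠ 0 := by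
  by_cases hb : b = b'
  · subst hb
    rw [div_self', mul_one]
    exact hg.theta_pow_ne hp (hne.resolve_left (by simp)) hkN
  · exact theta_ne_zero hp (hg.div_ne b b' hb k hkN)

theorem IsGeneric.ethe_ne (hp : ‖(p : ℂ)‖ < 1) (hg : IsGeneric N p t c) {b b' : Fin s} {k k' : ℕ}
    (hne : b ≠ b' ∨ k ≠ k') (h : k + k' ≤ 2 * N - 2) (hk : k ≤ N) (hk' : k' ≤ N) :
    ethe p (t ^ k * c b) (t ^ k' * c b') ≠ 0 := by
  refine ethe_ne_zero_iff.2 ⟨?_, ?_⟩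
  · rw [mul_mul_mul_comm, ← pow_add]
    exact theta_ne_zero hp (hg.mul_ne b b' _ h)
  · have : t ^ k * c b / (t ^ k' * c b') = t ^ ((k : ℤ) - k') * (c b / c b') := by
      rw [mul_div_mul_comm, zpow_sub, zpow_natCast, zpow_natCast, div_eq_mul_inv]
    rw [this]
    refine hg.theta_div_ne hp (hne.imp_right fun h => by omega) ?_
    rw [abs_le]; omega

theorem IsGeneric.theta_sq_ne (hp : ‖(p : ℂ)‖ < 1) (hg : IsGeneric N p t c) {b : Fin s} {k : ℕ}
    (h : k + k ≤ 2 * N - 2) : theta p ((t ^ k * c b) ^ 2) ≠ 0 := by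
  rw [pow_two, mul_mul_mul_comm, ← pow_add]
  exact theta_ne_zero hp (hg.mul_ne b b _ h)

theorem IsGeneric.mono (hg : IsGeneric N p t c) {M : ℕ} (hM : M ≤ N) : IsGeneric M p t c :=
  ⟨fun k h1 h2 => hg.pow_ne k h1 (h2.trans hM),
    fun i j hij k hk => hg.div_ne i j hij k (hk.trans (by exact_mod_cast hM)),
    fun i j k hk => hg.mul_ne i j k (by omega)⟩

end Generic

theorem le_of_sum_eq {s n : ℕ} {ν : Fin s → ℕ} (hν : ∑ i, ν i = n) (b : Fin s) : ν b ≤ n :=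
  hν ▸ single_le_sum_of_canonicallyOrdered (mem_univ b)

theorem add_le_of_sum_eq {s n : ℕ} {ν : Fin s → ℕ} (hν : ∑ i, ν i = n) {b b' : Fin s}
    (h : b ≠ b') : ν b + ν b' ≤ n := by
  classical
  rw [← hν, ← sum_pair h]
  exact sum_le_sum_of_subset (subset_univ _)

/-! ### Existence of the interpolation basis -/

section Injectivity

variable {r N : ℕ} {p t : ℂˣ} {c : Fin (r + 1) → ℂˣ}

/-- A function lying in `Th p 1 r` in each variable is determined by its values at the points with
reference coordinates. -/
theorem eq_zero_of_ref (hp : ‖(p : ℂ)‖ < 1) (hr : 1 ≤ r) (hg : IsGeneric N p t c) :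
    ∀ n ≤ N, ∀ f : (Fin n → ℂˣ) → ℂ, (∀ z i, (fun x => f (Function.update z i x)) ∈ Th p 1 r) →
      (∀ ν : Fin (r + 1) → ℕ, ∑ i, ν i = n → ∀ z, coords z = refMs t c ν → f z = 0) →
      ∀ z, f z = 0 := by
  intro n
  induction n with
  | zero =>
    intro _ f _ h0 z
    exact h0 0 (by simp) z (by rw [coords_zero, refMs_zero])
  | succ n ih =>
    intro hn f hf h0 z
    rw [← Fin.snoc_init_self z]
    -- The last coordinate is frozen. If the others form a reference point of `ν`, the slice in the
    -- last variable vanishes at the `r + 1` points `t^{ν_b} c_b`, since these complete it to the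
    -- reference points of `ν + ε_b`.
    refine ih (by omega) (fun w => f (Fin.snoc w (z (Fin.last n)))) (fun w i => ?_) ?_ _
    · simpa only [Fin.snoc_update] using hf (Fin.snoc w (z (Fin.last n))) i.castSucc
    · intro ν hν w hw
      have hTh := hf (Fin.snoc w (z (Fin.last n))) (Fin.last n)
      simp only [Fin.update_snoc_last] at hTh
      refine congrFun (Th.eq_zero_even hp hr (by simp) (x := fun b => t ^ ν b * c b)
        (fun b b' hb => ?_) hTh fun b => ?_) (z (Fin.last n))
      · have := add_le_of_sum_eq hν hb
        exact hg.ethe_ne hp (Or.inl hb) (by omega) (by omega) (by omega)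
      · refine h0 (ν + Pi.single b 1) (by simp [sum_add_distrib, hν]) _ ?_
        rw [refMs_add_single, coords_snoc, hw]

end Injectivity

section HSpace

variable {p : ℂˣ} {d n : ℕ}

theorem H.slice_mem {f : (Fin n → ℂˣ) → ℂ} (hf : f ∈ H p d n) (z : Fin n → ℂˣ) (i : Fin n) :
    (fun x => f (Function.update z i x)) ∈ Th p 1 d := by
  obtain ⟨⟨F, hF, hFf⟩, -, h2, h3⟩ := hf
  refine ⟨⟨fun w => F (Function.update (fun j => (z j : ℂ)) i w), ?_, fun x => ?_⟩,
    fun x => ?_, fun x => ?_⟩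
  · refine hF.comp (fun w _ => ?_) fun w hw j => ?_
    · refine DifferentiableAt.differentiableWithinAt ?_
      exact (hasFDerivAt_update (𝕜 := ℂ) (fun j => (z j : ℂ)) w).differentiableAt
    · by_cases h : j = i
      · subst h; simpa using hw
      · simp [h]
  · refine Eq.trans ?_ (hFf _)
    refine congrArg F (funext fun j => ?_)
    by_cases h : j = i
    · subst h; simp
    · simp [h]
  · simpa using h2 i (Function.update z i x)
  · simpa using h3 i (Function.update z i x)

theorem H.coords_eq {f : (Fin n → ℂˣ) → ℂ} (hf : f ∈ H p d n) {z z' : Fin n → ℂˣ}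
    (h : coords z = coords z') : f z = f z' := eq_of_coords_eq hf.2.1 h

theorem H.prod_mem {g : ℂˣ → ℂ} (hg : g ∈ Th p 1 d) :
    (fun z : Fin n → ℂˣ => ∏ i, g (z i)) ∈ H p d n := by
  obtain ⟨⟨G, hG, h⟩, h2, h3⟩ := hg
  have hupd : ∀ (i : Fin n) (z : Fin n → ℂˣ) (x : ℂˣ),
      ∏ j, g (Function.update z i x j) = g x * ∏ j ∈ univ.erase i, g (z j) := by
    intro i z x
    rw [← mul_prod_erase _ _ (mem_univ i), Function.update_self]
    congr 1
    exact prod_congr rfl fun j hj => by rw [Function.update_of_ne (ne_of_mem_erase hj)]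
  refine ⟨⟨fun w => ∏ i, G (w i), ?_, fun z => by simp [h]⟩, fun σ z => ?_, fun i z => ?_,
    fun i z => ?_⟩
  · have hi : ∀ i : Fin n, DifferentiableOn ℂ (fun w : Fin n → ℂ => G (w i)) {w | ∀ i, w i ≠ 0} :=
      fun i => hG.comp (g := G) (f := fun w : Fin n → ℂ => w i)
        (differentiable_apply (𝕜 := ℂ) i).differentiableOn fun w hw => hw i
    induction (univ : Finset (Fin n)) using Finset.induction_on with
    | empty => simp
    | insert a s ha ih =>
      simp only [prod_insert ha]
      exact (hi a).mul ih
  · exact Equiv.prod_comp σ fun i => g (z i)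
  · simp only []
    rw [hupd, h2, one_mul, mul_prod_erase univ (fun j => g (z j)) (mem_univ i)]
  · simp only []
    rw [hupd, h3, mul_right_comm, mul_prod_erase univ (fun j => g (z j)) (mem_univ i)]

end HSpace

theorem refPoint_coords_mem {s n : ℕ} {t : ℂˣ} {c : Fin s → ℂˣ} {g : ℂˣ → ℂ} (ν : Z s n) :
    ∏ i, g (refPoint t c ν i) = ((refMs t c ν.1).map g).prod := by
  rw [← coords_refPoint, prod_map_coords]

/-- The product of `e(x, t^{μ_j} c_j)` over `j ≠ o`. -/
noncomputable def kernelFun {s : ℕ} (p t : ℂˣ) (c : Fin s → ℂˣ) (o : Fin s) (μ : Fin s → ℕ)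
    (x : ℂˣ) : ℂ := ∏ j ∈ univ.erase o, ethe p x (t ^ μ j * c j)

section Existence

variable {r n : ℕ} {p t : ℂˣ} {c : Fin (r + 1) → ℂˣ} (hp : ‖(p : ℂ)‖ < 1)
include hp

theorem kernelFun_mem_Th (o : Fin (r + 1)) (μ : Fin (r + 1) → ℕ) :
    kernelFun p t c o μ ∈ Th p 1 r := by
  have := Th.prod (univ.erase o) fun j _ => ethe_mem_Th hp (t ^ μ j * c j)
  rw [card_erase_of_mem (mem_univ o), card_univ, Fintype.card_fin, add_tsub_cancel_right,
    mul_one] at this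
  have h : kernelFun p t c o μ = ∏ j ∈ univ.erase o, fun u => ethe p u (t ^ μ j * c j) := by
    funext x; rw [Finset.prod_apply]; rfl
  rwa [h]

/-- If `ν_j > μ_j`, the point `t^{μ_j} c_j` is a coordinate of the reference point and a zero of the
kernel. This is the triangularity of the evaluation matrix. -/
theorem le_of_kernel_ne_zero {o : Fin (r + 1)} {μ : Fin (r + 1) → ℕ} {ν : Z (r + 1) n}
    (h : ∏ i, kernelFun p t c o μ (refPoint t c ν i) ≠ 0) {j : Fin (r + 1)} (hj : j ≠ o) :
    ν.1 j ≤ μ j := by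
  by_contra! hlt
  refine h ?_
  rw [refPoint_coords_mem]
  refine Multiset.prod_eq_zero (Multiset.mem_map.2 ⟨t ^ μ j * c j, ?_, ?_⟩)
  · exact (mem_refMs t c).2 ⟨j, μ j, hlt, rfl⟩
  · exact prod_eq_zero (mem_erase.2 ⟨hj, mem_univ j⟩) (ethe_self hp _)

/-- The condition on `μ_j` keeps the exponent of `t` in a product of two points within the range `2n
- 2` of the genericity hypothesis. It would reach `2n - 1` only for the last point of a string of
length `n`, paired with the node at the end of that string. -/
theorem kernel_ne_zero (hg : IsGeneric n p t c) {o : Fin (r + 1)} {μ : Z (r + 1) n}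
    (ho : ∀ j ≠ o, μ.1 j < n ∨ μ.1 j = 0) :
    ∏ i, kernelFun p t c o μ.1 (refPoint t c μ i) ≠ 0 := by
  rw [refPoint_coords_mem]
  refine Multiset.prod_ne_zero fun h0 => ?_
  obtain ⟨x, hx, hx0⟩ := Multiset.mem_map.1 h0
  obtain ⟨b, k, hk, rfl⟩ := (mem_refMs t c).1 hx
  obtain ⟨j, hj, hj0⟩ := prod_eq_zero_iff.1 hx0
  have hμ := le_of_sum_eq μ.2 b
  refine hg.ethe_ne hp ?_ ?_ (hk.le.trans hμ) (le_of_sum_eq μ.2 j) hj0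
  · by_cases hb : b = j
    · subst hb; exact Or.inr hk.ne
    · exact Or.inl hb
  · by_cases hb : b = j
    · subst hb
      rcases ho b (ne_of_mem_erase hj) with h | h <;> omega
    · have := add_le_of_sum_eq μ.2 hb
      omega

variable (hr : 1 ≤ r)
include hr

/-- Each unit vector lies in the range of evaluation, by induction along the triangular order.
Linear independence is then immediate, and spanning follows from `eq_zero_of_ref`. -/
theorem exists_interpolationBasis (hg : IsGeneric n p t c) :
    ∃ E : Z (r + 1) n → (Fin n → ℂˣ) → ℂ, IsInterpolationBasis p t c E := by
  classical
  let ev : H p r n →ₗ[ℂ] (Z (r + 1) n → ℂ) :=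
    { toFun := fun f ν => f.1 (refPoint t c ν), map_add' := fun _ _ => rfl,
      map_smul' := fun _ _ => rfl }
  let ψ : Fin (r + 1) → Z (r + 1) n → H p r n := fun o μ =>
    ⟨_, H.prod_mem (kernelFun_mem_Th hp (t := t) (c := c) o μ.1)⟩
  have hψ : ∀ o μ ν, ev (ψ o μ) ν = ∏ i, kernelFun p t c o μ.1 (refPoint t c ν i) :=
    fun _ _ _ => rfl
  have key : ∀ (o : Fin (r + 1)) (μ : Z (r + 1) n), (∀ j ≠ o, μ.1 j < n ∨ μ.1 j = 0) →
      (∀ ν : Z (r + 1) n, (∀ j ≠ o, ν.1 j ≤ μ.1 j) → ν ≠ μ →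
        Pi.single ν (1 : ℂ) ∈ LinearMap.range ev) →
      Pi.single μ (1 : ℂ) ∈ LinearMap.range ev := by
    intro o μ ho ih
    have hne := kernel_ne_zero hp hg ho
    rw [← hψ] at hne
    have hsum : ev (ψ o μ) = ev (ψ o μ) μ • Pi.single μ (1 : ℂ) +
        ∑ ν ∈ univ.erase μ, ev (ψ o μ) ν • Pi.single ν (1 : ℂ) := by
      rw [add_sum_erase univ (fun ν => ev (ψ o μ) ν • (Pi.single ν (1 : ℂ) : Z (r + 1) n → ℂ))
        (mem_univ μ)]
      funext κ
      simp [Finset.sum_apply, Pi.single_apply]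
    have hmem : ev (ψ o μ) μ • Pi.single μ (1 : ℂ) ∈ LinearMap.range ev := by
      rw [eq_sub_of_add_eq hsum.symm]
      refine sub_mem ⟨_, rfl⟩ (sum_mem fun ν hν => ?_)
      by_cases h0 : ev (ψ o μ) ν = 0
      · rw [h0, zero_smul]; exact zero_mem _
      · refine Submodule.smul_mem _ _ (ih ν (fun j hj => ?_) (ne_of_mem_erase hν))
        rw [hψ] at h0
        exact le_of_kernel_ne_zero hp h0 hj
    have := Submodule.smul_mem _ (ev (ψ o μ) μ)⁻¹ hmem
    rwa [smul_smul, inv_mul_cancel₀ hne, one_smul] at this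
  have hall : ∀ (k : ℕ) (μ : Z (r + 1) n), n - μ.1 (Fin.last r) = k →
      Pi.single μ (1 : ℂ) ∈ LinearMap.range ev := by
    intro k
    induction k using Nat.strong_induction_on with
    | _ k ih =>
      intro μ hk
      by_cases h : ∃ o, μ.1 o = n
      · obtain ⟨o, ho⟩ := h
        have h0 : ∀ j ≠ o, μ.1 j = 0 := fun j hj => by
          have := add_le_of_sum_eq μ.2 hj
          omega
        refine key o μ (fun j hj => Or.inr (h0 j hj)) fun ν hν hne => (hne ?_).elim
        have h1 : ∀ j ≠ o, ν.1 j = 0 := fun j hj => by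
          have := hν j hj
          rw [h0 j hj] at this
          omega
        have h2 : ν.1 o = n := by
          have := ν.2
          rwa [sum_eq_single o (fun j _ hj => h1 j hj) (by simp)] at this
        refine Subtype.ext (funext fun j => ?_)
        by_cases hj : j = o
        · rw [hj, h2, ho]
        · rw [h1 j hj, h0 j hj]
      -- Otherwise omit the last index. Any other surviving `ν` has smaller or equal first parts,
      -- hence a strictly larger last part, and is covered by induction.
      · push Not at h
        refine key (Fin.last r) μ
          (fun j _ => Or.inl (lt_of_le_of_ne (le_of_sum_eq μ.2 j) (h j))) fun ν hν hne => ?_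
        have hle : ∀ j : Fin r, ν.1 j.castSucc ≤ μ.1 j.castSucc :=
          fun j => hν _ (Fin.castSucc_ne_last j)
        have h1 := ν.2
        have h2 := μ.2
        rw [Fin.sum_univ_castSucc] at h1 h2
        have hlt : μ.1 (Fin.last r) < ν.1 (Fin.last r) := by
          have h3 : ∑ j : Fin r, ν.1 j.castSucc ≤ ∑ j : Fin r, μ.1 j.castSucc :=
            sum_le_sum fun j _ => hle j
          refine lt_of_le_of_ne (by omega) fun heq => hne ?_
          have h4 : ∑ j : Fin r, ν.1 j.castSucc = ∑ j : Fin r, μ.1 j.castSucc := by omega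
          rw [sum_eq_sum_iff_of_le fun j _ => hle j] at h4
          refine Subtype.ext (funext fun j => ?_)
          induction j using Fin.lastCases with
          | last => exact heq.symm
          | cast j => exact h4 j (mem_univ j)
        have := le_of_sum_eq ν.2 (Fin.last r)
        exact ih _ (by omega) ν rfl
  choose F hF using fun μ => hall _ μ rfl
  have hint : ∀ μ ν, (F μ).1 (refPoint t c ν) = if μ = ν then 1 else 0 := fun μ ν => by
    have : ev (F μ) ν = (Pi.single μ 1 : Z (r + 1) n → ℂ) ν := by rw [hF]
    rw [Pi.single_apply] at this
    exact this.trans (if_congr eq_comm rfl rfl)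
  refine ⟨fun μ => (F μ).1, ?_, ?_, hint⟩
  · rw [Fintype.linearIndependent_iff]
    intro w hw ν
    have := congrFun hw (refPoint t c ν)
    simpa [Finset.sum_apply, hint] using this
  · refine le_antisymm (Submodule.span_le.2 ?_) fun f hf => ?_
    · rintro _ ⟨μ, rfl⟩
      exact (F μ).2
    · have hmem : ∑ μ, f (refPoint t c μ) • (F μ).1 ∈ H p r n :=
        sum_mem fun μ _ => Submodule.smul_mem _ _ (F μ).2
      have hsub := sub_mem hf hmem
      have h0 : f - ∑ μ, f (refPoint t c μ) • (F μ).1 = 0 := by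
        funext z
        refine eq_zero_of_ref hp hr hg n le_rfl _ (fun z i => H.slice_mem hsub z i)
          (fun ν hν z hz => ?_) z
        rw [H.coords_eq hsub (hz.trans (coords_refPoint t c ⟨ν, hν⟩).symm)]
        simp [Finset.sum_apply, hint]
      rw [sub_eq_zero.1 h0]
      exact sum_mem fun μ _ => Submodule.smul_mem _ _ (Submodule.subset_span ⟨μ, rfl⟩)

theorem isInterpolationBasis_interpE (hg : IsGeneric n p t c) :
    IsInterpolationBasis p t c (interpE (n := n) p t c) := by
  have h := exists_interpolationBasis hp hr hg
  rw [interpE, dif_pos h]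
  exact h.choose_spec

end Existence

section InterpE

variable {r n : ℕ} {p t : ℂˣ} {c : Fin (r + 1) → ℂˣ} {E : Z (r + 1) n → (Fin n → ℂˣ) → ℂ}

theorem IsInterpolationBasis.mem (hE : IsInterpolationBasis p t c E) (μ : Z (r + 1) n) :
    E μ ∈ H p r n := hE.span_eq ▸ Submodule.subset_span ⟨μ, rfl⟩

theorem IsInterpolationBasis.eval (hE : IsInterpolationBasis p t c E) (μ : Z (r + 1) n)
    {ν : Fin (r + 1) → ℕ} (hν : ∑ i, ν i = n) {z : Fin n → ℂˣ} (hz : coords z = refMs t c ν) :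
    E μ z = if μ.1 = ν then 1 else 0 := by
  rw [H.coords_eq (hE.mem μ) (hz.trans (coords_refPoint t c ⟨ν, hν⟩).symm), hE.interpolation]
  simp only [Subtype.ext_iff]

end InterpE

/-! ### From reference points to all regular points -/

section Countability

variable {p : ℂˣ} (hp : ‖(p : ℂ)‖ < 1)
include hp

theorem countable_theta_eq_zero : {u : ℂˣ | theta p u = 0}.Countable := by
  refine (Set.countable_range fun N : ℤ => p ^ N).mono fun u hu => ?_
  by_contra h
  exact theta_ne_zero hp (fun N hN => h ⟨N, hN.symm⟩) hu

theorem countable_ethe_eq_zero (y : ℂˣ) : {x : ℂˣ | ethe p x y = 0}.Countable := by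
  have h := countable_theta_eq_zero hp
  refine ((h.preimage (mul_left_injective y)).union
    (h.preimage (div_left_injective (b := y)))).mono fun x hx => ?_
  by_contra h'
  rw [Set.mem_union, not_or] at h'
  exact ethe_ne_zero_iff.2 ⟨h'.1, h'.2⟩ hx

theorem countable_theta_sq_eq_zero : {x : ℂˣ | theta p (x ^ 2) = 0}.Countable := by
  have h : {x : ℂˣ | theta p (x ^ 2) = 0} ⊆
      ⋃ u ∈ {u : ℂˣ | theta p u = 0}, {x : ℂˣ | x ^ 2 = u} := fun x hx => by simpa using hx
  refine ((countable_theta_eq_zero hp).biUnion fun u _ => ?_).mono h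
  rcases Set.eq_empty_or_nonempty {x : ℂˣ | x ^ 2 = u} with h0 | ⟨a, ha⟩
  · rw [h0]; exact Set.countable_empty
  · refine (Set.toFinite {a, -a}).countable.mono fun x hx => ?_
    have h1 : (x : ℂ) ^ 2 = (a : ℂ) ^ 2 := by
      have : x ^ 2 = a ^ 2 := hx.trans ha.symm
      exact_mod_cast congrArg Units.val this
    rcases sq_eq_sq_iff_eq_or_eq_neg.1 h1 with h2 | h2
    · exact Or.inl (Units.ext h2)
    · exact Or.inr (Units.ext h2)

omit hp in
theorem exists_units_notMem {C : Set ℂˣ} (hC : C.Countable) : ∃ x, x ∉ C := by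
  by_contra! h
  have h1 : (Set.univ : Set ℂ) ⊆ insert 0 (Units.val '' C) := fun w _ => by
    by_cases hw : w = 0
    · exact Or.inl hw
    · exact Or.inr ⟨Units.mk0 w hw, h _, rfl⟩
  exact not_countable_complex (((hC.image _).insert 0).mono h1)

theorem exists_inequivalent {C : Set ℂˣ} (hC : C.Countable) (m : ℕ) :
    ∃ x : Fin m → ℂˣ, (∀ b, x b ∉ C) ∧ ∀ b b', b ≠ b' → ethe p (x b) (x b') ≠ 0 := by
  induction m with
  | zero => exact ⟨fun _ => 1, fun b => b.elim0, fun b => b.elim0⟩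
  | succ m ih =>
    obtain ⟨x, hx, hxx⟩ := ih
    obtain ⟨y, hy⟩ := exists_units_notMem
      (hC.union (Set.countable_iUnion fun b : Fin m => countable_ethe_eq_zero hp (x b)))
    rw [Set.mem_union, not_or, Set.mem_iUnion, not_exists] at hy
    refine ⟨Fin.snoc x y, fun b => ?_, fun b b' hb => ?_⟩
    · induction b using Fin.lastCases with
      | last => simpa using hy.1
      | cast b => simpa using hx b
    · induction b using Fin.lastCases with
      | last =>
        induction b' using Fin.lastCases with
        | last => exact (hb rfl).elim
        | cast b' => simpa using hy.2 b'
      | cast b =>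
        induction b' using Fin.lastCases with
        | last => simpa using ethe_ne_zero_symm hp (hy.2 b)
        | cast b' => simpa using hxx b b' fun h => hb (congrArg _ h)

end Countability

/-- The coordinates of `z` are pairwise inequivalent, no half-periods, and inequivalent to the
elements of `Y`. -/
def RegOff (p : ℂˣ) (Y : Set ℂˣ) {n : ℕ} (z : Fin n → ℂˣ) : Prop :=
  (∀ i, theta p (z i ^ 2) ≠ 0) ∧ (∀ i j, i ≠ j → ethe p (z i) (z j) ≠ 0) ∧
    ∀ i, ∀ y ∈ Y, ethe p (z i) y ≠ 0

theorem regOff_empty_iff {p : ℂˣ} {n : ℕ} {z : Fin n → ℂˣ} :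
    RegOff p ∅ z ↔ IsRegularPoint p z := by
  refine ⟨fun h i => ⟨h.1 i, fun j hj => ethe_ne_zero_iff.1 (h.2.1 i j hj.symm)⟩,
    fun h => ⟨fun i => (h i).1, fun i j hj => ethe_ne_zero_iff.2 ((h i).2 j hj.symm), by simp⟩⟩

theorem regOff_snoc_iff {p : ℂˣ} (hp : ‖(p : ℂ)‖ < 1) {Y : Set ℂˣ} {n : ℕ} {w : Fin n → ℂˣ}
    {x : ℂˣ} : RegOff p Y (Fin.snoc w x : Fin (n + 1) → ℂˣ) ↔
      RegOff p (insert x Y) w ∧ theta p (x ^ 2) ≠ 0 ∧ ∀ y ∈ Y, ethe p x y ≠ 0 := by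
  constructor
  · rintro ⟨h1, h2, h3⟩
    refine ⟨⟨fun i => by simpa using h1 i.castSucc, fun i j hij => ?_, fun i y hy => ?_⟩,
      by simpa using h1 (Fin.last n), fun y hy => by simpa using h3 (Fin.last n) y hy⟩
    · simpa using h2 i.castSucc j.castSucc fun h => hij (Fin.castSucc_injective _ h)
    · rcases Set.mem_insert_iff.1 hy with rfl | hy
      · simpa using h2 i.castSucc (Fin.last n) (Fin.castSucc_ne_last i)
      · simpa using h3 i.castSucc y hy
  · rintro ⟨⟨h1, h2, h3⟩, h4, h5⟩
    refine ⟨fun i => ?_, fun i j hij => ?_, fun i y hy => ?_⟩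
    · induction i using Fin.lastCases with
      | last => simpa using h4
      | cast i => simpa using h1 i
    · induction i using Fin.lastCases with
      | last =>
        induction j using Fin.lastCases with
        | last => exact (hij rfl).elim
        | cast j => simpa using ethe_ne_zero_symm hp (h3 j x (Set.mem_insert _ _))
      | cast i =>
        induction j using Fin.lastCases with
        | last => simpa using h3 i x (Set.mem_insert _ _)
        | cast j => simpa using h2 i j fun h => hij (congrArg _ h)
    · induction i using Fin.lastCases with
      | last => simpa using h5 y hy
      | cast i => simpa using h3 i y (Set.mem_insert_of_mem _ hy)

/-- In each variable, `f` is determined on `RegOff p Y` by its values at `s` inequivalent points. -/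
def SlicewiseDetermined (p : ℂˣ) (s : ℕ) (Y : Set ℂˣ) {n : ℕ} (f : (Fin n → ℂˣ) → ℂ) : Prop :=
  ∀ (z : Fin n → ℂˣ) (i : Fin n) (x : Fin s → ℂˣ), (∀ b b', b ≠ b' → ethe p (x b) (x b') ≠ 0) →
    (∀ b, RegOff p Y (Function.update z i (x b)) ∧ f (Function.update z i (x b)) = 0) →
    ∀ y, RegOff p Y (Function.update z i y) → f (Function.update z i y) = 0

section Regular

variable {s N : ℕ} {p t : ℂˣ} {c : Fin s → ℂˣ} (hp : ‖(p : ℂ)‖ < 1)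
include hp

/-- The exponents of `t` in the coordinates are less than `N`, so in products of two coordinates
they are at most `2N - 2` and in quotients less than `N` in absolute value, as genericity requires.
-/
theorem regOff_of_refMs (hg : IsGeneric N p t c) {n : ℕ} (hn : n ≤ N) {Y : Set ℂˣ}
    (hY : ∀ y ∈ Y, ∀ b, ∀ k < N, ethe p (t ^ k * c b) y ≠ 0) {ν : Fin s → ℕ}
    (hν : ∑ i, ν i = n) {z : Fin n → ℂˣ} (hz : coords z = refMs t c ν) : RegOff p Y z := by
  obtain ⟨e, he⟩ := exists_labels t c hν hz
  have hlt : ∀ i, ((e i).2 : ℕ) < N := fun i =>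
    (e i).2.2.trans_le ((le_of_sum_eq hν _).trans hn)
  refine ⟨fun i => ?_, fun i j hij => ?_, fun i y hy => ?_⟩
  · rw [he]
    have := hlt i
    exact hg.theta_sq_ne hp (by omega)
  · rw [he, he]
    have h1 := hlt i
    have h2 := hlt j
    refine hg.ethe_ne hp ?_ (by omega) h1.le h2.le
    by_contra! h
    refine hij (e.injective (Sigma.ext h.1 ?_))
    exact (Fin.heq_ext_iff (by rw [h.1])).2 h.2
  · rw [he]
    exact hY y hy _ _ (hlt i)

/-- The analogue of `eq_zero_of_ref` for a function meaningful at regular points only. A frozen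
coordinate must be avoided by the remaining ones, and `Y` records the frozen coordinates. They must
also be inequivalent to the elements of all strings, so that reference points stay regular. A last
coordinate that violates this is reached at the end from `s` generic ones. -/
theorem eq_zero_of_ref_of_slicewise (hg : IsGeneric N p t c) :
    ∀ n ≤ N, ∀ (Y : Set ℂˣ) (f : (Fin n → ℂˣ) → ℂ), Y.Countable →
      (∀ y ∈ Y, ∀ b, ∀ k < N, ethe p (t ^ k * c b) y ≠ 0) → SlicewiseDetermined p s Y f →
      (∀ ν : Fin s → ℕ, ∑ i, ν i = n → ∀ z, coords z = refMs t c ν → f z = 0) →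
      ∀ z, RegOff p Y z → f z = 0 := by
  intro n
  induction n with
  | zero =>
    intro _ Y f _ _ _ h0 z _
    exact h0 0 (by simp) z (by rw [coords_zero, refMs_zero])
  | succ n ih =>
    intro hn Y f hYc hY hf h0
    have key : ∀ (w : Fin n → ℂˣ) (x : ℂˣ), RegOff p Y (Fin.snoc w x : Fin (n + 1) → ℂˣ) →
        (∀ b, ∀ k < N, ethe p (t ^ k * c b) x ≠ 0) → f (Fin.snoc w x) = 0 := by
      intro w x hreg hx
      obtain ⟨hw, hx2, hxY⟩ := (regOff_snoc_iff hp).1 hreg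
      have hY' : ∀ y ∈ insert x Y, ∀ b, ∀ k < N, ethe p (t ^ k * c b) y ≠ 0 := by
        rintro y (rfl | hy)
        exacts [hx, hY y hy]
      refine ih (by omega) (insert x Y) (fun w => f (Fin.snoc w x)) (hYc.insert x) hY' ?_ ?_ w hw
      · intro z i v hv hv0 y hy
        have := hf (Fin.snoc z x) i.castSucc v hv
        simp only [← Fin.snoc_update] at this
        exact this (fun b => ⟨(regOff_snoc_iff hp).2 ⟨(hv0 b).1, hx2, hxY⟩, (hv0 b).2⟩) y
          ((regOff_snoc_iff hp).2 ⟨hy, hx2, hxY⟩)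
      · intro ν hν z hz
        have := hf (Fin.snoc z x) (Fin.last n) (fun b => t ^ ν b * c b) fun b b' hb => by
          have := add_le_of_sum_eq hν hb
          exact hg.ethe_ne hp (Or.inl hb) (by omega) (by omega) (by omega)
        simp only [Fin.update_snoc_last] at this
        refine this (fun b => ?_) x ((regOff_snoc_iff hp).2
          ⟨regOff_of_refMs hp hg (by omega) hY' hν hz, hx2, hxY⟩)
        have hsum : ∑ i, (ν + Pi.single b 1 : Fin s → ℕ) i = n + 1 := by
          simp [sum_add_distrib, hν]
        have hco : coords (Fin.snoc z (t ^ ν b * c b) : Fin (n + 1) → ℂˣ) =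
            refMs t c (ν + Pi.single b 1) := by rw [refMs_add_single, coords_snoc, hz]
        exact ⟨regOff_of_refMs hp hg hn hY hsum hco, h0 _ hsum _ hco⟩
    intro z hz
    rw [← Fin.snoc_init_self z] at hz ⊢
    obtain ⟨hw, hx2, hxY⟩ := (regOff_snoc_iff hp).1 hz
    set w := Fin.init z
    -- For an arbitrary last coordinate, choose `s` inequivalent values outside the countable set of
    -- forbidden ones. There `key` applies, and the slice in the last variable carries the vanishing
    -- over.
    have hC : (({x : ℂˣ | theta p (x ^ 2) = 0} ∪ ⋃ y ∈ Y, {x : ℂˣ | ethe p x y = 0}) ∪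
        ((⋃ i : Fin n, {x : ℂˣ | ethe p x (w i) = 0}) ∪
          ⋃ b : Fin s, ⋃ k : ℕ, {x : ℂˣ | ethe p x (t ^ k * c b) = 0})).Countable :=
      ((countable_theta_sq_eq_zero hp).union
        (hYc.biUnion fun y _ => countable_ethe_eq_zero hp y)).union
        ((Set.countable_iUnion fun i => countable_ethe_eq_zero hp _).union
          (Set.countable_iUnion fun b => Set.countable_iUnion fun k =>
            countable_ethe_eq_zero hp _))
    obtain ⟨v, hv, hvv⟩ := exists_inequivalent hp hC s
    simp only [Set.mem_union, Set.mem_iUnion, Set.mem_ofPred_eq, not_or, not_exists] at hv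
    have := hf (Fin.snoc w (z (Fin.last n))) (Fin.last n) v hvv
    simp only [Fin.update_snoc_last] at this
    refine this (fun b => ?_) _ hz
    obtain ⟨⟨hv1, hv2⟩, hv3, hv4⟩ := hv b
    have hreg : RegOff p Y (Fin.snoc w (v b) : Fin (n + 1) → ℂˣ) := by
      refine (regOff_snoc_iff hp).2 ⟨⟨hw.1, hw.2.1, ?_⟩, hv1, hv2⟩
      rintro i y (rfl | hy)
      · exact ethe_ne_zero_symm hp (hv3 i)
      · exact hw.2.2 i y (Set.mem_insert_of_mem _ hy)
    exact ⟨hreg, key w (v b) hreg fun b' k _ => ethe_ne_zero_symm hp (hv4 b' k)⟩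

end Regular

/-! ### The operator `∇` as a function of one variable -/

theorem prod_erase_eq_prod_removeNth {M : Type*} [CommMonoid M] {n : ℕ} (i : Fin (n + 1))
    (h : Fin (n + 1) → M) : ∏ j ∈ univ.erase i, h j = ∏ j, h (i.succAbove j) := by
  rw [Fin.univ_succAbove n i, erase_cons, prod_map]; rfl

section Terms

variable {r n : ℕ} (p t : ℂˣ) (a : Fin ((r + 1) + (r + 3)) → ℂˣ)

/-- The factor of `f_i^+` depending on `u = z_i` only. -/
noncomputable def fHead (u : ℂˣ) : ℂ :=
  (∏ k, theta p (a k * u)) / ((u : ℂ) ^ (r + 1) * theta p (u ^ 2))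

/-- `f_i^+` as a function of `u = z_i` and of the tuple `w` of the other coordinates. -/
noncomputable def fTerm (u : ℂˣ) (w : Fin n → ℂˣ) : ℂ :=
  fHead p a u * ∏ j, (t * ethe p (t * u) (w j) / ethe p u (w j))

/-- `f_i^+` with its denominators cleared. -/
noncomputable def fCleared (w : Fin n → ℂˣ) (u : ℂˣ) : ℂ :=
  (∏ k, theta p (a k * u)) * ((u⁻¹ : ℂˣ) : ℂ) ^ (r + 2) * ∏ j, (t * ethe p (t * u) (w j))

variable {p t a}

theorem theta_ratio_eq (u v : ℂˣ) :
    theta p (t * u * v) * theta p (t * u / v) / (theta p (u * v) * theta p (u / v)) =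
      t * ethe p (t * u) v / ethe p u v := by
  have hu : (u : ℂ) ≠ 0 := u.ne_zero
  have ht : (t : ℂ) ≠ 0 := t.ne_zero
  rw [ethe, ethe]
  simp only [Units.val_inv_eq_inv_val, Units.val_mul]
  field_simp

theorem fPlus_eq (i : Fin (n + 1)) (z : Fin (n + 1) → ℂˣ) :
    fPlus p t a i z = fTerm p t a (z i) (i.removeNth z) := by
  rw [fPlus, fTerm, fHead, prod_erase_eq_prod_removeNth]
  simp only [theta_ratio_eq]
  rfl

theorem fHead_mul_oddTheta {u : ℂˣ} (hu : theta p (u ^ 2) ≠ 0) :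
    fHead p a u * oddTheta p u = (∏ k, theta p (a k * u)) * ((u⁻¹ : ℂˣ) : ℂ) ^ (r + 2) := by
  have h0 : (u : ℂ) ≠ 0 := u.ne_zero
  rw [fHead, oddTheta]
  simp only [Units.val_inv_eq_inv_val, inv_pow]
  field_simp
  ring

variable (hp : ‖(p : ℂ)‖ < 1)
include hp

theorem ethe_inv_right (u v : ℂˣ) : ethe p u v⁻¹ = ethe p u v := by
  rw [ethe_swap hp, ethe_inv_left hp, ← ethe_swap hp]

theorem oddTheta_inv (u : ℂˣ) : oddTheta p u⁻¹ = -oddTheta p u := by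
  simpa using (oddTheta_mem_Th hp).2.1 u

theorem fMinus_eq (i : Fin (n + 1)) (z : Fin (n + 1) → ℂˣ) :
    fMinus p t a i z = fTerm p t a (z i)⁻¹ (i.removeNth z) := by
  rw [fMinus, fPlus_eq, fTerm, fTerm]
  simp [Fin.removeNth, ethe_inv_right hp]

theorem nablaFormula_eq (φ : (Fin n → ℂˣ) → ℂ) (z : Fin (n + 1) → ℂˣ) :
    nablaFormula p t a φ z = ∑ i, (fTerm p t a (z i) (i.removeNth z) +
      fTerm p t a (z i)⁻¹ (i.removeNth z)) * φ (i.removeNth z) := by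
  simp only [nablaFormula, fPlus_eq, fMinus_eq hp]

omit hp in
theorem fTerm_mul {u : ℂˣ} {w : Fin n → ℂˣ} (hu : theta p (u ^ 2) ≠ 0)
    (hw : ∀ l, ethe p u (w l) ≠ 0) :
    fTerm p t a u w * (oddTheta p u * ∏ l, ethe p u (w l)) = fCleared p t a w u := by
  rw [fTerm, fCleared, mul_mul_mul_comm, fHead_mul_oddTheta hu, ← prod_mul_distrib]
  congr 1
  exact prod_congr rfl fun l _ => div_mul_cancel₀ _ (hw l)

omit hp in
-- The factor with index `k` is kept out of the denominators, so the identity remains valid at `u =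
-- w_k`, where it describes the residue of `f_i^+`.
theorem fTerm_erase_mul {u : ℂˣ} {w : Fin n → ℂˣ} (hu : theta p (u ^ 2) ≠ 0) (k : Fin n)
    (hw : ∀ l ≠ k, ethe p u (w l) ≠ 0) :
    fHead p a u * t * (∏ l ∈ univ.erase k, (t * ethe p (t * u) (w l) / ethe p u (w l))) *
      ethe p (t * u) (w k) * oddTheta p u * ∏ l ∈ univ.erase k, ethe p u (w l) =
      fCleared p t a w u := by
  have h1 : (∏ l ∈ univ.erase k, (t * ethe p (t * u) (w l) / ethe p u (w l))) *
      ∏ l ∈ univ.erase k, ethe p u (w l) = ∏ l ∈ univ.erase k, (t * ethe p (t * u) (w l)) := by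
    rw [← prod_mul_distrib]
    exact prod_congr rfl fun l hl => div_mul_cancel₀ _ (hw l (ne_of_mem_erase hl))
  rw [fCleared, ← fHead_mul_oddTheta hu, ← mul_prod_erase univ (fun j => (t : ℂ) * _)
    (mem_univ k), ← h1]
  ring

theorem theta_sq_inv_ne {u : ℂˣ} (hu : theta p (u ^ 2) ≠ 0) : theta p (u⁻¹ ^ 2) ≠ 0 := by
  rw [inv_pow, theta_inv hp]
  exact mul_ne_zero (neg_ne_zero.2 (Units.ne_zero _)) hu

theorem fTerm_inv_mul {u : ℂˣ} {w : Fin n → ℂˣ} (hu : theta p (u ^ 2) ≠ 0)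
    (hw : ∀ l, ethe p u (w l) ≠ 0) :
    fTerm p t a u⁻¹ w * (oddTheta p u * ∏ l, ethe p u (w l)) = -fCleared p t a w u⁻¹ := by
  rw [← fTerm_mul (theta_sq_inv_ne hp hu) fun l => by rw [ethe_inv_left hp]; exact hw l]
  simp only [ethe_inv_left hp, oddTheta_inv hp]
  ring

theorem holUnits_const_mul_theta (b : ℂˣ) : HolUnits fun x => theta p (b * x) :=
  (holUnits_theta hp).comp (m := fun u => b * u) (by
    simpa [Pi.mul_def] using (HolUnits.const (b : ℂ)).mul HolUnits.val)

theorem holUnits_fCleared (w : Fin n → ℂˣ) : HolUnits (fCleared p t a w) := by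
  have h1 := HolUnits.prod univ fun k (_ : k ∈ univ) => holUnits_const_mul_theta hp (a k)
  have h2 := HolUnits.prod (range (r + 2)) fun _ _ => HolUnits.val_inv
  have h3 := HolUnits.prod univ fun l (_ : l ∈ univ) => (HolUnits.const (t : ℂ)).mul
    ((ethe_mem_Th hp (w l)).1.comp (m := fun u => t * u) (by
      simpa [Pi.mul_def] using (HolUnits.const (t : ℂ)).mul HolUnits.val))
  have h : fCleared p t a w = (∏ k, fun x => theta p (a k * x)) *
      (∏ _i ∈ range (r + 2), fun x : ℂˣ => ((x⁻¹ : ℂˣ) : ℂ)) *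
      ∏ l, ((fun _ => (t : ℂ)) * ((fun u => ethe p u (w l)) ∘ fun u => t * u)) := by
    funext x
    simp [fCleared, Finset.prod_apply]
  rw [h]
  exact (h1.mul h2).mul h3

/-- The `2r + 4` theta factors contribute `(∏ a_k)⁻¹` with an even number of signs, and the kernels
contribute `t^{-2n}`. The balancing condition says that these constants cancel. -/
theorem fCleared_p_mul (hbal : t ^ (2 * n) * ∏ k, a k = 1) (w : Fin n → ℂˣ) (x : ℂˣ) :
    fCleared p t a w (p * x) =
      fCleared p t a w x * (((p * x ^ 2) ^ (-((r + 2 + n : ℕ) : ℤ)) : ℂˣ) : ℂ) := by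
  have hx : (x : ℂ) ≠ 0 := x.ne_zero
  have hp0 : (p : ℂ) ≠ 0 := p.ne_zero
  have ht : (t : ℂ) ≠ 0 := t.ne_zero
  have hbal' : (t : ℂ) ^ (2 * n) * ∏ k, (a k : ℂ) = 1 := by
    simpa using congrArg Units.val hbal
  have h1 : ∏ k, theta p (a k * (p * x)) =
      (∏ k, (a k : ℂ))⁻¹ * ((x : ℂ) ^ (2 * (r + 2)))⁻¹ * ∏ k, theta p (a k * x) := by
    have : ∀ k, theta p (a k * (p * x)) = -1 * (a k : ℂ)⁻¹ * (x : ℂ)⁻¹ * theta p (a k * x) := by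
      intro k
      rw [mul_left_comm, theta_mul_left hp]
      simp only [Units.val_inv_eq_inv_val, Units.val_mul, mul_inv]
      ring
    simp only [this, prod_mul_distrib, prod_const, card_univ, Fintype.card_fin, prod_inv_distrib]
    have h4 : (-1 : ℂ) ^ (r + 1 + (r + 3)) = 1 := Even.neg_one_pow ⟨r + 2, by ring⟩
    have h5 : ((x : ℂ)⁻¹) ^ (r + 1 + (r + 3)) = ((x : ℂ) ^ (2 * (r + 2)))⁻¹ := by
      rw [inv_pow]; congr 2; ring
    rw [h4, h5]
    ring
  have h2 : ∏ l, ((t : ℂ) * ethe p (t * (p * x)) (w l)) =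
      ((p : ℂ) ^ n * t ^ (2 * n) * x ^ (2 * n))⁻¹ * ∏ l, ((t : ℂ) * ethe p (t * x) (w l)) := by
    have : ∀ l, (t : ℂ) * ethe p (t * (p * x)) (w l) =
        ((p : ℂ) * t ^ 2 * x ^ 2)⁻¹ * ((t : ℂ) * ethe p (t * x) (w l)) := by
      intro l
      rw [mul_left_comm t p x, ethe_p_mul_left hp]
      simp only [zpow_neg, zpow_one, Units.val_inv_eq_inv_val, Units.val_mul,
        Units.val_pow_eq_pow_val]
      rw [mul_pow]
      ring
    simp only [this]
    rw [prod_mul_distrib, prod_const, card_univ, Fintype.card_fin, inv_pow, mul_pow, mul_pow,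
      pow_mul, pow_mul]
  rw [fCleared, fCleared, h1, h2]
  have h3 : (∏ k, (a k : ℂ))⁻¹ = (t : ℂ) ^ (2 * n) :=
    inv_eq_of_mul_eq_one_left hbal'
  rw [h3]
  simp only [zpow_neg, zpow_natCast, Units.val_inv_eq_inv_val, Units.val_mul,
    Units.val_pow_eq_pow_val, inv_pow]
  generalize ∏ k, theta p (a k * x) = A
  generalize ∏ l, ((t : ℂ) * ethe p (t * x) (w l)) = B
  have h4 : ((p : ℂ) * x) ^ (r + 2) * (p ^ n * x ^ (2 * n) * x ^ (2 * (r + 2))) =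
      x ^ (r + 2) * (p * x ^ 2) ^ (r + 2 + n) := by ring
  generalize (p : ℂ) = P at *
  generalize (t : ℂ) = T at *
  generalize (x : ℂ) = X at *
  calc _ = A * B * (T ^ (2 * n) * (T ^ (2 * n))⁻¹) *
        ((P * X) ^ (r + 2) * (P ^ n * X ^ (2 * n) * X ^ (2 * (r + 2))))⁻¹ := by
        simp only [mul_inv]; ring
    _ = _ := by rw [h4, mul_inv_cancel₀ (pow_ne_zero _ ht), mul_inv]; ring

omit hp in
/-- The antisymmetrization of a quasi-periodic function. -/
theorem sub_inv_mem_Th {g : ℂˣ → ℂ} {d : ℕ} (hg : HolUnits g)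
    (hq : ∀ x, g (p * x) = g x * (((p * x ^ 2) ^ (-(d : ℤ)) : ℂˣ) : ℂ)) :
    (fun x => g x - g x⁻¹) ∈ Th p (-1) d := by
  refine ⟨?_, fun x => by simp, fun x => ?_⟩
  · have := hg.add ((hg.comp (m := fun x => x⁻¹) HolUnits.val_inv).smul (-1))
    convert this using 1
    funext x
    simp [sub_eq_add_neg]
  · have h1 := hq (p * x)⁻¹
    rw [mul_inv, mul_inv_cancel_left] at h1
    have h2 : (p * (p⁻¹ * x⁻¹) ^ 2) ^ (-(d : ℤ)) = ((p * x ^ 2) ^ (-(d : ℤ)))⁻¹ := by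
      rw [← inv_zpow]
      congr 1
      rw [mul_pow, inv_pow, inv_pow, pow_two p, mul_inv p p, mul_inv, ← mul_assoc,
        mul_inv_cancel_left]
    rw [h2] at h1
    simp only [hq, mul_inv, h1]
    rw [sub_mul, mul_assoc (g _), Units.inv_mul, mul_one]

end Terms

section Slices

variable {r n : ℕ} {p t : ℂˣ} {a : Fin ((r + 1) + (r + 3)) → ℂˣ}

theorem coords_removeNth_update {α : Type*} (z : Fin (n + 1) → α) (i : Fin (n + 1)) (j : Fin n)
    (x : α) : coords ((i.succAbove j).removeNth (Function.update z i x)) =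
      x ::ₘ (univ.erase j).val.map (i.removeNth z) := by
  have h1 := coords_cons_removeNth (Function.update z i x) i
  have h2 := coords_cons_removeNth (Function.update z i x) (i.succAbove j)
  rw [Function.update_self, Fin.removeNth_update] at h1
  rw [Function.update_of_ne (Fin.succAbove_ne i j)] at h2
  rw [← h1] at h2
  have h3 : coords (i.removeNth z) = z (i.succAbove j) ::ₘ (univ.erase j).val.map (i.removeNth z) := by
    rw [coords, ← insert_erase (mem_univ j), insert_val_of_notMem (notMem_erase j univ),
      Multiset.map_cons, erase_insert (notMem_erase j univ)]
    rfl
  rw [h3, Multiset.cons_swap] at h2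
  exact (Multiset.cons_inj_right _).1 h2

theorem fTerm_eq_of_coords (u : ℂˣ) (z : Fin (n + 1) → ℂˣ) (i : Fin (n + 1)) (j : Fin n) (x : ℂˣ) :
    fTerm p t a u ((i.succAbove j).removeNth (Function.update z i x)) =
      fHead p a u * (t * ethe p (t * u) x / ethe p u x *
        ∏ l ∈ univ.erase j, (t * ethe p (t * u) (i.removeNth z l) / ethe p u (i.removeNth z l))) := by
  rw [fTerm, ← prod_map_coords _ fun v => (t : ℂ) * ethe p (t * u) v / ethe p u v,
    coords_removeNth_update, Multiset.map_cons, Multiset.prod_cons, Multiset.map_map]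
  rfl

theorem regOff_update {z : Fin (n + 1) → ℂˣ} {i : Fin (n + 1)} {x : ℂˣ}
    (h : RegOff p ∅ (Function.update z i x)) :
    RegOff p ∅ (i.removeNth z) ∧ theta p (x ^ 2) ≠ 0 ∧ ∀ l, ethe p x (i.removeNth z l) ≠ 0 := by
  have hs : ∀ l, Function.update z i x (i.succAbove l) = i.removeNth z l := fun l =>
    Function.update_of_ne (Fin.succAbove_ne i l) _ _
  refine ⟨⟨fun l => ?_, fun l l' hl => ?_, by simp⟩, ?_, fun l => ?_⟩
  · rw [← hs]; exact h.1 _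
  · rw [← hs, ← hs]; exact h.2.1 _ _ fun h' => hl (Fin.succAbove_right_injective h')
  · simpa using h.1 i
  · have := h.2.1 i (i.succAbove l) (Fin.succAbove_ne i l).symm
    rwa [hs, Function.update_self] at this

variable (p t a) in
/-- The coefficient of the `j`-th summand of the numerator of `∇φ` in one variable. -/
noncomputable def sliceCoeff (w : Fin n → ℂˣ) (j : Fin n) (u : ℂˣ) : ℂ :=
  fHead p a u * t *
    ∏ l ∈ univ.erase j, (t * ethe p (t * u) (w l) / ethe p u (w l))

variable (p) in
/-- The denominator of `∇φ` in one variable. -/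
noncomputable def sliceDenom (w : Fin n → ℂˣ) (x : ℂˣ) : ℂ :=
  oddTheta p x * ∏ l, ethe p x (w l)

variable (p t a) in
/-- The numerator of `∇φ - ψ` as a function of the `i`-th variable. -/
noncomputable def sliceNum (φ : (Fin n → ℂˣ) → ℂ) (ψ : (Fin (n + 1) → ℂˣ) → ℂ)
    (z : Fin (n + 1) → ℂˣ) (i : Fin (n + 1)) (x : ℂˣ) : ℂ :=
  φ (i.removeNth z) * (fCleared p t a (i.removeNth z) x - fCleared p t a (i.removeNth z) x⁻¹) -
  (∑ j : Fin n, (sliceCoeff p t a (i.removeNth z) j (i.removeNth z j) *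
        ethe p (t * i.removeNth z j) x +
      sliceCoeff p t a (i.removeNth z) j (i.removeNth z j)⁻¹ *
        ethe p (t * (i.removeNth z j)⁻¹) x) *
      (oddTheta p x * (∏ l ∈ univ.erase j, ethe p x (i.removeNth z l)) *
        φ ((i.succAbove j).removeNth (Function.update z i x)))) -
  sliceDenom p (i.removeNth z) x * ψ (Function.update z i x)

variable (hp : ‖(p : ℂ)‖ < 1)
include hp

/-- The `i`-th summand yields an antisymmetrization because the denominator is odd in `x`. In the
other summands `x` enters through `e(z_j, x) = -e(x, z_j)`, whence the minus sign. -/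
theorem sliceNum_eq (φ : (Fin n → ℂˣ) → ℂ) (ψ : (Fin (n + 1) → ℂˣ) → ℂ)
    (z : Fin (n + 1) → ℂˣ) (i : Fin (n + 1)) (x : ℂˣ)
    (h : RegOff p ∅ (Function.update z i x)) :
    sliceNum p t a φ ψ z i x = (nablaFormula p t a φ (Function.update z i x) -
      ψ (Function.update z i x)) * sliceDenom p (i.removeNth z) x := by
  obtain ⟨hw, hx2, hxw⟩ := regOff_update h
  rw [nablaFormula_eq hp, Fin.sum_univ_succAbove _ i, Fin.removeNth_update, Function.update_self,
    sub_mul, add_mul, sliceNum]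
  have h1 := fTerm_mul (t := t) (a := a) hx2 hxw
  have h2 := fTerm_inv_mul (t := t) (a := a) hp hx2 hxw
  have h3 : ∀ j : Fin n,
      (fTerm p t a (Function.update z i x (i.succAbove j))
          ((i.succAbove j).removeNth (Function.update z i x)) +
        fTerm p t a (Function.update z i x (i.succAbove j))⁻¹
          ((i.succAbove j).removeNth (Function.update z i x))) *
        φ ((i.succAbove j).removeNth (Function.update z i x)) *
        sliceDenom p (i.removeNth z) x =
      -((sliceCoeff p t a (i.removeNth z) j (i.removeNth z j) *
        ethe p (t * i.removeNth z j) x +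
      sliceCoeff p t a (i.removeNth z) j (i.removeNth z j)⁻¹ *
        ethe p (t * (i.removeNth z j)⁻¹) x) *
      (oddTheta p x * (∏ l ∈ univ.erase j, ethe p x (i.removeNth z l)) *
        φ ((i.succAbove j).removeNth (Function.update z i x)))) := by
    intro j
    have hne := ethe_ne_zero_symm hp (hxw j)
    rw [Function.update_of_ne (Fin.succAbove_ne i j), fTerm_eq_of_coords, fTerm_eq_of_coords,
      sliceDenom, ← mul_prod_erase univ (fun l => ethe p x (i.removeNth z l)) (mem_univ j),
      ethe_swap hp x, ← i.removeNth_apply z j, ethe_inv_left hp]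
    simp only [sliceCoeff]
    field_simp
  rw [sum_mul, sum_congr rfl fun j _ => h3 j, sum_neg_distrib, sliceDenom]
  linear_combination (-φ (i.removeNth z)) * (h1 + h2)

theorem sliceDenom_mem_Th (w : Fin n → ℂˣ) : sliceDenom p w ∈ Th p (-1) (2 + n) := by
  have := Th.mul (oddTheta_mem_Th hp) (Th.prod univ fun l _ => ethe_mem_Th hp (w l))
  rw [card_univ, Fintype.card_fin, mul_one, mul_one] at this
  have h : sliceDenom p w = oddTheta p * ∏ l, fun u => ethe p u (w l) := by
    funext x; simp [sliceDenom, Finset.prod_apply]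
  rwa [h]

theorem sliceNum_mem_Th (hbal : t ^ (2 * n) * ∏ k, a k = 1) {φ : (Fin n → ℂˣ) → ℂ}
    {ψ : (Fin (n + 1) → ℂˣ) → ℂ} (hφ : φ ∈ H p r n) (hψ : ψ ∈ H p r (n + 1))
    (z : Fin (n + 1) → ℂˣ) (i : Fin (n + 1)) :
    sliceNum p t a φ ψ z i ∈ Th p (-1) (r + 2 + n) := by
  have h1 : (fun x => φ (i.removeNth z) * (fCleared p t a (i.removeNth z) x -
      fCleared p t a (i.removeNth z) x⁻¹)) ∈ Th p (-1) (r + 2 + n) :=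
    Submodule.smul_mem _ _ (sub_inv_mem_Th (holUnits_fCleared hp _) (fCleared_p_mul hp hbal _))
  have h3 : (fun x => sliceDenom p (i.removeNth z) x * ψ (Function.update z i x)) ∈
      Th p (-1) (r + 2 + n) := by
    have := Th.mul (sliceDenom_mem_Th hp (i.removeNth z)) (H.slice_mem hψ z i)
    rw [mul_one, show 2 + n + r = r + 2 + n by ring] at this
    exact this
  refine sub_mem (sub_mem h1 ?_) h3
  have h2 : ∀ j : Fin n, (fun x => (sliceCoeff p t a (i.removeNth z) j (i.removeNth z j) *
        ethe p (t * i.removeNth z j) x +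
      sliceCoeff p t a (i.removeNth z) j (i.removeNth z j)⁻¹ *
        ethe p (t * (i.removeNth z j)⁻¹) x) *
      (oddTheta p x * (∏ l ∈ univ.erase j, ethe p x (i.removeNth z l)) *
        φ ((i.succAbove j).removeNth (Function.update z i x)))) ∈ Th p (-1) (r + 2 + n) := by
    intro j
    have hj : 0 < n := j.pos
    obtain ⟨i', hi'⟩ := Fin.exists_succAbove_eq (Fin.succAbove_ne i j).symm
    have k1 := add_mem
      (Submodule.smul_mem _ (sliceCoeff p t a (i.removeNth z) j (i.removeNth z j))
        (ethe_mem_Th_right hp (t * i.removeNth z j)))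
      (Submodule.smul_mem _ (sliceCoeff p t a (i.removeNth z) j (i.removeNth z j)⁻¹)
        (ethe_mem_Th_right hp (t * (i.removeNth z j)⁻¹)))
    have k2 := Th.prod (univ.erase j) fun l _ => ethe_mem_Th hp (i.removeNth z l)
    cases n with
    | zero => exact j.elim0
    | succ m =>
      have k3 : (fun x => φ ((i.succAbove j).removeNth (Function.update z i x))) ∈ Th p 1 r := by
        have := H.slice_mem hφ ((i.succAbove j).removeNth z) i'
        simpa only [← Fin.removeNth_update_succAbove, hi'] using this
      have := Th.mul k1 (Th.mul (Th.mul (oddTheta_mem_Th hp) k2) k3)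
      rw [card_erase_of_mem (mem_univ j), card_univ, Fintype.card_fin, mul_one, mul_one, one_mul,
        mul_one, show 1 + (2 + (m + 1 - 1) + r) = r + 2 + (m + 1) by simp; ring] at this
      convert this using 1
      funext x
      simp [Finset.prod_apply]
  have := sum_mem (t := univ) fun j _ => h2 j
  convert this using 1
  funext x
  simp [Finset.sum_apply]

/-- At `x = w_k` only the `i`-th summand and the one with `j = k` survive. They carry the same value
of `φ`, because `φ` is symmetric, and they cancel; thus `∇φ` has no pole at `z_i = z_k`. -/
theorem sliceNum_eq_zero {φ : (Fin n → ℂˣ) → ℂ} (ψ : (Fin (n + 1) → ℂˣ) → ℂ) (hφ : φ ∈ H p r n)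
    (z : Fin (n + 1) → ℂˣ) (i : Fin (n + 1)) (hw : RegOff p ∅ (i.removeNth z)) (k : Fin n) :
    sliceNum p t a φ ψ z i (i.removeNth z k) = 0 := by
  have hD : sliceDenom p (i.removeNth z) (i.removeNth z k) = 0 := by
    rw [sliceDenom, prod_eq_zero (mem_univ k) (ethe_self hp _), mul_zero]
  have hφk : φ ((i.succAbove k).removeNth (Function.update z i (i.removeNth z k))) =
      φ (i.removeNth z) := by
    refine H.coords_eq hφ ?_
    rw [coords_removeNth_update, coords, ← insert_erase (mem_univ k),
      insert_val_of_notMem (notMem_erase k univ), Multiset.map_cons,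
      erase_insert (notMem_erase k univ)]
  rw [sliceNum, hD, zero_mul, sub_zero, sum_eq_single k]
  · have h1 := fTerm_erase_mul (t := t) (a := a) (hw.1 k) k fun l hl => hw.2.1 k l hl.symm
    have h2 := fTerm_erase_mul (t := t) (a := a) (u := (i.removeNth z k)⁻¹) (w := i.removeNth z)
      (theta_sq_inv_ne hp (hw.1 k)) k fun l hl => by
        rw [ethe_inv_left hp]; exact hw.2.1 k l hl.symm
    simp only [oddTheta_inv hp] at h2
    have h3 : ∏ l ∈ univ.erase k, ethe p (i.removeNth z k)⁻¹ (i.removeNth z l) =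
        ∏ l ∈ univ.erase k, ethe p (i.removeNth z k) (i.removeNth z l) :=
      prod_congr rfl fun l _ => ethe_inv_left hp _ _
    rw [h3] at h2
    rw [hφk, ← h1, ← h2, sliceCoeff, sliceCoeff]
    ring
  · intro j _ hj
    rw [prod_eq_zero (i := k) (by simp [hj.symm]) (ethe_self hp _)]
    ring
  · simp

/-- `∇φ - ψ` is determined on regular points by its values at `s` points in each variable. -/
theorem slicewiseDetermined_nabla_sub (hbal : t ^ (2 * n) * ∏ k, a k = 1) {φ : (Fin n → ℂˣ) → ℂ}
    {ψ : (Fin (n + 1) → ℂˣ) → ℂ} (hφ : φ ∈ H p r n) (hψ : ψ ∈ H p r (n + 1)) :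
    SlicewiseDetermined p (r + 1) ∅ fun z => nablaFormula p t a φ z - ψ z := by
  intro z i x hx hx0 y hy
  obtain ⟨hw, hy2, hyw⟩ := regOff_update hy
  -- The numerator is odd of degree `r + 2 + n` and has `n + (r + 1)` zeros, one fewer than the
  -- degree: the apparent poles and the given points.
  have hN : sliceNum p t a φ ψ z i = 0 := by
    refine Th.eq_zero_odd hp (ι := Fin n ⊕ Fin (r + 1)) (x := Sum.elim (i.removeNth z) x)
      (by simp; omega) (by omega) ?_ ?_ (sliceNum_mem_Th hp hbal hφ hψ z i) ?_
    · rintro (k | b) (k' | b') h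
      · exact hw.2.1 k k' fun h' => h (congrArg _ h')
      · exact ethe_ne_zero_symm hp ((regOff_update (hx0 b').1).2.2 k)
      · exact (regOff_update (hx0 b).1).2.2 k'
      · exact hx b b' fun h' => h (congrArg _ h')
    · rintro (k | b)
      · exact hw.1 k
      · exact (regOff_update (hx0 b).1).2.1
    · rintro (k | b)
      · exact sliceNum_eq_zero hp ψ hφ z i hw k
      · have := sliceNum_eq (t := t) (a := a) hp φ ψ z i (x b) (hx0 b).1
        exact this.trans (mul_eq_zero_of_left (hx0 b).2 _)
  have h := sliceNum_eq (t := t) (a := a) hp φ ψ z i y hy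
  rw [hN, Pi.zero_apply] at h
  refine (mul_eq_zero.1 h.symm).resolve_right ?_
  exact mul_ne_zero (mul_ne_zero y⁻¹.ne_zero hy2) (prod_ne_zero_iff.2 fun l _ => hyw l)

end Slices

/-! ### The value of `∇E_λ` at reference points -/

/-- The index `λ + ε_b`. -/
def Z.addSingle {s n : ℕ} (l : Z s n) (b : Fin s) : Z s (n + 1) :=
  ⟨l.1 + Pi.single b 1, by simp [sum_add_distrib, l.2]⟩

section Evaluation

variable {r n : ℕ} {p t : ℂˣ} {a : Fin ((r + 1) + (r + 3)) → ℂˣ}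

variable (p t a) in
/-- The value of `f_i^+` at a reference point for `λ + ε_b`, where `z_i` is the last coordinate
`t^{λ_b} a_b` of the `b`-th string. -/
noncomputable def topCoeff (l : Fin (r + 1) → ℕ) (b : Fin (r + 1)) : ℂ :=
  fHead p a (t ^ l b * firstParams a b) * ((refMs t (firstParams a) l).map fun v =>
    t * ethe p (t * (t ^ l b * firstParams a b)) v / ethe p (t ^ l b * firstParams a b) v).prod

variable (hp : ‖(p : ℂ)‖ < 1)
include hp

theorem fTerm_eq_zero {u : ℂˣ} {w : Fin n → ℂˣ} (h : t * u ∈ coords w) : fTerm p t a u w = 0 := by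
  obtain ⟨i, hi⟩ := mem_coords.1 h
  rw [fTerm, prod_eq_zero (mem_univ i), mul_zero]
  rw [hi, ethe_self hp, mul_zero, zero_div]

theorem fTerm_inv_eq_zero {u : ℂˣ} {w : Fin n → ℂˣ} (h : t⁻¹ * u ∈ coords w) :
    fTerm p t a u⁻¹ w = 0 := by
  obtain ⟨i, hi⟩ := mem_coords.1 h
  rw [fTerm, prod_eq_zero (mem_univ i), mul_zero]
  have : t * u⁻¹ = (t⁻¹ * u)⁻¹ := by rw [mul_inv, inv_inv]
  rw [hi, this, ethe_inv_left hp, ethe_self hp, mul_zero, zero_div]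

theorem fHead_inv_firstParams (b : Fin (r + 1)) : fHead p a (firstParams a b)⁻¹ = 0 := by
  rw [fHead, prod_eq_zero (mem_univ (Fin.castAdd (r + 3) b)), zero_div]
  rw [firstParams, mul_inv_cancel, theta_one hp]

omit hp in
theorem mem_coords_removeNth {z : Fin (n + 1) → ℂˣ} {x : ℂˣ} {i : Fin (n + 1)}
    (hx : x ∈ coords z) (hne : x ≠ z i) : x ∈ coords (i.removeNth z) := by
  rw [← coords_cons_removeNth z i, Multiset.mem_cons] at hx
  exact hx.resolve_left hne

/-- Write `z_i = t^k a_b`. A nonzero contribution requires `z_i` to be the top of its string, and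
removing it leaves the reference point of `ν - ε_b`, where `E_l` is a Kronecker delta. -/
theorem nabla_interp_eval {E : Z (r + 1) n → (Fin n → ℂˣ) → ℂ}
    (hE : IsInterpolationBasis p t (firstParams a) E) (hg : IsGeneric (n + 1) p t (firstParams a))
    (l : Z (r + 1) n) {ν : Fin (r + 1) → ℕ} (hν : ∑ i, ν i = n + 1) {z : Fin (n + 1) → ℂˣ}
    (hz : coords z = refMs t (firstParams a) ν) :
    nablaFormula p t a (E l) z =
      ∑ b, if l.1 + Pi.single b 1 = ν then topCoeff p t a l.1 b else 0 := by
  classical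
  -- This ensures that `t z_i` and `t⁻¹ z_i`, when they are coordinates, are not the one removed.
  have ht1 : t ≠ 1 := fun h => hg.pow_ne 1 le_rfl (by omega) 0 (by simp [h])
  obtain ⟨e, he⟩ := exists_labels t (firstParams a) hν hz
  have hterm : ∀ i, (fTerm p t a (z i) (i.removeNth z) + fTerm p t a (z i)⁻¹ (i.removeNth z)) *
      E l (i.removeNth z) =
      if ((e i).2 : ℕ) = l.1 (e i).1 ∧ l.1 + Pi.single (e i).1 1 = ν then
        topCoeff p t a l.1 (e i).1 else 0 := by
    intro i
    have hi := he i
    obtain ⟨b, k, hk⟩ : ∃ b, ∃ k : Fin (ν b), e i = ⟨b, k⟩ := ⟨_, _, rfl⟩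
    rw [hk] at hi ⊢
    simp only at hi ⊢
    -- At the bottom of a string `f_i^-` contains `θ(a_b / z_i) = θ(1)`; higher up, the coordinate
    -- `t⁻¹ z_i` gives a zero.
    have hminus : fTerm p t a (z i)⁻¹ (i.removeNth z) = 0 := by
      rcases Nat.eq_zero_or_pos (k : ℕ) with h0 | h0
      · rw [hi, h0, pow_zero, one_mul, fTerm, fHead_inv_firstParams hp, zero_mul]
      · have h1 : t⁻¹ * z i = t ^ ((k : ℕ) - 1) * firstParams a b := by
          obtain ⟨m, hm⟩ := Nat.exists_eq_succ_of_ne_zero h0.ne'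
          rw [hi, hm, Nat.succ_eq_add_one, Nat.add_sub_cancel, pow_succ', ← mul_assoc,
            ← mul_assoc, inv_mul_cancel, one_mul]
        refine fTerm_inv_eq_zero hp (mem_coords_removeNth ?_ ?_)
        · rw [h1, hz]
          exact (mem_refMs _ _).2 ⟨b, _, by omega, rfl⟩
        · simpa using ht1
    rw [hminus, add_zero]
    -- Below the top of the string, `t z_i` is another coordinate and `f_i^+` vanishes.
    rcases (Nat.succ_le_of_lt k.2).lt_or_eq with h1 | h1
    · rw [if_neg, fTerm_eq_zero hp, zero_mul]
      · refine mem_coords_removeNth ?_ (by simpa using ht1)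
        rw [hi, hz, ← mul_assoc, ← pow_succ']
        exact (mem_refMs _ _).2 ⟨b, _, h1, rfl⟩
      · rintro ⟨h2, h3⟩
        have := congrFun h3 b
        simp only [Pi.add_apply, Pi.single_eq_same] at this
        omega
    · obtain ⟨ν', hν'⟩ : ∃ ν' : Fin (r + 1) → ℕ, ν = ν' + Pi.single b 1 := by
        refine ⟨ν - Pi.single b 1, funext fun j => ?_⟩
        by_cases hj : j = b
        · subst hj; simp; omega
        · simp [hj]
      have hνb : (k : ℕ) = ν' b := by
        have := congrFun hν' b
        simp only [Pi.add_apply, Pi.single_eq_same] at this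
        omega
      have hco : coords (i.removeNth z) = refMs t (firstParams a) ν' := by
        rw [← coords_cons_removeNth z i, hν', refMs_add_single, hi, hνb] at hz
        exact (Multiset.cons_inj_right _).1 hz
      have hsum : ∑ i, ν' i = n := by
        rw [hν'] at hν
        simpa [sum_add_distrib] using hν
      have hiff : ((k : ℕ) = l.1 b ∧ l.1 + Pi.single b 1 = ν) ↔ l.1 = ν' := by
        refine ⟨fun h => add_right_cancel (h.2.trans hν'), fun h => ⟨?_, ?_⟩⟩
        · rw [h, hνb]
        · rw [h, hν']
      rw [hE.eval l hsum hco, if_congr hiff rfl rfl]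
      by_cases hl : l.1 = ν'
      · rw [if_pos hl, if_pos hl, mul_one, topCoeff, fTerm, hi, hνb,
          ← prod_map_coords _ fun v => (t : ℂ) *
            ethe p (t * (t ^ ν' b * firstParams a b)) v /
              ethe p (t ^ ν' b * firstParams a b) v, hco, hl]
      · rw [if_neg hl, if_neg hl, mul_zero]
  rw [nablaFormula_eq hp, sum_congr rfl fun i _ => hterm i]
  by_cases hex : ∃ b, l.1 + Pi.single b 1 = ν
  · obtain ⟨b, hb⟩ := hex
    have huniq : ∀ b', l.1 + Pi.single b' 1 = ν → b' = b := by
      intro b' hb'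
      have := congrFun (add_left_cancel (hb'.trans hb.symm)) b'
      by_contra hne
      rw [Pi.single_eq_same, Pi.single_eq_of_ne hne] at this
      exact one_ne_zero this
    have hlt : l.1 b < ν b := by rw [← hb]; simp
    rw [sum_eq_single (e.symm ⟨b, ⟨l.1 b, hlt⟩⟩), sum_eq_single b]
    · have h := e.apply_symm_apply ⟨b, ⟨l.1 b, hlt⟩⟩
      generalize e (e.symm ⟨b, ⟨l.1 b, hlt⟩⟩) = q at h
      subst h
      simp
    · intro b' _ hb'
      exact if_neg fun h => hb' (huniq b' h)
    · simp
    · intro i _ hi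
      refine if_neg fun h => hi ?_
      rw [Equiv.eq_symm_apply]
      have h1 := huniq _ h.2
      obtain ⟨b', k, hk⟩ : ∃ b, ∃ k : Fin (ν b), e i = ⟨b, k⟩ := ⟨_, _, rfl⟩
      rw [hk] at h h1 ⊢
      simp only at h h1
      subst h1
      exact congrArg _ (Fin.ext h.1)
    · simp
  · push Not at hex
    rw [sum_eq_zero fun i _ => if_neg fun h => hex _ h.2, sum_eq_zero fun b _ => if_neg (hex b)]

/-- The combination lies in `ℋ` by construction and agrees with `∇E_l` at all reference points,
hence at all regular points. Holomorphy of `∇E_l` need not be proved separately. -/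
theorem sum_topCoeff_mem_nablaImage {E : Z (r + 1) n → (Fin n → ℂˣ) → ℂ}
    {E' : Z (r + 1) (n + 1) → (Fin (n + 1) → ℂˣ) → ℂ}
    (hE : IsInterpolationBasis p t (firstParams a) E)
    (hE' : IsInterpolationBasis p t (firstParams a) E')
    (hg : IsGeneric (n + 1) p t (firstParams a)) (hbal : t ^ (2 * n) * ∏ k, a k = 1)
    (l : Z (r + 1) n) :
    ∑ b, topCoeff p t a l.1 b • E' (l.addSingle b) ∈ nablaImage n p t a := by
  have hψ : ∑ b, topCoeff p t a l.1 b • E' (l.addSingle b) ∈ H p r (n + 1) :=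
    sum_mem fun b _ => Submodule.smul_mem _ _ (hE'.mem _)
  refine ⟨hψ, E l, hE.mem l, fun z hz => (sub_eq_zero.1 ?_).symm⟩
  refine eq_zero_of_ref_of_slicewise hp hg (n + 1) le_rfl ∅ _ Set.countable_empty (by simp)
    (slicewiseDetermined_nabla_sub hp hbal (hE.mem l) hψ) (fun ν hν w hw => ?_) z
    (regOff_empty_iff.2 hz)
  rw [nabla_interp_eval hp hE hg l hν hw, Finset.sum_apply, sub_eq_zero]
  refine sum_congr rfl fun b _ => ?_
  rw [Pi.smul_apply, hE'.eval _ hν hw, smul_eq_mul, mul_ite, mul_one, mul_zero]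
  rfl

end Evaluation

/-! ### Renormalization by `K_μ` -/

theorem oddThetaFact_succ (p τ x : ℂˣ) (k : ℕ) :
    oddThetaFact p τ x (k + 1) = oddThetaFact p τ x k * oddTheta p (τ ^ k * x) :=
  prod_range_succ _ _

theorem prod_map_refMs {s : ℕ} (t : ℂˣ) (c : Fin s → ℂˣ) (μ : Fin s → ℕ) (g : ℂˣ → ℂ) :
    ((refMs t c μ).map g).prod = ∏ b, ∏ k ∈ range (μ b), g (t ^ k * c b) := by
  rw [refMs, ← Multiset.coe_mapAddMonoidHom, map_sum, Multiset.prod_sum]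
  refine prod_congr rfl fun b _ => ?_
  rw [Multiset.coe_mapAddMonoidHom, Multiset.map_map]
  rfl

/-- Only the pairs containing `b` change, and each `j ≠ b` occurs in exactly one of them. -/
theorem prod_prod_Ioi_update {s : ℕ} (G G' : Fin s → Fin s → ℂ) (R : Fin s → ℂ) (b : Fin s)
    (h : ∀ i j, i < j → G' i j = G i j * if i = b then R j else if j = b then R i else 1) :
    ∏ i, ∏ j ∈ Ioi i, G' i j = (∏ i, ∏ j ∈ Ioi i, G i j) * ∏ j ∈ univ.erase b, R j := by
  have h1 : ∏ i, ∏ j ∈ Ioi i, G' i j = (∏ i, ∏ j ∈ Ioi i, G i j) *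
      ∏ i, ∏ j ∈ Ioi i, if i = b then R j else if j = b then R i else 1 := by
    rw [← prod_mul_distrib]
    refine prod_congr rfl fun i _ => ?_
    rw [← prod_mul_distrib]
    exact prod_congr rfl fun j hj => h i j (mem_Ioi.1 hj)
  have h2 : ∀ i, (∏ j ∈ Ioi i, if i = b then R j else if j = b then R i else 1) =
      (if i = b then ∏ j ∈ Ioi b, R j else 1) * if i ∈ Iio b then R i else 1 := by
    intro i
    by_cases hi : i = b
    · subst hi; simp
    · simp only [hi, if_false, one_mul, prod_ite_eq', mem_Ioi, mem_Iio]
  rw [h1, prod_congr rfl fun i _ => h2 i, prod_mul_distrib, prod_ite_eq' univ b,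
    if_pos (mem_univ b), prod_ite_mem, univ_inter, ← prod_union]
  · congr 2
    ext j
    simp only [mem_union, mem_Ioi, mem_Iio, mem_erase, mem_univ, and_true]
    exact ⟨fun h => h.elim (fun h => h.ne') fun h => h.ne, fun h => (lt_or_gt_of_ne h).symm⟩
  · rw [disjoint_left]
    intro j hj hj'
    exact lt_asymm (mem_Ioi.1 hj) (mem_Iio.1 hj')

section NormK

variable {r : ℕ} (p τ : ℂˣ) (α : Fin ((r + 1) + (r + 3)) → ℂˣ)

theorem normK_add_single (l : Fin (r + 1) → ℕ) (b : Fin (r + 1)) :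
    normK p τ α (l + Pi.single b 1) = normK p τ α l *
      ((∏ j, oddTheta p (τ * (τ ^ l b * firstParams α b) / firstParams α j)) *
      (∏ j, oddTheta p (τ ^ l b * firstParams α b * restParams α j)) *
      ∏ j ∈ univ.erase b, oddTheta p (τ ^ l b * firstParams α b * (τ ^ l j * firstParams α j))) := by
  have hne : ∀ i ∈ univ.erase b, (l + Pi.single b 1 : Fin (r + 1) → ℕ) i = l i := by
    intro i hi
    simp [ne_of_mem_erase hi]
  have hb : (l + Pi.single b 1 : Fin (r + 1) → ℕ) b = l b + 1 := by simp
  have hfac' : ∀ (F : Fin (r + 1) → ℕ → ℂ) (c : ℂ), F b (l b + 1) = F b (l b) * c →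
      ∏ i, F i ((l + Pi.single b 1 : Fin (r + 1) → ℕ) i) = (∏ i, F i (l i)) * c := by
    intro F c hc
    rw [← mul_prod_erase univ _ (mem_univ b), ← mul_prod_erase univ (fun i => F i (l i)) (mem_univ b),
      hb, prod_congr rfl fun i hi => by rw [hne i hi], hc]
    ring
  rw [normK, normK, hfac' (fun i k => ∏ j, oddThetaFact p τ (τ * firstParams α i / firstParams α j) k)
      (∏ j, oddTheta p (τ * (τ ^ l b * firstParams α b) / firstParams α j)),
    hfac' (fun i k => ∏ j, oddThetaFact p τ (firstParams α i * restParams α j) k)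
      (∏ j, oddTheta p (τ ^ l b * firstParams α b * restParams α j)),
    prod_prod_Ioi_update (fun i j => oddThetaFact p τ (firstParams α i * firstParams α j) (l i + l j))
      _ (fun j => oddTheta p (τ ^ l b * firstParams α b * (τ ^ l j * firstParams α j))) b]
  · ring
  · intro i j hij
    by_cases hi : i = b
    · subst hi
      have hj : (Pi.single i 1 : Fin (r + 1) → ℕ) j = 0 := Pi.single_eq_of_ne hij.ne' _
      simp only [Pi.add_apply, Pi.single_eq_same, hj, add_zero, if_true]
      rw [add_right_comm, oddThetaFact_succ, pow_add, mul_mul_mul_comm]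
    · have hi' : (Pi.single b 1 : Fin (r + 1) → ℕ) i = 0 := Pi.single_eq_of_ne hi _
      by_cases hj : j = b
      · subst hj
        simp only [Pi.add_apply, Pi.single_eq_same, hi', add_zero, if_true, hi, if_false]
        rw [← add_assoc, oddThetaFact_succ, pow_add, mul_mul_mul_comm, mul_comm (τ ^ l i * _)]
      · simp [hi, hj]
  · rw [← prod_mul_distrib]
    exact prod_congr rfl fun j _ => by rw [oddThetaFact_succ, mul_assoc]
  · rw [← prod_mul_distrib]
    refine prod_congr rfl fun j _ => ?_
    rw [oddThetaFact_succ, mul_div_assoc, mul_left_comm, mul_div_assoc, mul_div_assoc]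

end NormK

section TopCoeff

variable {r n : ℕ} {p t : ℂˣ} {a : Fin ((r + 1) + (r + 3)) → ℂˣ} (hp : ‖(p : ℂ)‖ < 1)
include hp

omit hp in
-- Both theta quotients telescope along the string `c, tc, …, t^{m-1} c`.
theorem prod_theta_ratio {u c : ℂˣ} {m : ℕ} (h1 : ∀ k ≤ m, theta p (u * (t ^ k * c)) ≠ 0)
    (h2 : ∀ k ≤ m, theta p (t * u / (t ^ k * c)) ≠ 0) :
    ∏ k ∈ range m, (t * ethe p (t * u) (t ^ k * c) / ethe p u (t ^ k * c)) =
      theta p (u * (t ^ m * c)) * theta p (t * u / c) /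
        (theta p (u * c) * theta p (t * u / (t ^ m * c))) := by
  induction m with
  | zero =>
    have k1 := h1 0 le_rfl
    have k2 := h2 0 le_rfl
    simp only [pow_zero, one_mul] at k1 k2
    simp [div_self (mul_ne_zero k1 k2)]
  | succ m ih =>
    rw [prod_range_succ, ih (fun k hk => h1 k (by omega)) fun k hk => h2 k (by omega),
      ← theta_ratio_eq]
    have k0 := h1 0 (Nat.zero_le _)
    have k1 := h1 m (Nat.le_succ m)
    have k2 := h2 m (Nat.le_succ m)
    have k3 := h2 (m + 1) le_rfl
    have e1 : u * (t ^ (m + 1) * c) = t * u * (t ^ m * c) := by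
      rw [pow_succ]; ac_rfl
    have e2 : t * u / (t ^ (m + 1) * c) = u / (t ^ m * c) := by
      rw [pow_succ', mul_assoc, mul_div_mul_left_eq_div]
    rw [e2] at k3 ⊢
    rw [e1]
    rw [pow_zero, one_mul] at k0
    field_simp

/-- After telescoping, the factors `θ(u a_j)` cancel against the first `s` factors of the head. The
term `j = b` supplies `θ(u²)`, which cancels as well, and leaves `θ(t)` in the denominator. -/
theorem topCoeff_eq (hg : IsGeneric (n + 1) p t (firstParams a)) {l : Fin (r + 1) → ℕ}
    (hl : ∑ i, l i = n) (b : Fin (r + 1)) {u : ℂˣ} (hu : u = t ^ l b * firstParams a b) :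
    topCoeff p t a l b * (theta p t * (u : ℂ) ^ (r + 1) *
        ∏ j ∈ univ.erase b, theta p (t * u / (t ^ l j * firstParams a j))) =
      (∏ j, theta p (restParams a j * u)) *
        (∏ j ∈ univ.erase b, theta p (u * (t ^ l j * firstParams a j))) *
        ∏ j, theta p (t * u / firstParams a j) := by
  have hL := fun j => le_of_sum_eq hl j
  have h1 : ∀ j, ∀ k ≤ l j, theta p (u * (t ^ k * firstParams a j)) ≠ 0 := by
    intro j k hk
    have := hL j
    have := hL b
    rw [hu, mul_mul_mul_comm, ← pow_add]
    exact theta_ne_zero hp (hg.mul_ne b j _ (by omega))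
  have h2 : ∀ j, ∀ k ≤ l j, theta p (t * u / (t ^ k * firstParams a j)) ≠ 0 := by
    intro j k hk
    have e : t * u / (t ^ k * firstParams a j) =
        t ^ ((l b : ℤ) + 1 - k) * (firstParams a b / firstParams a j) := by
      rw [hu, ← mul_assoc, mul_div_mul_comm, zpow_sub, zpow_add_one, zpow_natCast, zpow_natCast,
        div_eq_mul_inv (t * _), mul_comm t]
    have hj := hL j
    have hb := hL b
    rw [e]
    refine hg.theta_div_ne hp ?_ (by rw [abs_le]; push_cast; omega)
    by_cases hjb : b = j
    · subst hjb; exact Or.inr (by omega)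
    · exact Or.inl hjb
  have hu0 : (u : ℂ) ≠ 0 := u.ne_zero
  have hprod : topCoeff p t a l b = fHead p a u *
      ∏ j, (theta p (u * (t ^ l j * firstParams a j)) * theta p (t * u / firstParams a j) /
        (theta p (u * firstParams a j) * theta p (t * u / (t ^ l j * firstParams a j)))) := by
    rw [topCoeff, ← hu, prod_map_refMs]
    congr 1
    exact prod_congr rfl fun j _ => prod_theta_ratio (h1 j) (h2 j)
  have hhead : ∏ k, theta p (a k * u) =
      (∏ j, theta p (u * firstParams a j)) * ∏ j, theta p (restParams a j * u) := by
    rw [Fin.prod_univ_add]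
    simp only [mul_comm u]
    rfl
  have hLb : t ^ l b * firstParams a b = u := hu.symm
  rw [hprod, fHead, hhead, prod_div_distrib, prod_mul_distrib, prod_mul_distrib,
    ← mul_prod_erase univ (fun j => theta p (u * (t ^ l j * firstParams a j))) (mem_univ b),
    ← mul_prod_erase univ (fun j => theta p (t * u / (t ^ l j * firstParams a j))) (mem_univ b),
    hLb, ← pow_two, mul_div_cancel_right]
  have k1 : ∏ j, theta p (u * firstParams a j) ≠ 0 := prod_ne_zero_iff.2 fun j _ => by
    simpa using h1 j 0 (Nat.zero_le _)
  have k2 : ∏ j ∈ univ.erase b, theta p (t * u / (t ^ l j * firstParams a j)) ≠ 0 :=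
    prod_ne_zero_iff.2 fun j _ => h2 j _ le_rfl
  have k3 : theta p (u ^ 2) ≠ 0 := by
    have := h1 b (l b) le_rfl
    rwa [hLb, ← pow_two] at this
  have k4 : theta p t ≠ 0 := by
    have := h2 b (l b) le_rfl
    rwa [hLb, mul_div_cancel_right] at this
  field_simp

end TopCoeff

section Renormalization

variable {r n : ℕ} {p t τ : ℂˣ} {a α : Fin ((r + 1) + (r + 3)) → ℂˣ}

/-- The factor of proportionality between the coefficients for `E_μ` and for `Ẽ_μ`. -/
noncomputable def renormConst (p t τ : ℂˣ) (α : Fin ((r + 1) + (r + 3)) → ℂˣ)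
    (l : Fin (r + 1) → ℕ) : ℂ :=
  (∏ j, (firstParams α j : ℂ)) * (∏ j, (restParams α j : ℂ))⁻¹ * (τ : ℂ)⁻¹ *
    ((∏ j, ((τ ^ l j * firstParams α j : ℂˣ) : ℂ)) ^ 2)⁻¹ * theta p t

/-- The numerator of `topCoeff` is the theta part of `K_{l+ε_b} / K_l`, and its denominator
reappears as odd theta functions. The point is that `renormConst` does not depend on `b`. -/
theorem normK_add_single_eq (hp : ‖(p : ℂ)‖ < 1) (hg : IsGeneric (n + 1) p t (firstParams a))
    (hτ : τ ^ 2 = t) (hα : ∀ k, α k ^ 2 = a k) {l : Fin (r + 1) → ℕ} (hl : ∑ i, l i = n)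
    (b : Fin (r + 1)) :
    normK p τ α (l + Pi.single b 1) = normK p τ α l * renormConst p t τ α l *
      topCoeff p t a l b * ∏ j ∈ univ.erase b,
        oddTheta p (τ * (τ ^ l b * firstParams α b) / (τ ^ l j * firstParams α j)) := by
  set U := τ ^ l b * firstParams α b with hU
  have hfp : ∀ j, firstParams α j ^ 2 = firstParams a j := fun j => hα _
  have hrp : ∀ j, restParams α j ^ 2 = restParams a j := fun j => hα _
  have hL : ∀ j, (τ ^ l j * firstParams α j) ^ 2 = t ^ l j * firstParams a j := fun j => by
    rw [mul_pow, hfp, ← hτ, ← pow_mul, ← pow_mul, mul_comm 2]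
  have htop := topCoeff_eq hp hg hl b (u := U ^ 2) (hL b)
  clear_value U
  have e1 : ∀ j, oddTheta p (τ * U / firstParams α j) =
      (firstParams α j : ℂ) * (((τ : ℂ) * U)⁻¹ * theta p (t * U ^ 2 / firstParams a j)) := by
    intro j
    rw [oddTheta, div_pow, mul_pow, hτ, hfp, inv_div, div_eq_mul_inv]
    simp only [Units.val_mul, Units.val_inv_eq_inv_val, mul_assoc]
  have e2 : ∀ j, oddTheta p (U * restParams α j) =
      (U : ℂ)⁻¹ * ((restParams α j : ℂ)⁻¹ * theta p (restParams a j * U ^ 2)) := by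
    intro j
    rw [oddTheta, mul_pow, hrp, mul_comm (U ^ 2)]
    simp only [Units.val_mul, Units.val_inv_eq_inv_val, mul_inv, mul_assoc]
  have e3 : ∀ j, oddTheta p (U * (τ ^ l j * firstParams α j)) =
      (U : ℂ)⁻¹ * (((τ ^ l j * firstParams α j : ℂˣ) : ℂ)⁻¹ *
        theta p (U ^ 2 * (t ^ l j * firstParams a j))) := by
    intro j
    rw [oddTheta, mul_pow, hL]
    simp only [Units.val_mul, Units.val_inv_eq_inv_val, mul_inv, mul_assoc]
  have e4 : ∀ j, oddTheta p (τ * U / (τ ^ l j * firstParams α j)) =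
      ((τ ^ l j * firstParams α j : ℂˣ) : ℂ) *
        (((τ : ℂ) * U)⁻¹ * theta p (t * U ^ 2 / (t ^ l j * firstParams a j))) := by
    intro j
    rw [oddTheta, div_pow, mul_pow, hτ, hL, inv_div, div_eq_mul_inv]
    simp only [Units.val_mul, Units.val_inv_eq_inv_val, mul_assoc]
  rw [normK_add_single, ← hU, renormConst,
    ← mul_prod_erase univ (fun j => ((τ ^ l j * firstParams α j : ℂˣ) : ℂ)) (mem_univ b), ← hU]
  simp only [e1, e2, e3, e4, prod_mul_distrib, prod_const, prod_inv_distrib, card_univ,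
    Fintype.card_fin, card_erase_of_mem (mem_univ b), Nat.add_sub_cancel]
  have hA : ∏ j, (firstParams α j : ℂ) ≠ 0 := prod_ne_zero_iff.2 fun j _ => Units.ne_zero _
  have hB : ∏ j, (restParams α j : ℂ) ≠ 0 := prod_ne_zero_iff.2 fun j _ => Units.ne_zero _
  have hΛ : ∏ j ∈ univ.erase b, ((τ ^ l j * firstParams α j : ℂˣ) : ℂ) ≠ 0 :=
    prod_ne_zero_iff.2 fun j _ => Units.ne_zero _
  have hU0 : (U : ℂ) ≠ 0 := U.ne_zero
  have hτ0 : (τ : ℂ) ≠ 0 := τ.ne_zero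
  simp only [Units.val_pow_eq_pow_val] at htop
  generalize ∏ j, (firstParams α j : ℂ) = A at *
  generalize ∏ j, (restParams α j : ℂ) = B at *
  generalize ∏ j ∈ univ.erase b, ((τ ^ l j * firstParams α j : ℂˣ) : ℂ) = Λ at *
  generalize ∏ j, theta p (t * U ^ 2 / firstParams a j) = X1 at *
  generalize ∏ j, theta p (restParams a j * U ^ 2) = X2 at *
  generalize ∏ j ∈ univ.erase b, theta p (U ^ 2 * (t ^ l j * firstParams a j)) = X3 at *
  generalize ∏ j ∈ univ.erase b, theta p (t * U ^ 2 / (t ^ l j * firstParams a j)) = X4 at *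
  generalize (U : ℂ) = V at *
  generalize (τ : ℂ) = T at *
  generalize theta p t = Y at *
  generalize topCoeff p t a l b = C at *
  field_simp
  -- The powers of `U` collected from all prefactors reduce to the `r` prefactors `(τU)⁻¹` of the
  -- remaining odd theta functions, so none is left in the constant.
  have hs : T * V ^ 2 * (1 / (T * V)) ^ (r + 1) * (1 / V) ^ (r + 3) * (1 / V) ^ r *
      (V ^ 2) ^ (r + 1) = (1 / (T * V)) ^ r := by
    rw [pow_succ (1 / (T * V)), pow_add (1 / V) r 3, ← pow_mul, mul_add, pow_add V, mul_comm 2 r,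
      pow_mul V r 2]
    simp only [one_div, inv_pow]
    field_simp
  linear_combination (-(normK p τ α l) * T * V ^ 2 * (1 / (T * V)) ^ (r + 1) *
    (1 / V) ^ (r + 3) * (1 / V) ^ r) * htop + normK p τ α l * C * Y * X4 * hs

end Renormalization

/-! ### The partial fraction identity of type `A` -/

theorem prod_erase_succAbove {M : Type*} [CommMonoid M] {n : ℕ} (k : Fin (n + 1)) (i : Fin n)
    (f : Fin (n + 1) → M) :
    ∏ j ∈ univ.erase (k.succAbove i), f j = f k * ∏ j ∈ univ.erase i, f (k.succAbove j) := by
  have h : univ.erase (k.succAbove i) =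
      insert k ((univ.erase i).map (Fin.succAboveEmb k)) := by
    ext j
    rcases eq_or_ne j k with rfl | hj
    · simp [(Fin.succAbove_ne j i).symm]
    · obtain ⟨j, rfl⟩ := Fin.exists_succAbove_eq hj
      simp [Fin.succAbove_ne]
  rw [h, prod_insert (by simp [Fin.succAbove_ne]), prod_map]
  rfl

section TypeA

variable {p : ℂˣ} (hp : ‖(p : ℂ)‖ < 1)
include hp

theorem oddTheta_one : oddTheta p 1 = 0 := by simp [oddTheta, theta_one hp]

theorem oddTheta_div_comm (x y : ℂˣ) : oddTheta p (x / y) = -oddTheta p (y / x) := by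
  rw [← inv_div, oddTheta_inv hp]

omit hp in
-- Two nodes `y` and `c / y` with fixed product `c` enter only through the variable `y² / c` of an
-- even function of degree one.
theorem oddTheta_mul_eq_ethe (x y c : ℂˣ) :
    oddTheta p (x / y) * oddTheta p (x / (c / y)) = ethe p (x ^ 2 / c) (y ^ 2 / c) := by
  have e1 : (x / y) ^ 2 = x ^ 2 / c / (y ^ 2 / c) := by rw [div_pow, div_div_div_cancel_right]
  have e2 : (x / (c / y)) ^ 2 = x ^ 2 / c * (y ^ 2 / c) := by
    rw [div_div_eq_mul_div, div_pow, mul_pow, div_mul_div_comm, pow_two c]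
  have e3 : (x ^ 2 / c)⁻¹ = (x / y)⁻¹ * (x / (c / y))⁻¹ := by
    rw [← mul_inv, div_mul_div_comm, mul_div_cancel, pow_two]
  rw [oddTheta, oddTheta, ethe, e1, e2, e3, Units.val_mul]
  ring

/-- The elliptic partial fraction identity of type `A`. -/
theorem sum_prod_oddTheta_eq_zero : ∀ (N : ℕ) (x y : Fin (N + 1) → ℂˣ),
    (∀ i j, i ≠ j → ∀ M : ℤ, x i ^ 2 / x j ^ 2 ≠ p ^ M) → ∏ i, x i = ∏ i, y i →
    ∑ i, (∏ j, oddTheta p (x i / y j)) / ∏ j ∈ univ.erase i, oddTheta p (x i / x j) = 0 := by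
  intro N
  induction N with
  | zero =>
    intro x y _ h
    simp only [Fin.prod_univ_succ, Fin.prod_univ_zero, mul_one] at h
    simp [h, oddTheta_one hp]
  | succ N ih =>
    intro x y hx hxy
    have hθ : ∀ i j, i ≠ j → oddTheta p (x i / x j) ≠ 0 := fun i j hij => by
      rw [oddTheta, div_pow]
      exact mul_ne_zero (Units.ne_zero _) (theta_ne_zero hp (hx i j hij))
    -- as a function of `Y`, where `Y = y₀² / (y₀ y₁)`
    set c := y 0 * y 1 with hc
    set rest : Fin N → ℂˣ := fun j => y j.succ.succ with hrest
    let co : Fin (N + 2) → ℂ := fun i => (∏ j, oddTheta p (x i / rest j)) /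
      ∏ j ∈ univ.erase i, oddTheta p (x i / x j)
    have hform : ∀ v : ℂˣ, ∀ i, co i * ethe p (x i ^ 2 / c) (v ^ 2 / c) =
        (∏ j, oddTheta p (x i / (Fin.cons v (Fin.cons (c / v) rest) : Fin (N + 2) → ℂˣ) j)) /
          ∏ j ∈ univ.erase i, oddTheta p (x i / x j) := by
      intro v i
      rw [Fin.prod_univ_succ, Fin.prod_univ_succ, ← oddTheta_mul_eq_ethe]
      simp only [Fin.cons_zero, Fin.cons_succ, co]
      ring
    let g : ℂˣ → ℂ := fun Y => ∑ i, co i * ethe p (x i ^ 2 / c) Y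
    have hgTh : g ∈ Th p 1 1 := by
      have : g = ∑ i, co i • fun Y => ethe p (x i ^ 2 / c) Y := by
        funext Y; simp [g, Finset.sum_apply]
      rw [this]
      exact sum_mem fun i _ => Submodule.smul_mem _ _ (ethe_mem_Th_right hp _)
    -- For `y_0 = x_k` the term `i = k` vanishes, and in the others `[x_i / x_k]` cancels. The rest
    -- is the identity with one node fewer.
    have hgx : ∀ k, g (x k ^ 2 / c) = 0 := by
      intro k
      have hIH := ih (fun i => x (k.succAbove i)) (Fin.cons (c / x k) rest)
        (fun i j hij => hx _ _ fun h => hij (Fin.succAbove_right_injective h)) (by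
          have hy2 : ∏ j, y j = c * ∏ j, rest j := by
            rw [Fin.prod_univ_succ, Fin.prod_univ_succ, ← mul_assoc]; rfl
          rw [Fin.prod_univ_succAbove _ k, hy2, mul_comm] at hxy
          rw [Fin.prod_cons, div_mul_eq_mul_div, eq_div_iff_mul_eq', ← hxy, mul_comm])
      rw [← hIH]
      simp only [g, hform]
      rw [Fin.sum_univ_succAbove _ k, Fin.prod_univ_succ]
      simp only [Fin.cons_zero, div_self', oddTheta_one hp, zero_mul, zero_div, zero_add]
      refine sum_congr rfl fun i _ => ?_
      have hne := hθ (k.succAbove i) k (Fin.succAbove_ne k i)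
      have herase : ∏ j ∈ univ.erase (k.succAbove i), oddTheta p (x (k.succAbove i) / x j) =
          oddTheta p (x (k.succAbove i) / x k) *
            ∏ j ∈ univ.erase i, oddTheta p (x (k.succAbove i) / x (k.succAbove j)) :=
        prod_erase_succAbove k i fun j => oddTheta p (x (k.succAbove i) / x j)
      rw [Fin.prod_univ_succ, Fin.cons_zero, herase]
      simp only [Fin.cons_succ]
      rw [mul_div_mul_left _ _ hne]
    have hg0 : g = 0 := by
      -- In degree one, two inequivalent zeros suffice. The quotients of the nodes `x_k²` are not in
      -- `p^ℤ`, so only the products of the points `x_k² / c` can make all pairs equivalent.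
      by_cases hpair : ∃ k k', k ≠ k' ∧ ethe p (x k ^ 2 / c) (x k' ^ 2 / c) ≠ 0
      · obtain ⟨k, k', -, hne⟩ := hpair
        refine Th.eq_zero_even hp le_rfl (ι := Fin 2) (by simp)
          (x := ![x k ^ 2 / c, x k' ^ 2 / c]) (fun i j hij => ?_) hgTh fun i => ?_
        · fin_cases i <;> fin_cases j
          · exact (hij rfl).elim
          · exact hne
          · exact ethe_ne_zero_symm hp hne
          · exact (hij rfl).elim
        · fin_cases i
          · exact hgx k
          · exact hgx k'
      · have hprod : ∀ k k', k ≠ k' → ∃ M : ℤ, x k ^ 2 / c * (x k' ^ 2 / c) = p ^ M := by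
          intro k k' hk
          by_contra! h
          refine hpair ⟨k, k', hk, ethe_ne_zero_iff.2 ⟨theta_ne_zero hp h, ?_⟩⟩
          rw [div_div_div_cancel_right]
          exact theta_ne_zero hp (hx k k' hk)
        cases N with
        | zero =>
          -- With two nodes, the product condition makes the two zeros inverse to each other, and
          -- the two terms cancel by oddness.
          have h2 : x 0 * x 1 = c := by
            simpa [Fin.prod_univ_succ, hc] using hxy
          have h3 : x 1 ^ 2 / c = (x 0 ^ 2 / c)⁻¹ := by
            rw [inv_div, ← h2, div_eq_div_iff_mul_eq_mul]
            simp only [pow_two]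
            ac_rfl
          have h4 : univ.erase (0 : Fin 2) = {1} := rfl
          have h5 : univ.erase (1 : Fin 2) = {0} := rfl
          funext Y
          change ∑ i : Fin 2, co i * ethe p (x i ^ 2 / c) Y = 0
          simp only [co, Fin.sum_univ_two, Fin.prod_univ_zero, h4, h5,
            prod_singleton, h3, ethe_inv_left hp]
          rw [oddTheta_div_comm hp (x 1)]
          ring
        | succ N =>
          -- With three or more nodes, two such products sharing a factor would put a quotient of
          -- nodes in `p^ℤ`.
          obtain ⟨M, hM⟩ := hprod ⟨0, by omega⟩ ⟨1, by omega⟩ (by simp)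
          obtain ⟨M', hM'⟩ := hprod ⟨0, by omega⟩ ⟨2, by omega⟩ (by simp [Fin.ext_iff])
          refine (hx ⟨1, by omega⟩ ⟨2, by omega⟩ (by simp [Fin.ext_iff]) (M - M') ?_).elim
          rw [zpow_sub, ← hM, ← hM', ← div_eq_mul_inv, mul_div_mul_left_eq_div,
            div_div_div_cancel_right]
    have hy : y = Fin.cons (y 0) (Fin.cons (c / y 0) rest) := by
      funext j
      refine Fin.cases rfl (fun j => Fin.cases ?_ (fun j => rfl) j) j
      simp [hc]
    rw [hy]
    have := congrFun hg0 (y 0 ^ 2 / c)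
    simp only [g, hform] at this
    exact this

end TypeA

/-! ### The recursion for the coefficients `R_{μ,ν}` -/

theorem prod_erase_last {M : Type*} [CommMonoid M] {r : ℕ} (f : Fin (r + 1) → M) :
    ∏ j ∈ univ.erase (Fin.last r), f j = ∏ j : Fin r, f j.castSucc := by
  rw [Fin.univ_castSuccEmb, erase_cons, prod_map]
  rfl

theorem oddThetaFact_succ' (p τ x : ℂˣ) (k : ℕ) :
    oddThetaFact p τ x (k + 1) = oddTheta p x * oddThetaFact p τ (τ * x) k := by
  rw [oddThetaFact, oddThetaFact, prod_range_succ', mul_comm, pow_zero, one_mul]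
  simp only [pow_succ, mul_assoc]

theorem zpow_sub_mul_div (τ x y : ℂˣ) (k k' : ℕ) :
    τ ^ ((k : ℤ) - k') * (x / y) = τ ^ k * x / (τ ^ k' * y) := by
  rw [zpow_sub, zpow_natCast, zpow_natCast, ← div_eq_mul_inv, div_mul_div_comm]

section Generic

variable {s N : ℕ} {p t τ : ℂˣ} {c α : Fin s → ℂˣ}

theorem IsGeneric.sq_div_sq_ne (hg : IsGeneric N p t c) (hτ : τ ^ 2 = t)
    (hα : ∀ k, α k ^ 2 = c k) {k k' : ℕ} (hk : k ≤ N) (hk' : k' ≤ N) {i j : Fin s} (h : i ≠ j)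
    (M : ℤ) : (τ ^ k * α i) ^ 2 / (τ ^ k' * α j) ^ 2 ≠ p ^ M := by
  have := hg.div_ne i j h (k - k') (by rw [abs_le]; omega) M
  rwa [zpow_sub_mul_div, ← hα, ← hα, ← hτ, pow_right_comm τ 2 k, pow_right_comm τ 2 k', ← mul_pow,
    ← mul_pow] at this

theorem IsGeneric.oddTheta_ne (hp : ‖(p : ℂ)‖ < 1) (hg : IsGeneric N p t c) (hτ : τ ^ 2 = t)
    (hα : ∀ k, α k ^ 2 = c k) {k k' : ℕ} (hk : k ≤ N) (hk' : k' ≤ N) {i j : Fin s}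
    (h : i ≠ j ∨ k ≠ k') : oddTheta p (τ ^ k * α i / (τ ^ k' * α j)) ≠ 0 := by
  have := hg.theta_div_ne hp (k := k - k') (h.imp_right fun h => by omega)
    (by rw [abs_le]; omega)
  rw [zpow_sub_mul_div, ← hα, ← hα, ← hτ, pow_right_comm τ 2 k, pow_right_comm τ 2 k', ← mul_pow,
    ← mul_pow, ← div_pow] at this
  exact mul_ne_zero (Units.ne_zero _) this

end Generic

section Recursion

variable {r : ℕ} (p τ : ℂˣ) (α : Fin (r + 1) → ℂˣ)

/-- The terms of the recursion for `R_{μ,ν}` in `ν`. -/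
noncomputable def recTerm (μ ν : Fin (r + 1) → ℕ) (b : Fin (r + 1)) : ℂ :=
  ((∏ j : Fin r, oddTheta p (τ ^ μ (Fin.last r) * α (Fin.last r) /
      (τ ^ μ j.castSucc * α j.castSucc))) *
    ∏ j, oddThetaFact p τ (τ * (τ ^ ν (Fin.last r) * α (Fin.last r) / (τ ^ μ j * α j)))
        (μ (Fin.last r) - ν (Fin.last r) - 1) /
      ∏ i : Fin r, oddThetaFact p τ (τ * (τ ^ μ i.castSucc * α i.castSucc / (τ ^ μ j * α j)))
        (ν i.castSucc - μ i.castSucc)) *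
  ((∏ j, oddTheta p (τ ^ ν b * α b / (τ ^ μ j * α j))) /
    ∏ j ∈ univ.erase b, oddTheta p (τ ^ ν b * α b / (τ ^ ν j * α j)))

variable {p τ α}

theorem coeffR_eq (μ ν : Fin (r + 1) → ℕ) : coeffR p τ α μ ν =
    (∏ j : Fin r, oddTheta p (τ ^ μ (Fin.last r) * α (Fin.last r) /
      (τ ^ μ j.castSucc * α j.castSucc))) /
    (∏ j : Fin r, oddTheta p (τ ^ ν (Fin.last r) * α (Fin.last r) /
      (τ ^ ν j.castSucc * α j.castSucc))) *
    ((∏ j, oddThetaFact p τ (τ ^ ν (Fin.last r) * α (Fin.last r) / (τ ^ μ j * α j))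
        (μ (Fin.last r) - ν (Fin.last r))) /
      ∏ j, ∏ i : Fin r,
        oddThetaFact p τ (τ * (τ ^ μ i.castSucc * α i.castSucc / (τ ^ μ j * α j)))
        (ν i.castSucc - μ i.castSucc)) := by
  rw [coeffR, prod_div_distrib, prod_div_distrib]
  simp only [zpow_add_one, mul_right_comm _ τ, zpow_sub_mul_div]
  simp only [mul_comm _ τ]

theorem coeffR_self (μ : Fin (r + 1) → ℕ) (h : ∀ j : Fin r, oddTheta p
    (τ ^ μ (Fin.last r) * α (Fin.last r) / (τ ^ μ j.castSucc * α j.castSucc)) ≠ 0) :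
    coeffR p τ α μ μ = 1 := by
  rw [coeffR_eq, div_self (prod_ne_zero_iff.2 fun j _ => h j)]
  simp [oddThetaFact]

/-- Split off the first factor of `[t^{ν_s-μ_j} a_s/a_j]_{μ_s-ν_s}`. It exists because `ν_s < μ_s`,
so the subtractions in `recTerm` are not truncated. -/
theorem coeffR_eq_recTerm {μ ν : Fin (r + 1) → ℕ} (h : ν (Fin.last r) < μ (Fin.last r)) :
    coeffR p τ α μ ν = recTerm p τ α μ ν (Fin.last r) := by
  obtain ⟨k, hk⟩ : ∃ k, μ (Fin.last r) - ν (Fin.last r) = k + 1 := ⟨_, (Nat.sub_add_cancel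
    (by omega)).symm⟩
  rw [coeffR_eq, recTerm, hk, Nat.add_sub_cancel, prod_erase_last, prod_div_distrib]
  simp only [oddThetaFact_succ', prod_mul_distrib]
  ring

/-- Raising `ν_b` adds to the denominators the factors `[t^{ν_b} a_b / (t^{μ_j} a_j)]`, which cancel
the numerator in `recTerm`. What remains is `R_{μ, λ+ε_s}` times the quotient of the coefficients of
`Ẽ_{λ+ε_b}` and `Ẽ_{λ+ε_s}` in the basic relation. -/
theorem recTerm_add_single (l : Fin (r + 1) → ℕ) {μ : Fin (r + 1) → ℕ} (b : Fin r)
    (hb : μ b.castSucc ≤ l b.castSucc)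
    (h1 : ∀ j, oddTheta p (τ ^ (l b.castSucc + 1) * α b.castSucc / (τ ^ μ j * α j)) ≠ 0)
    (h2 : ∀ j : Fin r, oddTheta p (τ ^ (l (Fin.last r) + 1) * α (Fin.last r) /
      (τ ^ l j.castSucc * α j.castSucc)) ≠ 0) :
    recTerm p τ α μ (l + Pi.single b.castSucc 1) b.castSucc =
      coeffR p τ α μ (l + Pi.single (Fin.last r) 1) *
        (∏ j : Fin r, oddTheta p (τ ^ (l (Fin.last r) + 1) * α (Fin.last r) /
          (τ ^ l j.castSucc * α j.castSucc))) /
        ∏ j ∈ univ.erase b.castSucc, oddTheta p (τ ^ (l b.castSucc + 1) * α b.castSucc /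
          (τ ^ l j * α j)) := by
  have eb : (l + Pi.single b.castSucc 1 : Fin (r + 1) → ℕ) b.castSucc = l b.castSucc + 1 := by simp
  have ebS : (l + Pi.single b.castSucc 1 : Fin (r + 1) → ℕ) (Fin.last r) = l (Fin.last r) := by
    simp [(Fin.castSucc_lt_last b).ne']
  have ebj : ∀ j ∈ univ.erase b.castSucc,
      (l + Pi.single b.castSucc 1 : Fin (r + 1) → ℕ) j = l j := fun j hj => by
    simp [ne_of_mem_erase hj]
  have eS : (l + Pi.single (Fin.last r) 1 : Fin (r + 1) → ℕ) (Fin.last r) = l (Fin.last r) + 1 := by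
    simp
  have eSj : ∀ j : Fin r, (l + Pi.single (Fin.last r) 1 : Fin (r + 1) → ℕ) j.castSucc =
      l j.castSucc := fun j => by simp [(Fin.castSucc_lt_last j).ne]
  have hfac : ∀ j, ∏ i : Fin r, oddThetaFact p τ
      (τ * (τ ^ μ i.castSucc * α i.castSucc / (τ ^ μ j * α j)))
      ((l + Pi.single b.castSucc 1 : Fin (r + 1) → ℕ) i.castSucc - μ i.castSucc) =
      (∏ i : Fin r, oddThetaFact p τ (τ * (τ ^ μ i.castSucc * α i.castSucc / (τ ^ μ j * α j)))
        (l i.castSucc - μ i.castSucc)) *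
        oddTheta p (τ ^ (l b.castSucc + 1) * α b.castSucc / (τ ^ μ j * α j)) := by
    intro j
    rw [← mul_prod_erase univ _ (mem_univ b), ← mul_prod_erase univ (fun i : Fin r =>
      oddThetaFact p τ (τ * (τ ^ μ i.castSucc * α i.castSucc / (τ ^ μ j * α j)))
        (l i.castSucc - μ i.castSucc)) (mem_univ b), eb, Nat.sub_add_comm hb, oddThetaFact_succ]
    have e : τ ^ (l b.castSucc - μ b.castSucc) *
        (τ * (τ ^ μ b.castSucc * α b.castSucc / (τ ^ μ j * α j))) =
        τ ^ (l b.castSucc + 1) * α b.castSucc / (τ ^ μ j * α j) := by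
      rw [← mul_assoc, ← pow_succ, ← mul_div_assoc, ← mul_assoc, ← pow_add,
        show l b.castSucc - μ b.castSucc + 1 + μ b.castSucc = l b.castSucc + 1 by omega]
    rw [e, prod_congr rfl fun i hi => by rw [ebj i.castSucc (by simpa using hi)]]
    ring
  rw [recTerm, coeffR_eq, prod_div_distrib, prod_congr rfl fun j _ => hfac j, prod_mul_distrib,
    eb, ebS, eS]
  have hden : ∏ j ∈ univ.erase b.castSucc, oddTheta p (τ ^ (l b.castSucc + 1) * α b.castSucc /
      (τ ^ (l + Pi.single b.castSucc 1 : Fin (r + 1) → ℕ) j * α j)) =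
      ∏ j ∈ univ.erase b.castSucc, oddTheta p (τ ^ (l b.castSucc + 1) * α b.castSucc /
        (τ ^ l j * α j)) := prod_congr rfl fun j hj => by rw [ebj j hj]
  rw [hden]
  simp only [eSj]
  have k1 := prod_ne_zero_iff.2 fun j (_ : j ∈ univ) => h1 j
  have k2 := prod_ne_zero_iff.2 fun j (_ : j ∈ univ) => h2 j
  rw [Nat.sub_sub]
  simp only [← mul_div_assoc, ← mul_assoc, ← pow_succ'] at k1 k2 ⊢
  generalize ∏ j, oddTheta p (τ ^ (l b.castSucc + 1) * α b.castSucc / (τ ^ μ j * α j)) = A at *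
  generalize ∏ j : Fin r, oddTheta p (τ ^ (l (Fin.last r) + 1) * α (Fin.last r) /
          (τ ^ l j.castSucc * α j.castSucc)) = B at *
  field_simp

/-- The type `A` identity for the square roots of `t^{ν_i} a_i` and `t^{μ_i} a_i`; their products
agree because `μ` and `ν` have the same sum. -/
theorem sum_recTerm (hp : ‖(p : ℂ)‖ < 1) {N : ℕ} {t : ℂˣ} {c : Fin (r + 1) → ℂˣ}
    (hg : IsGeneric N p t c) (hτ : τ ^ 2 = t) (hα : ∀ k, α k ^ 2 = c k) {μ ν : Fin (r + 1) → ℕ}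
    (hμ : ∑ i, μ i = N) (hν : ∑ i, ν i = N) : ∑ b, recTerm p τ α μ ν b = 0 := by
  simp only [recTerm]
  rw [← mul_sum, sum_prod_oddTheta_eq_zero hp r (fun i => τ ^ ν i * α i) fun i => τ ^ μ i * α i,
    mul_zero]
  · exact fun i j hij M => hg.sq_div_sq_ne hτ hα (le_of_sum_eq hν i) (le_of_sum_eq hν j) hij M
  · rw [prod_mul_distrib, prod_mul_distrib, prod_pow_eq_pow_sum, prod_pow_eq_pow_sum, hμ, hν]

/-- The factor `[1]` occurs. This disposes of the boundary indices `ν` for which `ν - ε_b` would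
leave the range of summation. -/
theorem recTerm_eq_zero (hp : ‖(p : ℂ)‖ < 1) {μ ν : Fin (r + 1) → ℕ} {b : Fin (r + 1)}
    (h : ν b = μ b) : recTerm p τ α μ ν b = 0 := by
  rw [recTerm, prod_eq_zero (i := b) (f := fun j => oddTheta p (τ ^ ν b * α b / (τ ^ μ j * α j)))
    (mem_univ b) (by rw [h, div_self', oddTheta_one hp])]
  simp

end Recursion

/-! ### The congruence -/

theorem Z.addSingle_injective {s n : ℕ} (b : Fin s) :
    Function.Injective fun l : Z s n => l.addSingle b := fun _ _ h =>
  Subtype.ext (add_right_cancel (congrArg Subtype.val h))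

theorem sum_addSingle {M : Type*} [AddCommMonoid M] {s n : ℕ} (b : Fin s) (f : Z s (n + 1) → M)
    (hf : ∀ ν, ν.1 b = 0 → f ν = 0) : ∑ l : Z s n, f (l.addSingle b) = ∑ ν, f ν := by
  refine (sum_map univ ⟨_, Z.addSingle_injective b⟩ f).symm.trans ?_
  refine sum_subset (subset_univ _) fun ν _ hν => hf ν ?_
  by_contra h0
  refine hν (mem_map.2 ⟨⟨ν.1 - Pi.single b 1, ?_⟩, mem_univ _, ?_⟩)
  · have h1 : Pi.single b 1 ≤ ν.1 := fun j => by
      by_cases hj : j = b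
      · subst hj; simpa using Nat.one_le_iff_ne_zero.2 h0
      · simp [hj]
    have h2 := ν.2
    rw [← tsub_add_cancel_of_le h1] at h2
    simpa [sum_add_distrib, -Pi.sub_apply] using h2
  · refine Subtype.ext (funext fun j => ?_)
    by_cases hj : j = b
    · subst hj
      simpa [Z.addSingle] using Nat.sub_add_cancel (Nat.one_le_iff_ne_zero.2 h0)
    · simp [Z.addSingle, hj]

section Main

variable {r n : ℕ} {p t τ : ℂˣ} {a α : Fin ((r + 1) + (r + 3)) → ℂˣ}

theorem sum_interpETilde_mem_nablaImage (hp : ‖(p : ℂ)‖ < 1) (hr : 1 ≤ r)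
    (hg : IsGeneric (n + 1) p t (firstParams a)) (hbal : t ^ (2 * n) * ∏ k, a k = 1)
    (hτ : τ ^ 2 = t) (hα : ∀ k, α k ^ 2 = a k) (l : Z (r + 1) n) :
    ∑ b, (∏ j ∈ univ.erase b, oddTheta p (τ ^ (l.1 b + 1) * firstParams α b /
      (τ ^ l.1 j * firstParams α j)))⁻¹ • interpETilde p t τ a α (l.addSingle b) ∈
      nablaImage n p t a := by
  have h := Submodule.smul_mem _ (normK p τ α l.1 * renormConst p t τ α l.1)
    (sum_topCoeff_mem_nablaImage hp (isInterpolationBasis_interpE hp hr (hg.mono (Nat.le_succ n)))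
      (isInterpolationBasis_interpE hp hr hg) hg hbal l)
  rw [smul_sum] at h
  convert h using 2 with b
  have hne : ∏ j ∈ univ.erase b, oddTheta p (τ ^ (l.1 b + 1) * firstParams α b /
      (τ ^ l.1 j * firstParams α j)) ≠ 0 := prod_ne_zero_iff.2 fun j hj =>
    hg.oddTheta_ne hp hτ (fun k => hα _) (Nat.succ_le_succ (le_of_sum_eq l.2 b))
      ((le_of_sum_eq l.2 j).trans (Nat.le_succ n)) (Or.inl (ne_of_mem_erase hj).symm)
  have hK := normK_add_single_eq hp hg hτ hα l.2 b
  simp only [← mul_assoc, ← pow_succ'] at hK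
  rw [interpETilde, smul_smul, smul_smul]
  congr 1
  change _ * normK p τ α (l.1 + Pi.single b 1) = _
  rw [hK]
  field_simp

variable (r n p t τ a α) in
/-- The right hand side of the transformation, as a sum over all indices. -/
noncomputable def coeffRSum (μ : Z (r + 1) n) (l : ℕ) : (Fin n → ℂˣ) → ℂ :=
  ∑ ν : Z (r + 1) n with
    ν.1 (Fin.last r) = μ.1 (Fin.last r) - l ∧ ∀ j : Fin r, μ.1 j.castSucc ≤ ν.1 j.castSucc,
    coeffR p τ (firstParams α) μ.1 ν.1 • interpETilde p t τ a α ν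

/-- For `l = 0` every part of `ν` is at least that of `μ`; the sums agree, so only `ν = μ` occurs.
-/
theorem coeffRSum_zero (hp : ‖(p : ℂ)‖ < 1) (hg : IsGeneric n p t (firstParams a))
    (hτ : τ ^ 2 = t) (hα : ∀ k, α k ^ 2 = a k) (μ : Z (r + 1) n) :
    coeffRSum r n p t τ a α μ 0 = interpETilde p t τ a α μ := by
  have hS : univ.filter (fun ν : Z (r + 1) n => ν.1 (Fin.last r) = μ.1 (Fin.last r) - 0 ∧
      ∀ j : Fin r, μ.1 j.castSucc ≤ ν.1 j.castSucc) = {μ} := by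
    ext ν
    simp only [mem_filter, mem_univ, true_and, mem_singleton, Nat.sub_zero]
    refine ⟨fun ⟨h1, h2⟩ => ?_, fun h => by simp [h]⟩
    have hle : ∀ j ∈ univ, μ.1 j ≤ ν.1 j := fun j _ => Fin.lastCases h1.ge h2 j
    have := (sum_eq_sum_iff_of_le hle).1 (μ.2.trans ν.2.symm)
    exact Subtype.ext (funext fun j => (this j (mem_univ j)).symm)
  rw [coeffRSum, hS, sum_singleton, coeffR_self, one_smul]
  exact fun j => hg.oddTheta_ne hp hτ (fun k => hα _) (le_of_sum_eq μ.2 _) (le_of_sum_eq μ.2 _)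
    (Or.inl (Fin.castSucc_lt_last j).ne')

/-- The difference is a sum of multiples of the basic relation, one for each `ξ` such that `ξ + ε_s`
occurs at level `l`. The relation replaces `Ẽ_{ξ+ε_s}` by the `Ẽ_{ξ+ε_b}` with `b < s`, which belong
to level `l + 1`. -/
theorem coeffRSum_sub_mem (hp : ‖(p : ℂ)‖ < 1) (hr : 1 ≤ r)
    (hg : IsGeneric (n + 1) p t (firstParams a)) (hbal : t ^ (2 * n) * ∏ k, a k = 1)
    (hτ : τ ^ 2 = t) (hα : ∀ k, α k ^ 2 = a k) (μ : Z (r + 1) (n + 1)) {l : ℕ}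
    (hl : l + 1 ≤ μ.1 (Fin.last r)) :
    coeffRSum r (n + 1) p t τ a α μ l - coeffRSum r (n + 1) p t τ a α μ (l + 1) ∈
      nablaImage n p t a := by
  classical
  set β := firstParams α with hβ
  have hβ2 : ∀ k, β k ^ 2 = firstParams a k := fun k => hα _
  set E := interpETilde (n := n + 1) p t τ a α with hE
  let D : Finset (Z (r + 1) n) := univ.filter fun ξ =>
    ξ.1 (Fin.last r) + 1 = μ.1 (Fin.last r) - l ∧ ∀ j : Fin r, μ.1 j.castSucc ≤ ξ.1 j.castSucc
  have hT : coeffRSum r (n + 1) p t τ a α μ l = ∑ ξ ∈ D,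
      coeffR p τ β μ.1 (ξ.addSingle (Fin.last r)).1 • E (ξ.addSingle (Fin.last r)) := by
    rw [coeffRSum, sum_filter, ← sum_addSingle (Fin.last r), sum_filter]
    · refine sum_congr rfl fun ξ _ => ?_
      simp [Z.addSingle, (Fin.castSucc_lt_last _).ne]
      rfl
    · intro ν hν
      rw [if_neg]
      omega
  have hT' : coeffRSum r (n + 1) p t τ a α μ (l + 1) = -∑ ξ ∈ D, ∑ b : Fin r,
      recTerm p τ β μ.1 (ξ.addSingle b.castSucc).1 b.castSucc • E (ξ.addSingle b.castSucc) := by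
    have h1 : ∀ b : Fin r, ∑ ξ ∈ D,
        recTerm p τ β μ.1 (ξ.addSingle b.castSucc).1 b.castSucc • E (ξ.addSingle b.castSucc) =
        ∑ ν : Z (r + 1) (n + 1) with ν.1 (Fin.last r) = μ.1 (Fin.last r) - (l + 1) ∧
          ∀ j : Fin r, μ.1 j.castSucc ≤ ν.1 j.castSucc,
          recTerm p τ β μ.1 ν.1 b.castSucc • E ν := by
      intro b
      -- Terms with `ν_b = μ_b` vanish, so `ν_b > μ_b` may be imposed, and then `ν - ε_b` runs
      -- exactly over `D`.
      have h2 : ∀ ν : Z (r + 1) (n + 1), (if ν.1 (Fin.last r) = μ.1 (Fin.last r) - (l + 1) ∧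
          ∀ j : Fin r, μ.1 j.castSucc ≤ ν.1 j.castSucc then
          recTerm p τ β μ.1 ν.1 b.castSucc • E ν else 0) =
          if (ν.1 (Fin.last r) = μ.1 (Fin.last r) - (l + 1) ∧
          ∀ j : Fin r, μ.1 j.castSucc ≤ ν.1 j.castSucc) ∧ μ.1 b.castSucc < ν.1 b.castSucc then
          recTerm p τ β μ.1 ν.1 b.castSucc • E ν else 0 := by
        intro ν
        by_cases h : μ.1 b.castSucc < ν.1 b.castSucc
        · simp only [h, and_true]
        · rw [eq_comm, if_neg fun h' => h h'.2, eq_comm, ite_eq_right_iff]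
          intro h'
          rw [recTerm_eq_zero hp (le_antisymm (not_lt.1 h) (h'.2 b)), zero_smul]
      rw [eq_comm, sum_filter, sum_congr rfl fun ν _ => h2 ν, ← sum_addSingle b.castSucc, eq_comm, sum_filter]
      · refine sum_congr rfl fun ξ _ => ?_
        congr 1
        have e1 : (ξ.addSingle b.castSucc).1 (Fin.last r) = ξ.1 (Fin.last r) := by
          simp [Z.addSingle, (Fin.castSucc_lt_last b).ne']
        have e2 : (ξ.addSingle b.castSucc).1 b.castSucc = ξ.1 b.castSucc + 1 := by
          simp [Z.addSingle]
        have e3 : ∀ j, j ≠ b → (ξ.addSingle b.castSucc).1 j.castSucc = ξ.1 j.castSucc :=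
          fun j hj => by simp [Z.addSingle, hj]
        rw [e1, e2, eq_iff_iff]
        constructor
        · rintro ⟨h3, h4⟩
          refine ⟨⟨by omega, fun j => ?_⟩, Nat.lt_succ_of_le (h4 b)⟩
          by_cases hj : j = b
          · rw [hj, e2]; exact (h4 b).trans (Nat.le_succ _)
          · rw [e3 j hj]; exact h4 j
        · rintro ⟨⟨h3, h4⟩, h5⟩
          refine ⟨by omega, fun j => ?_⟩
          by_cases hj : j = b
          · rw [hj]; exact Nat.le_of_lt_succ h5
          · rw [← e3 j hj]; exact h4 j
      · intro ν hν
        rw [if_neg]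
        omega
    rw [sum_comm, sum_congr rfl fun b _ => h1 b, sum_comm, coeffRSum, ← sum_neg_distrib]
    refine sum_congr rfl fun ν hν => ?_
    have hνS := (mem_filter.1 hν).2.1
    -- The partial fraction identity isolates the term `b = s`, which is `R_{μ,ν}`.
    have hsum := sum_recTerm hp hg hτ hβ2 μ.2 ν.2
    rw [Fin.sum_univ_castSucc, ← coeffR_eq_recTerm (by omega)] at hsum
    rw [← sum_smul, ← neg_smul, eq_neg_of_add_eq_zero_right hsum]
  rw [hT, hT', sub_neg_eq_add, ← sum_add_distrib]
  refine sum_mem fun ξ hξ => ?_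
  obtain ⟨hξS, hξj⟩ := (mem_filter.1 hξ).2
  have hle := fun j => le_of_sum_eq ξ.2 j
  have hne : ∀ b, ∀ j, b ≠ j →
      oddTheta p (τ ^ (ξ.1 b + 1) * β b / (τ ^ ξ.1 j * β j)) ≠ 0 := fun b j hj =>
    hg.oddTheta_ne hp hτ hβ2 (Nat.succ_le_succ (hle b)) ((hle j).trans (Nat.le_succ n)) (Or.inl hj)
  -- The relation is scaled so that `Ẽ_{ξ+ε_s}` has coefficient `R_{μ, ξ+ε_s}`.
  have h := Submodule.smul_mem _ (coeffR p τ β μ.1 (ξ.addSingle (Fin.last r)).1 *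
      ∏ j : Fin r, oddTheta p (τ ^ (ξ.1 (Fin.last r) + 1) * β (Fin.last r) /
          (τ ^ ξ.1 j.castSucc * β j.castSucc)))
    (sum_interpETilde_mem_nablaImage hp hr hg hbal hτ hα ξ)
  rw [Fin.sum_univ_castSucc, add_comm (Finset.sum _ _), smul_add, smul_sum, prod_erase_last, smul_smul,
    mul_inv_cancel_right₀ (prod_ne_zero_iff.2 fun j _ => hne _ _ (Fin.castSucc_lt_last j).ne')] at h
  convert h using 3 with b
  rw [smul_smul]
  congr 1
  refine recTerm_add_single ξ.1 b (hξj b) (fun j => ?_) fun j => hne _ _ (Fin.castSucc_lt_last j).ne'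
  refine hg.oddTheta_ne hp hτ hβ2 (Nat.succ_le_succ (hle _)) (le_of_sum_eq μ.2 j) ?_
  by_cases hj : b.castSucc = j
  · exact Or.inr (by rw [← hj]; exact (Nat.lt_succ_of_le (hξj b)).ne')
  · exact Or.inl hj

theorem psiCongr_coeffRSum (hp : ‖(p : ℂ)‖ < 1) (hr : 1 ≤ r)
    (hg : IsGeneric (n + 1) p t (firstParams a)) (hbal : t ^ (2 * n) * ∏ k, a k = 1)
    (hτ : τ ^ 2 = t) (hα : ∀ k, α k ^ 2 = a k) (μ : Z (r + 1) (n + 1)) (l : ℕ)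
    (hl : l ≤ μ.1 (Fin.last r)) :
    PsiCongr p t a (interpETilde p t τ a α μ) (coeffRSum r (n + 1) p t τ a α μ l) := by
  induction l with
  | zero =>
    rw [PsiCongr, coeffRSum_zero hp hg hτ hα, sub_self]
    exact zero_mem _
  | succ l ih =>
    rw [PsiCongr, ← sub_add_sub_cancel]
    exact add_mem (ih (by omega)) (coeffRSum_sub_mem hp hr hg hbal hτ hα μ hl)

end Main

end EllipticBC


open EllipticBC

theorem theorem3p1 (r n : ℕ) (hr : 1 ≤ r) (p t : ℂˣ) (hp : ‖(p : ℂ)‖ < 1)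
    (a : Fin ((r + 1) + (r + 3)) → ℂˣ)
    (hbal : t ^ (2 * (n + 1) - 2) * ∏ k, a k = 1)
    (hgen : IsGeneric (n + 1) p t (firstParams a))
    (τ : ℂˣ) (hτ : τ ^ 2 = t)
    (α : Fin ((r + 1) + (r + 3)) → ℂˣ) (hα : ∀ k, α k ^ 2 = a k) :
    IsInterpolationBasis (n := n + 1) p t (firstParams a) (interpE p t (firstParams a)) ∧
    ∀ (μ : Z (r + 1) (n + 1)) (l : ℕ), l ≤ μ.1 (Fin.last r) →
      PsiCongr p t a (interpETilde p t τ a α μ)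
        (∑ ν : Z (r + 1) (n + 1) with
          ν.1 (Fin.last r) = μ.1 (Fin.last r) - l ∧ ∀ j : Fin r, μ.1 j.castSucc ≤ ν.1 j.castSucc,
          coeffR p τ (firstParams α) μ.1 ν.1 • interpETilde p t τ a α ν) :=
  ⟨isInterpolationBasis_interpE hp hr hgen, fun μ l hl =>
    psiCongr_coeffRSum hp hr hgen (by simpa [mul_add] using hbal) hτ hα μ l hl⟩
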